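/- **Setting.** A fermionic (bosonic) spin system on $\mathbb R^2$ is given by a countable set of sites $\Lambda\to\mathbb R^2$ that is uniformly locally finite (the number of sites in a unit ball is bounded) and a finite number of modes per site, the same at all sites; the on-site space is the ($\mathbb Z/2$-graded) Fock space of that many fermionic modes (respectively the trivially graded space of that many qubits). For $X\subset\mathbb R^2$, $\mathcal A_X$ is the $C^*$-algebra generated by the (graded) tensor product of the on-site matrix algebras of the sites in $X$; $\mathcal A=\mathcal A_{\mathbb R^2}$, and $\eta$ is the grading automorphism of $\mathcal A$ (the identity for bosons). An automorphism is graded if it commutes with $\eta$. An automorphism of $\mathcal A_X$ is identified with its extension to $\mathcal A$ that acts trivially on $\mathcal A_{X^c}$. The stack of two systems has the algebra $\mathcal A_1\otimes\mathcal A_2$ (graded tensor product), and $(\Psi_1\otimes\Psi_2)(xy)=\Psi_1(x)\Psi_2(y)$. A trivial state is a tensor product over the sites of vector states given by even unit vectors; a trivial extension of a state is its stack with a trivial state. Two states are unitarily equivalent if their GNS representations are, and $(\Psi\alpha)(x)=\Psi(\alpha(x))$. A cone is an open sector of $\mathbb R^2$ (an apex and an open interval of directions, of angle less than $2\pi$);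 its boundary is the boundary of its closure, and it is generic if no site lies on its boundary. A good conical partition consists of generic cones $A_0,\dots,A_n$, $B_{01},\dots,B_{n0}$ ($n\ge1$) with the same apex such that the $A_a$ are disjoint, follow each other counterclockwise and have a union that is dense in $\mathbb R^2$, the closures of the $B_{a(a+1)}$ pairwise intersect only at the apex, and $B_{a(a+1)}$ contains the open half-line separating $A_a$ and $A_{a+1}$. An automorphism is associated with the partition if it is a product $\prod_a\beta_a\prod_a\beta_{a(a+1)}$ of automorphisms $\beta_a$ of $\mathcal A_{A_a}$ and $\beta_{a(a+1)}$ of $\mathcal A_{B_{a(a+1)}}$. Two states $\Psi_0,\Psi_1$ are in the same phase if for every good conical partition there are trivial extensions $\tilde\Psi_0,\tilde\Psi_1$ over the same system (up to an isomorphism preserving grading and localization) and a graded automorphism $\alpha$ associated with the partition such that $\tilde\Psi_0\alpha$ is unitarily equivalent to $\tilde\Psi_1$. The trivial phase is the phase of the trivial states. A state $\Psi$ is invertible if there is a state $\Psi'$ over another spin system (of the same kind, fermionic or bosonic) such that $\Psi\otimes\Psi'$ is a state in the trivial phase. **Lemma.** Let $\Psi$ be a pure invertible state over a (fermionic or bosonic)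 spin system $\mathcal A$ on $\mathbb R^2$. Let $B_L$, $B_R$ be disjoint cones with a common apex whose boundaries intersect only at that apex, and let $\beta_L$, $\beta_R$ be automorphisms of $\mathcal A_{B_L}$ and $\mathcal A_{B_R}$, respectively, such that $\Psi\beta_L$ and $\Psi\beta_R$ are unitarily equivalent to $\Psi$. Let $\Theta$, $U_L$, $U_R$ be unitary operators implementing $\eta$, $\beta_L$, $\beta_R$, respectively, in the GNS representation $\pi_\Psi$, i.e. $\pi_\Psi(\eta(x))=\Theta\pi_\Psi(x)\Theta^*$, $\pi_\Psi(\beta_{L,R}(x))=U_{L,R}\,\pi_\Psi(x)\,U_{L,R}^*$ for all $x\in\mathcal A$. Then: 1. If $\beta_L$ is graded, or there is a site outside $B_L$, there is a unique $\varepsilon_L\in\{0,1\}$ with $\Theta U_L=(-1)^{\varepsilon_L}U_L\Theta$; likewise for $R$. 2. Whenever $\varepsilon_L,\varepsilon_R\in\{0,1\}$ satisfy $\Theta U_L=(-1)^{\varepsilon_L}U_L\Theta$ and $\Theta U_R=(-1)^{\varepsilon_R}U_R\Theta$, we have $U_LU_R=(-1)^{\varepsilon_L\varepsilon_R}U_RU_L$.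 -/

import Mathlib

open scoped ComplexOrder InnerProductSpace

namespace Spin

noncomputable section

/-! ## Fock space and its generators -/

/-- Whether the elementary degrees of freedom anticommute or commute at distinct sites. -/
inductive Statistics where
  | fermionic
  | bosonic

/-- `ℓ²` over the finite subsets of `M`: the Hilbert space with orthonormal basis `e_S`, where
`S` is the finite set of occupied modes. -/
abbrev Fock (M : Type) : Type := lp (fun _ : Finset M => ℂ) 2

theorem memlp_weighted {ι : Type} (σ : Equiv.Perm ι) (w : ι → ℂ) (hw : ∀ i, ‖w i‖ = 1)
    (f : lp (fun _ : ι => ℂ) 2) :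
    Memℓp (fun i => w (σ.symm i) * f (σ.symm i) : ∀ _ : ι, ℂ) 2 := by
  have h2 : 0 < (2 : ENNReal).toReal := by norm_num
  rw [memℓp_gen_iff h2]
  have h := (memℓp_gen_iff h2).1 (lp.memℓp f)
  simpa [hw, Function.comp_def] using (σ.symm.summable_iff).2 h

/-- The operator `e_i ↦ w i • e_{σ i}` on `ℓ²(ι)`, where `σ` is a permutation and the weights
`w i` have modulus one. -/
def weightedPerm {ι : Type} (σ : Equiv.Perm ι) (w : ι → ℂ) (hw : ∀ i, ‖w i‖ = 1) :
    lp (fun _ : ι => ℂ) 2 →L[ℂ] lp (fun _ : ι => ℂ) 2 :=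
  LinearMap.mkContinuous
    { toFun := fun f => ⟨fun i => w (σ.symm i) * f (σ.symm i), memlp_weighted σ w hw f⟩
      map_add' := fun f g => by ext i; exact mul_add _ _ _
      map_smul' := fun c f => by ext i; simp [mul_left_comm] }
    1 (fun f => by
      have h2 : 0 < (2 : ENNReal).toReal := by norm_num
      refine le_of_eq ?_
      rw [one_mul, lp.norm_eq_tsum_rpow h2, lp.norm_eq_tsum_rpow h2]
      congr 1
      simpa [hw] using (σ.symm.tsum_eq fun i => ‖f i‖ ^ (2 : ENNReal).toReal))

@[simp]
theorem weightedPerm_apply {ι : Type} (σ : Equiv.Perm ι) (w : ι → ℂ) (hw : ∀ i, ‖w i‖ = 1)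
    (f : lp (fun _ : ι => ℂ) 2) (i : ι) :
    weightedPerm σ w hw f i = w (σ.symm i) * f (σ.symm i) := rfl

/-- Flip the occupation of the mode `m`: `S ↦ S ∆ {m}`. -/
def toggle {M : Type} [LinearOrder M] (m : M) : Equiv.Perm (Finset M) :=
  (symmDiff_left_involutive ({m} : Finset M)).toPerm

/-- The Jordan-Wigner sign `(-1)^{#{k ∈ S : k < m}}` for fermions, and `1` for bosons. -/
def stringSign (κ : Statistics) {M : Type} [LinearOrder M] (m : M) (S : Finset M) : ℂ :=
  match κ with
  | .fermionic => (-1) ^ (S.filter (· < m)).card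
  | .bosonic => 1

/-- The fermion parity `(-1)^{#S}` for fermions, and `1` for bosons. -/
def paritySign (κ : Statistics) {M : Type} (S : Finset M) : ℂ :=
  match κ with
  | .fermionic => (-1) ^ S.card
  | .bosonic => 1

theorem norm_stringSign (κ : Statistics) {M : Type} [LinearOrder M] (m : M) (S : Finset M) :
    ‖stringSign κ m S‖ = 1 := by
  cases κ <;> simp [stringSign]

theorem norm_paritySign (κ : Statistics) {M : Type} (S : Finset M) :
    ‖paritySign κ S‖ = 1 := by
  cases κ <;> simp [paritySign]

/-- The weight with which the generator `(m, b)` maps `e_S` to `e_{S ∆ {m}}`. -/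
def genWeight (κ : Statistics) {M : Type} [LinearOrder M] (m : M) (b : Bool) (S : Finset M) : ℂ :=
  stringSign κ m S * (if b then (if m ∈ S then -Complex.I else Complex.I) else 1)

theorem norm_genWeight (κ : Statistics) {M : Type} [LinearOrder M] (m : M) (b : Bool)
    (S : Finset M) : ‖genWeight κ m b S‖ = 1 := by
  unfold genWeight
  rw [norm_mul, norm_stringSign]
  split_ifs <;> simp

/-- The self-adjoint unitary generators attached to a mode `m`.
Fermions: `gen m false` and `gen m true` are the two Majorana operators of the mode `m`
(all these operators square to `1` and pairwise anticommute).
Bosons: they are the Pauli matrices `X` and `Y` of the qubit `m` (generators that belong to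
different qubits commute). -/
def gen (κ : Statistics) {M : Type} [LinearOrder M] (m : M) (b : Bool) : Fock M →L[ℂ] Fock M :=
  weightedPerm (toggle m) (genWeight κ m b) (norm_genWeight κ m b)

/-- The grading operator `e_S ↦ (-1)^{#S} e_S` for fermions, and the identity for bosons. -/
def parityOp (κ : Statistics) (M : Type) : Fock M →L[ℂ] Fock M :=
  weightedPerm (Equiv.refl _) (paritySign κ) (norm_paritySign κ)

/-- The product of a list of generators. -/
def genWord (κ : Statistics) {M : Type} [LinearOrder M] (w : List (M × Bool)) :
    Fock M →L[ℂ] Fock M :=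
  (w.map fun p => gen κ p.1 p.2).prod

/-! ## Spin systems on the plane -/

/-- The Euclidean plane. -/
abbrev Plane : Type := EuclideanSpace ℝ (Fin 2)

/-- A spin system on the plane: a countable, uniformly locally finite lattice of sites `Λ → ℝ²`
and a number `modes` of modes per site. For fermions the on-site Hilbert space is the Fock space
of `modes` fermionic modes, with `2 * modes` Majorana operators; for bosons it is the Hilbert space
of `modes` qubits. The linear order on the sites is only used to write down the Jordan-Wigner
signs. -/
structure SpinSystem (κ : Statistics) where
  Λ : Type
  [linearOrder : LinearOrder Λ]
  [countable : Countable Λ]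
  pos : Λ → Plane
  uniformlyLocallyFinite : ∃ l : ℕ, ∀ x : Plane, {j | dist (pos j) x < 1}.encard ≤ l
  modes : ℕ

attribute [instance] SpinSystem.linearOrder SpinSystem.countable

namespace SpinSystem

variable {κ : Statistics} (S : SpinSystem κ)

/-- All the modes of the system: pairs of a site and an on-site mode. -/
abbrev Mode : Type := S.Λ ×ₗ Fin S.modes

/-- The mode with number `k` at the site `j`. -/
def mode (j : S.Λ) (k : Fin S.modes) : S.Mode := toLex (j, k)

/-- The position of a mode. -/
def modePos (m : S.Mode) : Plane := S.pos (ofLex m).1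

/-- The generators of the algebra of local observables. -/
def generators : Set (Fock S.Mode →L[ℂ] Fock S.Mode) :=
  Set.range fun p : S.Mode × Bool => gen κ p.1 p.2

/-- The quasi-local algebra as a norm-closed subalgebra of the bounded operators on Fock space. -/
def quasiLocal : StarSubalgebra ℂ (Fock S.Mode →L[ℂ] Fock S.Mode) :=
  (StarAlgebra.adjoin ℂ S.generators).topologicalClosure

instance isClosed_quasiLocal :
    IsClosed (S.quasiLocal : Set (Fock S.Mode →L[ℂ] Fock S.Mode)) :=
  StarSubalgebra.isClosed_topologicalClosure _

/-- The C⋆-algebra of quasi-local observables: the norm completion of the algebra of local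
observables. -/
def Observables : Type := S.quasiLocal

instance : CStarAlgebra S.Observables := inferInstanceAs (CStarAlgebra S.quasiLocal)

/-- The usual order of a C⋆-algebra. -/
instance : PartialOrder S.Observables := CStarAlgebra.spectralOrder S.Observables

instance : StarOrderedRing S.Observables := CStarAlgebra.spectralOrderedRing S.Observables

theorem gen_mem (m : S.Mode) (b : Bool) : gen κ m b ∈ S.quasiLocal :=
  StarSubalgebra.le_topologicalClosure _ (StarAlgebra.subset_adjoin ℂ _ ⟨(m, b), rfl⟩)

/-- The generators as elements of the quasi-local algebra. -/
def γ (m : S.Mode) (b : Bool) : S.Observables := ⟨gen κ m b, S.gen_mem m b⟩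

/-- The product of a list of generators in the quasi-local algebra. -/
def word (w : List (S.Mode × Bool)) : S.Observables := (w.map fun p => S.γ p.1 p.2).prod

/-- The algebra `A_X` of observables localized in `X ⊆ ℝ²`. -/
def localAlgebra (X : Set Plane) : StarSubalgebra ℂ S.Observables :=
  (StarAlgebra.adjoin ℂ {a | ∃ m b, S.modePos m ∈ X ∧ a = S.γ m b}).topologicalClosure

end SpinSystem

/-! ### The grading automorphism -/

theorem paritySign_mul_self (κ : Statistics) {M : Type} (T : Finset M) :
    paritySign κ T * paritySign κ T = 1 := by
  cases κ
  · simp [paritySign, ← mul_pow]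
  · simp [paritySign]

theorem parityOp_mul_self (κ : Statistics) (M : Type) : parityOp κ M * parityOp κ M = 1 := by
  ext f T
  simp [parityOp, ← mul_assoc, paritySign_mul_self]

theorem star_parityOp (κ : Statistics) (M : Type) : star (parityOp κ M) = parityOp κ M := by
  rw [ContinuousLinearMap.star_eq_adjoint]
  symm
  rw [ContinuousLinearMap.eq_adjoint_iff]
  intro f g
  rw [lp.inner_eq_tsum, lp.inner_eq_tsum]
  refine tsum_congr fun T => ?_
  cases κ
  · simp [parityOp, paritySign]
    ring
  · simp [parityOp, paritySign]

/-- The grading operator as a unitary operator. -/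
def parityUnitary (κ : Statistics) (M : Type) : unitary (Fock M →L[ℂ] Fock M) :=
  ⟨parityOp κ M, by
    rw [Unitary.mem_iff, star_parityOp]
    exact ⟨parityOp_mul_self κ M, parityOp_mul_self κ M⟩⟩

theorem paritySign_mul_toggle {M : Type} [LinearOrder M] (m : M) (T : Finset M) :
    paritySign .fermionic T * paritySign .fermionic (symmDiff T {m}) = -1 := by
  have key : ∀ U : Finset M, m ∉ U →
      paritySign .fermionic U * paritySign .fermionic (insert m U) = -1 := by
    intro U hU
    simp only [paritySign, Finset.card_insert_of_notMem hU, pow_succ, ← mul_assoc, ← mul_pow]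
    simp
  by_cases h : m ∈ T
  · have h1 : symmDiff T {m} = T.erase m := by
      ext k
      by_cases hk : k = m <;> simp [Finset.mem_symmDiff, hk, h]
    have h2 := key (T.erase m) (Finset.notMem_erase m T)
    rw [Finset.insert_erase h] at h2
    rw [h1, mul_comm, h2]
  · have h1 : symmDiff T {m} = insert m T := by
      ext k
      by_cases hk : k = m <;> simp [Finset.mem_symmDiff, hk, h]
    rw [h1, key T h]

theorem parityOp_bosonic (M : Type) : parityOp .bosonic M = 1 := by
  ext f T
  simp [parityOp, paritySign]

theorem parityOp_conj_gen (κ : Statistics) {M : Type} [LinearOrder M] (m : M) (b : Bool) :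
    parityOp κ M * gen κ m b * parityOp κ M = gen κ m b ∨
      parityOp κ M * gen κ m b * parityOp κ M = -gen κ m b := by
  cases κ
  · right
    ext f T
    have h : (toggle m).symm T = symmDiff T {m} := rfl
    have h2 := paritySign_mul_toggle m T
    simp only [parityOp, gen, mul_apply_eq_comp, weightedPerm_apply,
      Equiv.refl_symm, Equiv.refl_apply, neg_apply, lp.coeFn_neg,
      Pi.neg_apply, h]
    linear_combination (genWeight .fermionic m b (symmDiff T {m}) * f (symmDiff T {m})) * h2
  · left
    simp [parityOp_bosonic]

namespace SpinSystem

variable {κ : Statistics} (S : SpinSystem κ)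

theorem parity_conj_mem (x : Fock S.Mode →L[ℂ] Fock S.Mode) (hx : x ∈ S.quasiLocal) :
    Unitary.conjStarAlgAut ℂ _ (parityUnitary κ S.Mode) x ∈ S.quasiLocal := by
  set φ := Unitary.conjStarAlgAut ℂ _ (parityUnitary κ S.Mode) with hφ
  have hφx : ∀ y, φ y = parityOp κ S.Mode * y * parityOp κ S.Mode := by
    intro y
    rw [hφ, Unitary.conjStarAlgAut_apply]
    change parityOp κ S.Mode * y * star (parityOp κ S.Mode) = _
    rw [star_parityOp]
  have hcont : Continuous φ := by
    have : (φ : _ → _) = fun y => parityOp κ S.Mode * y * parityOp κ S.Mode := funext hφx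
    rw [this]
    fun_prop
  have hle : S.quasiLocal ≤ S.quasiLocal.comap φ.toStarAlgHom := by
    refine StarSubalgebra.topologicalClosure_minimal ?_ ?_
    · refine StarAlgebra.adjoin_le ?_
      rintro _ ⟨⟨m, b⟩, rfl⟩
      change φ (gen κ m b) ∈ S.quasiLocal
      rw [hφx]
      rcases parityOp_conj_gen κ m b with h | h
      · rw [h]; exact S.gen_mem m b
      · rw [h]; exact neg_mem (S.gen_mem m b)
    · exact S.isClosed_quasiLocal.preimage hcont
  exact hle hx

/-- The grading automorphism `η` of the quasi-local algebra: conjugation by the grading operator.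
For fermions it maps every Majorana operator `c` to `-c`; for bosons it is the identity. -/
def grading : S.Observables ≃⋆ₐ[ℂ] S.Observables where
  toFun a := ⟨Unitary.conjStarAlgAut ℂ _ (parityUnitary κ S.Mode) a.1, S.parity_conj_mem _ a.2⟩
  invFun a := ⟨Unitary.conjStarAlgAut ℂ _ (parityUnitary κ S.Mode) a.1, S.parity_conj_mem _ a.2⟩
  left_inv a := Subtype.ext (by
    have h : parityUnitary κ S.Mode * parityUnitary κ S.Mode = 1 :=
      Subtype.ext (parityOp_mul_self κ S.Mode)
    change (Unitary.conjStarAlgAut ℂ _ (parityUnitary κ S.Mode) *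
      Unitary.conjStarAlgAut ℂ _ (parityUnitary κ S.Mode)) a.1 = a.1
    rw [← map_mul, h, map_one]; rfl)
  right_inv a := Subtype.ext (by
    have h : parityUnitary κ S.Mode * parityUnitary κ S.Mode = 1 :=
      Subtype.ext (parityOp_mul_self κ S.Mode)
    change (Unitary.conjStarAlgAut ℂ _ (parityUnitary κ S.Mode) *
      Unitary.conjStarAlgAut ℂ _ (parityUnitary κ S.Mode)) a.1 = a.1
    rw [← map_mul, h, map_one]; rfl)
  map_mul' a b := Subtype.ext (map_mul (Unitary.conjStarAlgAut ℂ _ (parityUnitary κ S.Mode)) _ _)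
  map_add' a b := Subtype.ext (map_add (Unitary.conjStarAlgAut ℂ _ (parityUnitary κ S.Mode)) _ _)
  map_star' a := Subtype.ext (map_star (Unitary.conjStarAlgAut ℂ _ (parityUnitary κ S.Mode)) _)
  map_smul' c a := Subtype.ext
    (map_smul (Unitary.conjStarAlgAut ℂ _ (parityUnitary κ S.Mode)) c a.1)

/-- An automorphism of the quasi-local algebra is graded if it commutes with `η`. -/
def IsGraded (α : S.Observables ≃⋆ₐ[ℂ] S.Observables) : Prop :=
  ∀ a, α (S.grading a) = S.grading (α a)

/-- `α` is (the extension by the identity of) an automorphism of `A_X`: it restricts to an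
automorphism of `A_X` and acts trivially on `A_{X^c}`. -/
def IsLocalizedIn (X : Set Plane) (α : S.Observables ≃⋆ₐ[ℂ] S.Observables) : Prop :=
  (∀ a, α a ∈ S.localAlgebra X ↔ a ∈ S.localAlgebra X) ∧ ∀ a ∈ S.localAlgebra Xᶜ, α a = a

/-! ### Stacking -/

theorem modes_uniformlyLocallyFinite :
    ∃ l : ℕ, ∀ x : Plane, {m : S.Mode | dist (S.modePos m) x < 1}.encard ≤ l := by
  obtain ⟨l, hl⟩ := S.uniformlyLocallyFinite
  refine ⟨l * S.modes, fun x => ?_⟩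
  have h : {m : S.Mode | dist (S.modePos m) x < 1} =
      toLex '' ({j | dist (S.pos j) x < 1} ×ˢ (Set.univ : Set (Fin S.modes))) := by
    ext m
    constructor
    · intro hm
      exact ⟨ofLex m, ⟨hm, trivial⟩, rfl⟩
    · rintro ⟨p, hp, rfl⟩
      exact hp.1
  rw [h, toLex.injective.encard_image, Set.encard_prod]
  push_cast
  gcongr
  · exact hl x
  · simp [Set.encard_univ]

/-- The stack of two spin systems: the disjoint union of their modes, with the positions of the
modes unchanged. Its quasi-local algebra is the (graded) tensor product of the two quasi-local
algebras. To keep a constant number of modes per site, every mode becomes a site of its own. -/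
def stack (S T : SpinSystem κ) : SpinSystem κ where
  Λ := S.Mode ⊕ₗ T.Mode
  countable := Countable.of_equiv ((S.Λ × Fin S.modes) ⊕ (T.Λ × Fin T.modes))
    ((Equiv.sumCongr toLex toLex).trans toLex)
  pos j := Sum.elim S.modePos T.modePos (ofLex j)
  uniformlyLocallyFinite := by
    obtain ⟨l, hl⟩ := S.modes_uniformlyLocallyFinite
    obtain ⟨l', hl'⟩ := T.modes_uniformlyLocallyFinite
    refine ⟨l + l', fun x => ?_⟩
    have h : {j : S.Mode ⊕ₗ T.Mode | dist (Sum.elim S.modePos T.modePos (ofLex j)) x < 1} ⊆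
        (fun m => toLex (Sum.inl m)) '' {m : S.Mode | dist (S.modePos m) x < 1} ∪
          (fun m => toLex (Sum.inr m)) '' {m : T.Mode | dist (T.modePos m) x < 1} := by
      intro j hj
      obtain ⟨m, hm⟩ | ⟨m, hm⟩ : (∃ m, ofLex j = Sum.inl m) ∨ ∃ m, ofLex j = Sum.inr m := by
        rcases ofLex j with m | m <;> simp
      · exact Or.inl ⟨m, by simpa [hm] using hj, congrArg toLex hm.symm⟩
      · exact Or.inr ⟨m, by simpa [hm] using hj, congrArg toLex hm.symm⟩
    refine (Set.encard_le_encard h).trans ((Set.encard_union_le _ _).trans ?_)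
    push_cast
    exact add_le_add ((Set.encard_image_le _ _).trans (hl x))
      ((Set.encard_image_le _ _).trans (hl' x))
  modes := 1

/-- A generator of the first system as a generator of the stack. -/
def stackInl (S T : SpinSystem κ) (p : S.Mode × Bool) : (S.stack T).Mode × Bool :=
  ((S.stack T).mode (toLex (Sum.inl p.1)) (0 : Fin 1), p.2)

/-- A generator of the second system as a generator of the stack. -/
def stackInr (S T : SpinSystem κ) (p : T.Mode × Bool) : (S.stack T).Mode × Bool :=
  ((S.stack T).mode (toLex (Sum.inr p.1)) (0 : Fin 1), p.2)

/-- Isomorphisms of spin systems: isomorphisms of the quasi-local algebras that preserve the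
grading and the localization of observables. -/
def IsSystemIso (S T : SpinSystem κ) (φ : S.Observables ≃⋆ₐ[ℂ] T.Observables) : Prop :=
  (∀ a, φ (S.grading a) = T.grading (φ a)) ∧
    ∀ (X : Set Plane) (a), φ a ∈ T.localAlgebra X ↔ a ∈ S.localAlgebra X

end SpinSystem

/-! ## States -/

/-- A state of a C⋆-algebra: a positive linear functional with value `1` at the unit. -/
structure State (A : Type) [CStarAlgebra A] [PartialOrder A] where
  functional : A →ₚ[ℂ] ℂ
  map_one : functional 1 = 1

namespace State

variable {A B : Type} [CStarAlgebra A] [PartialOrder A] [StarOrderedRing A]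
  [CStarAlgebra B] [PartialOrder B] [StarOrderedRing B]

/-- The state `Ψ α : x ↦ Ψ (α x)`. -/
def comp (Ψ : State B) (α : A ≃⋆ₐ[ℂ] B) : State A where
  functional :=
    { toFun := fun a => Ψ.functional (α a)
      map_add' := fun a b => by simp
      map_smul' := fun c a => by simp
      monotone' := fun a b h => OrderHomClass.mono Ψ.functional (OrderHomClass.mono α h) }
  map_one := by
    change Ψ.functional (α 1) = 1
    rw [_root_.map_one, Ψ.map_one]

/-- A state is pure if it is not a proper convex combination of other states. -/
def IsPure (Ψ : State A) : Prop :=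
  ∀ (Ψ₁ Ψ₂ : State A) (t : ℝ), 0 < t → t < 1 →
    (∀ a, Ψ.functional a = t * Ψ₁.functional a + (1 - t) * Ψ₂.functional a) →
      (∀ a, Ψ₁.functional a = Ψ.functional a) ∧ ∀ a, Ψ₂.functional a = Ψ.functional a

/-- The GNS Hilbert space of a state. -/
abbrev Space (Ψ : State A) : Type := Ψ.functional.GNS

/-- The GNS representation of a state. -/
abbrev π (Ψ : State A) : A →⋆ₐ[ℂ] (Ψ.Space →L[ℂ] Ψ.Space) := Ψ.functional.gnsStarAlgHom

/-- Two states are unitarily equivalent if their GNS representations are. -/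
def UnitarilyEquivalent (Ψ₁ Ψ₂ : State A) : Prop :=
  ∃ V : Ψ₁.Space ≃ₗᵢ[ℂ] Ψ₂.Space, ∀ (a : A) (ξ : Ψ₁.Space), V (Ψ₁.π a ξ) = Ψ₂.π a (V ξ)

/-- The unitary operator `U` implements the automorphism `α` in the GNS representation of `Ψ`. -/
def IsImplementer (Ψ : State A) (α : A ≃⋆ₐ[ℂ] A) (U : unitary (Ψ.Space →L[ℂ] Ψ.Space)) : Prop :=
  ∀ a, Ψ.π (α a) = (U : Ψ.Space →L[ℂ] Ψ.Space) * Ψ.π a * star (U : Ψ.Space →L[ℂ] Ψ.Space)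

end State

/-- `Φ` is the stack `Ψ₁ ⊗ Ψ₂`: we have `Φ (x y) = Ψ₁ x * Ψ₂ y` for `x` in the first and `y` in the
second system. (It is enough to say this for products of generators.) -/
def IsStackState {κ : Statistics} {S T : SpinSystem κ} (Φ : State (S.stack T).Observables)
    (Ψ₁ : State S.Observables) (Ψ₂ : State T.Observables) : Prop :=
  ∀ (w : List (S.Mode × Bool)) (w' : List (T.Mode × Bool)),
    Φ.functional ((S.stack T).word (w.map (S.stackInl T)) *
        (S.stack T).word (w'.map (S.stackInr T))) =
      Ψ₁.functional (S.word w) * Ψ₂.functional (T.word w')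

/-- A trivial state: a tensor product over the sites of vector states given by even unit vectors
of the on-site Hilbert spaces. -/
def IsTrivialState {κ : Statistics} {S : SpinSystem κ} (Ψ : State S.Observables) : Prop :=
  ∃ v : S.Λ → Fock (Fin S.modes),
    (∀ j, ‖v j‖ = 1 ∧ parityOp κ (Fin S.modes) (v j) = v j) ∧
    ∀ (l : List S.Λ) (_ : l.Nodup) (w : S.Λ → List (Fin S.modes × Bool)),
      Ψ.functional ((l.map fun j => S.word ((w j).map fun p => (S.mode j p.1, p.2))).prod) =
        (l.map fun j => ⟪v j, genWord κ (w j) (v j)⟫_ℂ).prod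

/-! ## Cones and phases -/

/-- The unit vector in the direction with angle `θ`. -/
def direction (θ : ℝ) : Plane := !₂[Real.cos θ, Real.sin θ]

/-- A cone in the plane: an apex and an open interval `(lo, hi)` of directions. -/
structure Cone where
  apex : Plane
  lo : ℝ
  hi : ℝ
  lo_lt_hi : lo < hi
  hi_lt : hi < lo + 2 * Real.pi

namespace Cone

/-- The open region spanned by the half-lines from the apex in the directions of the interval. -/
def region (C : Cone) : Set Plane :=
  {x | ∃ r θ : ℝ, 0 < r ∧ C.lo < θ ∧ θ < C.hi ∧ x = C.apex + r • direction θ}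

/-- The boundary of a cone is the boundary of its closure. -/
def boundary (C : Cone) : Set Plane := frontier (closure C.region)

/-- A cone is generic for a spin system if there are no sites on its boundary. -/
def IsGeneric {κ : Statistics} (C : Cone) (S : SpinSystem κ) : Prop :=
  ∀ j : S.Λ, S.pos j ∉ C.boundary

end Cone

/-- Good conical partitions `A_0, …, A_{n+1}, B_{01}, …, B_{(n+1)0}`, where `B a` stands for
`B_{a(a+1)}` and indices are cyclic (addition in `Fin (n + 2)`). -/
structure GoodConicalPartition (n : ℕ) where
  apex : Plane
  A : Fin (n + 2) → Cone
  B : Fin (n + 2) → Cone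
  apex_A : ∀ a, (A a).apex = apex
  apex_B : ∀ a, (B a).apex = apex
  disjoint_A : Pairwise fun a b => Disjoint (A a).region (A b).region
  cover : closure (⋃ a, (A a).region) = Set.univ
  /-- The cones `A a` follow each other in counterclockwise order. -/
  oriented : ∀ a, direction (A a).hi = direction (A (a + 1)).lo
  closure_B : Pairwise fun a b => closure (B a).region ∩ closure (B b).region = {apex}
  /-- `B a` contains the half-line that separates `A a` and `A (a + 1)`. -/
  separating : ∀ a, ∀ r : ℝ, 0 < r → apex + r • direction (A a).hi ∈ (B a).region

/-- A good conical partition of the lattice of `S`: all the cones are generic. -/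
def GoodConicalPartition.IsGeneric {κ : Statistics} {n : ℕ} (P : GoodConicalPartition n)
    (S : SpinSystem κ) : Prop :=
  ∀ a, (P.A a).IsGeneric S ∧ (P.B a).IsGeneric S

/-- `α` is associated with the partition: `α = ∏ β_a ∏ β_{a(a+1)}` with automorphisms
`β_a` of `A_{A_a}` and `β_{a(a+1)}` of `A_{B_{a(a+1)}}`. -/
def IsAssociated {κ : Statistics} {n : ℕ} (P : GoodConicalPartition n) (S : SpinSystem κ)
    (α : S.Observables ≃⋆ₐ[ℂ] S.Observables) : Prop :=
  ∃ β β' : Fin (n + 2) → (S.Observables ≃⋆ₐ[ℂ] S.Observables),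
    (∀ a, S.IsLocalizedIn (P.A a).region (β a) ∧ S.IsLocalizedIn (P.B a).region (β' a)) ∧
    α = (List.ofFn β).prod * (List.ofFn β').prod

/-- Two states are in the same phase: for any good conical partition they have trivial extensions
over the same spin system (up to isomorphism) that are related by a graded automorphism associated
with the partition, up to unitary equivalence. -/
def InSamePhase {κ : Statistics} {S₀ S₁ : SpinSystem κ} (Ψ₀ : State S₀.Observables)
    (Ψ₁ : State S₁.Observables) : Prop :=
  ∀ (n : ℕ) (P : GoodConicalPartition n), P.IsGeneric S₀ → P.IsGeneric S₁ →
    ∃ (T₀ T₁ : SpinSystem κ) (τ₀ : State T₀.Observables) (τ₁ : State T₁.Observables)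
      (E₀ : State (S₀.stack T₀).Observables) (E₁ : State (S₁.stack T₁).Observables)
      (φ : (S₀.stack T₀).Observables ≃⋆ₐ[ℂ] (S₁.stack T₁).Observables)
      (α : (S₀.stack T₀).Observables ≃⋆ₐ[ℂ] (S₀.stack T₀).Observables),
      IsTrivialState τ₀ ∧ IsTrivialState τ₁ ∧ IsStackState E₀ Ψ₀ τ₀ ∧ IsStackState E₁ Ψ₁ τ₁ ∧
      (S₀.stack T₀).IsSystemIso (S₁.stack T₁) φ ∧
      (S₀.stack T₀).IsGraded α ∧ IsAssociated P (S₀.stack T₀) α ∧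
      (E₀.comp α).UnitarilyEquivalent (E₁.comp φ)

/-- The trivial phase is the phase of the trivial states. -/
def InTrivialPhase {κ : Statistics} {S : SpinSystem κ} (Ψ : State S.Observables) : Prop :=
  ∃ (S₀ : SpinSystem κ) (Ψ₀ : State S₀.Observables), IsTrivialState Ψ₀ ∧ InSamePhase Ψ Ψ₀

/-- A state `Ψ` is invertible if there is a state `Ψ'` over another spin system such that the stack
`Ψ ⊗ Ψ'` is in the trivial phase. -/
def IsInvertible {κ : Statistics} {S : SpinSystem κ} (Ψ : State S.Observables) : Prop :=
  ∃ (S' : SpinSystem κ) (Ψ' : State S'.Observables) (Φ : State (S.stack S').Observables),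
    IsStackState Φ Ψ Ψ' ∧ InTrivialPhase Φ

/-- `Θ U = (-1)^ε U Θ`: the operator `U` has parity `ε` with respect to `Θ`. -/
def HasParity {H : Type} [NormedAddCommGroup H] [InnerProductSpace ℂ H] [CompleteSpace H]
    (Θ U : unitary (H →L[ℂ] H)) (ε : Fin 2) : Prop :=
  (Θ : H →L[ℂ] H) * (U : H →L[ℂ] H) =
    (-1 : ℂ) ^ (ε : ℕ) • ((U : H →L[ℂ] H) * (Θ : H →L[ℂ] H))

end

end Spin

/-! The GNS representation of a pure state is irreducible, so implementers of commuting
automorphisms commute up to a scalar. For `Θ` and `U_L` the scalar squares to one because `Θ²` is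
itself a scalar; this gives the parity of an implementer of a graded automorphism. An automorphism
of a region that misses a site is graded, because conjugation by a generator at that site acts on
the observables of the region as `η`. What remains is to compute the scalar `c` in `U_L U_R = c U_R
U_L`.

For a product vector `Ω` this is direct. Let `V` commute with all observables outside a region `M`,
and `W` with all those inside. Then `V Ω` is a limit of vectors `x Ω` with `x` in the algebra of
`M`, and `W Ω` is a limit of vectors `y Ω` with `y` in that of the complement. If `V` and `W` have
parities, `x` and `y` can be taken homogeneous. They then commute up to the sign `(-1)^(ab)`, and so
do `V` and `W` on `Ω` (`IsProductVector.graded_commute`).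

Invertibility reduces the general case to this one. A good conical partition is chosen with cones
`A_0` and `A_2` that contain the sites of `B_L` and `B_R`. After stacking with an inverse and with
trivial states, an automorphism `α` associated with the partition makes the state unitarily
equivalent to a product state. Hence one Hilbert space carries a representation `ρ` of the stack
that contains `π_Ψ`, together with a cyclic product vector for the local structure transported by
`α`. The automorphism moves observables only within the cones of the partition. It therefore maps
the algebra of `X = A_0 ∪ B_{01} ∪ B_{30}` into that of the complement of `A_2`, and the algebra of
the complement of `X` into that of the complement of `A_0` (`IsAssociated.apply_mem`).

The implementers must also be lifted to the larger space, which by Schur's lemma is `π_Ψ` tensored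
with a multiplicity space. An even `U` lifts to `U ⊗ 1`. An odd `U` lifts to `U ⊗ (parity of the
multiplicity space)`, a Klein transformation without which it would anticommute with the odd
generators of the added modes. The tensor product is never formed. Its role is played by the set of
intertwiners `J` from `π_Ψ` to `ρ`, and the multiplicity parity acts on them by `J ↦ Θ₁ J Θ†`. The
lifts satisfy the same relation with the same `c`, and they commute with the observables required
above, so `c = (-1)^(ε_L ε_R)`.

The partition exists because the two cones are separated by angular gaps. The cones are widened into
the gaps, and their apex is moved slightly to a point from which no boundary line meets a site. -/

namespace Spin
noncomputable section

/-! ### Total families of vectors and amplification of isometries -/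

section Hilbert

variable {ι : Type*} {H K : Type*} [NormedAddCommGroup H] [InnerProductSpace ℂ H]
  [NormedAddCommGroup K] [InnerProductSpace ℂ K]

/-- A family of vectors is total if only the zero vector is orthogonal to all of them. -/
def Total (v : ι → H) : Prop := ∀ x : H, (∀ i, ⟪v i, x⟫_ℂ = 0) → x = 0

theorem Total.denseRange [CompleteSpace H] {v : ι → H} (hv : Total v) :
    DenseRange (Finsupp.linearCombination ℂ v) := by
  have h : (LinearMap.range (Finsupp.linearCombination ℂ v)).topologicalClosure = ⊤ := by
    rw [Submodule.topologicalClosure_eq_top_iff, Submodule.eq_bot_iff]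
    intro x hx
    refine hv x fun i => ?_
    exact (Submodule.mem_orthogonal _ _).1 hx _
      ⟨Finsupp.single i 1, by simp⟩
  intro x
  have hx : x ∈ (LinearMap.range (Finsupp.linearCombination ℂ v)).topologicalClosure := by
    rw [h]; trivial
  exact hx

theorem Total.eq_of_inner {v : ι → H} (hv : Total v) {x y : H}
    (h : ∀ i, ⟪v i, x⟫_ℂ = ⟪v i, y⟫_ℂ) : x = y :=
  sub_eq_zero.1 (hv _ fun i => by rw [inner_sub_right, h i, sub_self])

theorem Total.ext [CompleteSpace H] {v : ι → H} (hv : Total v) {S T : H →L[ℂ] K}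
    (h : ∀ i, S (v i) = T (v i)) :
    S = T := by
  have : (S : H → K) = T := by
    refine hv.denseRange.equalizer S.continuous T.continuous ?_
    funext f
    simp [Finsupp.linearCombination_apply, map_finsuppSum, h]
  ext x
  exact congrFun this x

/-- Families of vectors with the same Gram matrix are related by an isometry. -/
theorem Total.exists_isometry [CompleteSpace H] [CompleteSpace K] {v : ι → H} (hv : Total v)
    (w : ι → K)
    (h : ∀ i j, ⟪v i, v j⟫_ℂ = ⟪w i, w j⟫_ℂ) :
    ∃ T : H →L[ℂ] K, (∀ i, T (v i) = w i) ∧ ∀ x y, ⟪T x, T y⟫_ℂ = ⟪x, y⟫_ℂ := by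
  -- Inner products of finite combinations depend only on the Gram matrix. The assignment `v i ↦ w
  -- i` therefore preserves norms on the dense span, even when the `v i` are linearly dependent.
  have hin : ∀ f g : ι →₀ ℂ, ⟪Finsupp.linearCombination ℂ w f, Finsupp.linearCombination ℂ w g⟫_ℂ =
      ⟪Finsupp.linearCombination ℂ v f, Finsupp.linearCombination ℂ v g⟫_ℂ := by
    intro f g
    simp only [Finsupp.linearCombination_apply, Finsupp.sum, sum_inner, inner_sum, inner_smul_left,
      inner_smul_right, h]
  have hnorm : ∀ f : ι →₀ ℂ, ‖Finsupp.linearCombination ℂ w f‖ ≤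
      1 * ‖Finsupp.linearCombination ℂ v f‖ := by
    intro f
    rw [one_mul, @norm_eq_sqrt_re_inner ℂ, @norm_eq_sqrt_re_inner ℂ, hin]
  have heq := LinearMap.extendOfNorm_eq hv.denseRange ⟨1, hnorm⟩
  refine ⟨(Finsupp.linearCombination ℂ w).extendOfNorm (Finsupp.linearCombination ℂ v),
    fun i => ?_, fun x y => ?_⟩
  · simpa using heq (Finsupp.single i 1)
  · refine hv.denseRange.induction_on₂
      (p := fun x y => ⟪(Finsupp.linearCombination ℂ w).extendOfNorm
        (Finsupp.linearCombination ℂ v) x, (Finsupp.linearCombination ℂ w).extendOfNorm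
        (Finsupp.linearCombination ℂ v) y⟫_ℂ = ⟪x, y⟫_ℂ) ?_ ?_ x y
    · exact isClosed_eq (by fun_prop) (by fun_prop)
    · intro f g
      rw [heq, heq, hin]

theorem norm_eq_of_inner {T : H →L[ℂ] K} (hT : ∀ x y, ⟪T x, T y⟫_ℂ = ⟪x, y⟫_ℂ) (x : H) :
    ‖T x‖ = ‖x‖ := by
  rw [@norm_eq_sqrt_re_inner ℂ, @norm_eq_sqrt_re_inner ℂ, hT]

/-- Amplification: if the intertwiners `J ∈ 𝓘` have scalar products `J† J'` and jointly total
ranges, then every isometry of `H` lifts to an isometry of `K`. -/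
theorem exists_amplification [CompleteSpace K] {𝓘 : Set (H →L[ℂ] K)}
    (hschur : ∀ J ∈ 𝓘, ∀ J' ∈ 𝓘, ∃ c : ℂ, ∀ x y, ⟪J x, J' y⟫_ℂ = c * ⟪x, y⟫_ℂ)
    (htot : Total fun p : 𝓘 × H => p.1.1 p.2) (U : H →L[ℂ] H)
    (hU : ∀ x y, ⟪U x, U y⟫_ℂ = ⟪x, y⟫_ℂ) :
    ∃ V : K →L[ℂ] K, (∀ J ∈ 𝓘, ∀ x, V (J x) = J (U x)) ∧ ∀ x y, ⟪V x, V y⟫_ℂ = ⟪x, y⟫_ℂ := by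
  -- The vectors `J x` and `J (U x)` have the same Gram matrix, since `J† J'` is a scalar and `U`
  -- preserves inner products.
  obtain ⟨V, h1, h2⟩ := htot.exists_isometry (fun p : 𝓘 × H => p.1.1 (U p.2)) (by
    rintro ⟨⟨J, hJ⟩, x⟩ ⟨⟨J', hJ'⟩, y⟩
    obtain ⟨c, hc⟩ := hschur J hJ J' hJ'
    simp [hc, hU])
  exact ⟨V, fun J hJ x => h1 (⟨J, hJ⟩, x), h2⟩

end Hilbert

/-! ### GNS representations and irreducibility for pure states -/

namespace State

variable {A : Type} [CStarAlgebra A] [PartialOrder A] [StarOrderedRing A] (Ψ : State A)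

/-- The cyclic vector of the GNS representation. -/
def vac : Ψ.Space := ((Ψ.functional.toPreGNS 1 : Ψ.functional.PreGNS) : Ψ.Space)

theorem π_vac (a : A) :
    Ψ.π a Ψ.vac = ((Ψ.functional.toPreGNS a : Ψ.functional.PreGNS) : Ψ.Space) := by
  change Ψ.functional.gnsNonUnitalStarAlgHom a _ = _
  simp [vac]

theorem inner_π_vac (a b : A) :
    ⟪Ψ.π a Ψ.vac, Ψ.π b Ψ.vac⟫_ℂ = Ψ.functional (star a * b) := by
  rw [π_vac, π_vac, UniformSpace.Completion.inner_coe]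
  rfl

theorem π_one_apply (x : Ψ.Space) : Ψ.π 1 x = x := by
  rw [_root_.map_one]; rfl

theorem inner_vac_π (a : A) : ⟪Ψ.vac, Ψ.π a Ψ.vac⟫_ℂ = Ψ.functional a := by
  have := Ψ.inner_π_vac 1 a
  rwa [π_one_apply, star_one, one_mul] at this

theorem inner_vac_vac : ⟪Ψ.vac, Ψ.vac⟫_ℂ = 1 := by
  have := Ψ.inner_vac_π 1
  rwa [π_one_apply, Ψ.map_one] at this

theorem vac_ne_zero : Ψ.vac ≠ 0 := by
  intro h
  have := Ψ.inner_vac_vac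
  simp [h] at this

theorem total_π_vac : Total fun a => Ψ.π a Ψ.vac := by
  intro x hx
  have : (fun y => ⟪y, x⟫_ℂ) = fun _ => 0 := by
    refine (UniformSpace.Completion.denseRange_coe (α := Ψ.functional.PreGNS)).equalizer
      (by fun_prop) (by fun_prop) ?_
    funext a
    have h := hx (Ψ.functional.ofPreGNS a)
    beta_reduce at h
    rw [π_vac] at h
    exact h
  exact inner_self_eq_zero.1 (congrFun this x)

/-- The vector functional of `T Ω`, where `T` is a positive operator that commutes with `π`. -/
def ofCommutant (T : Ψ.Space →L[ℂ] Ψ.Space) (hT : ∀ a x, T (Ψ.π a x) = Ψ.π a (T x))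
    (hpos : ∀ x, 0 ≤ ⟪x, T x⟫_ℂ) (t : ℝ) (ht : 0 < t) (htv : ⟪Ψ.vac, T Ψ.vac⟫_ℂ = t) :
    State A where
  functional :=
    PositiveLinearMap.mk
      { toFun := fun a => (t : ℂ)⁻¹ * ⟪Ψ.vac, T (Ψ.π a Ψ.vac)⟫_ℂ
        map_add' := fun a b => by simp [inner_add_right, mul_add]
        map_smul' := fun c a => by simp [inner_smul_right]; ring }
      (by
        have key : ∀ a : A, 0 ≤ a → 0 ≤ (t : ℂ)⁻¹ * ⟪Ψ.vac, T (Ψ.π a Ψ.vac)⟫_ℂ := by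
          intro a ha
          obtain ⟨c, rfl⟩ := CStarAlgebra.nonneg_iff_eq_star_mul_self.1 ha
          refine mul_nonneg (by simpa using ht.le) ?_
          have h := hpos (Ψ.π c Ψ.vac)
          rwa [_root_.map_mul, mul_apply_eq_comp, hT, map_star,
            ContinuousLinearMap.star_eq_adjoint, ContinuousLinearMap.adjoint_inner_right]
        intro a b hab
        have h := key (b - a) (sub_nonneg.2 hab)
        simp only [map_sub, sub_apply, inner_sub_right, mul_sub,
          sub_nonneg] at h
        exact h)
  map_one := by
    change (t : ℂ)⁻¹ * ⟪Ψ.vac, T (Ψ.π 1 Ψ.vac)⟫_ℂ = 1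
    rw [π_one_apply, htv, inv_mul_cancel₀ (by exact_mod_cast ht.ne')]

theorem ofCommutant_apply (T : Ψ.Space →L[ℂ] Ψ.Space) (hT : ∀ a x, T (Ψ.π a x) = Ψ.π a (T x))
    (hpos : ∀ x, 0 ≤ ⟪x, T x⟫_ℂ) (t : ℝ) (ht : 0 < t) (htv : ⟪Ψ.vac, T Ψ.vac⟫_ℂ = t) (a : A) :
    (Ψ.ofCommutant T hT hpos t ht htv).functional a =
      (t : ℂ)⁻¹ * ⟪Ψ.vac, T (Ψ.π a Ψ.vac)⟫_ℂ := rfl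

variable {Ψ}

/-- Because `‖R‖ ≤ 1/4`, both `1/2 + R` and `1/2 - R` are positive. Their normalized vector
functionals at the cyclic vector `Ω` decompose `Ψ` convexly with strictly positive weights `1/2 ±
r`, where `r = ⟪Ω, R Ω⟫`. Purity makes the first functional equal to `Ψ`, which says `R Ω = r Ω`;
since `Ω` is cyclic and `R` commutes with the representation, `R = r`. -/
theorem IsPure.commutant_of_small (hΨ : Ψ.IsPure) (R : Ψ.Space →L[ℂ] Ψ.Space)
    (hR : ∀ a x, R (Ψ.π a x) = Ψ.π a (R x)) (hsa : IsSelfAdjoint R) (hnorm : ‖R‖ ≤ 1 / 4) :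
    ∃ c : ℂ, ∀ x, R x = c • x := by
  have hreal : ∀ x, (⟪x, R x⟫_ℂ).im = 0 := fun x => by
    rw [← Complex.conj_eq_iff_im, inner_conj_symm]
    conv_lhs => rw [← hsa.adjoint_eq, ContinuousLinearMap.adjoint_inner_left]
  have hbd : ∀ x, |(⟪x, R x⟫_ℂ).re| ≤ 1 / 4 * ‖x‖ ^ 2 := fun x => by
    refine (Complex.abs_re_le_norm _).trans ((norm_inner_le_norm _ _).trans ?_)
    have := R.le_opNorm x
    nlinarith [norm_nonneg x, mul_le_mul_of_nonneg_right hnorm (norm_nonneg x)]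
  have hxx : ∀ x : Ψ.Space, ⟪x, x⟫_ℂ = ((‖x‖ ^ 2 : ℝ) : ℂ) := fun x => by
    rw [inner_self_eq_norm_sq_to_K]; norm_cast
  have hRx : ∀ x, ⟪x, R x⟫_ℂ = ((⟪x, R x⟫_ℂ).re : ℂ) := fun x =>
    Complex.ext rfl (by simp [hreal])
  have main : ∀ s : ℝ, (s = 1 ∨ s = -1) → ∀ x,
      0 ≤ ⟪x, ((1 / 2 : ℂ) • (1 : Ψ.Space →L[ℂ] Ψ.Space) + (s : ℂ) • R) x⟫_ℂ := by
    intro s hs x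
    have e : ⟪x, ((1 / 2 : ℂ) • (1 : Ψ.Space →L[ℂ] Ψ.Space) + (s : ℂ) • R) x⟫_ℂ =
        ((1 / 2 * ‖x‖ ^ 2 + s * (⟪x, R x⟫_ℂ).re : ℝ) : ℂ) := by
      simp only [add_apply, smul_apply, one_apply_eq_self, inner_add_right, inner_smul_right, hxx]
      rw [hRx x]
      push_cast
      simp
    have h1 := abs_le.1 (hbd x)
    rw [e, Complex.zero_le_real]
    rcases hs with rfl | rfl <;> nlinarith [h1.1, h1.2, sq_nonneg ‖x‖]
  have hcomm : ∀ s : ℂ, ∀ a x, ((1 / 2 : ℂ) • (1 : Ψ.Space →L[ℂ] Ψ.Space) + s • R) (Ψ.π a x) =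
      Ψ.π a (((1 / 2 : ℂ) • (1 : Ψ.Space →L[ℂ] Ψ.Space) + s • R) x) := fun s a x => by
    simp [-PositiveLinearMap.gnsStarAlgHom_apply, hR]
  set r : ℝ := (⟪Ψ.vac, R Ψ.vac⟫_ℂ).re with hr
  have hrv : ⟪Ψ.vac, R Ψ.vac⟫_ℂ = r := Complex.ext rfl (by simp [hreal])
  have hv : ‖Ψ.vac‖ ^ 2 = 1 := by
    have := (hxx Ψ.vac).symm.trans Ψ.inner_vac_vac
    exact_mod_cast this
  have hrb := abs_le.1 (hbd Ψ.vac)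
  rw [hv] at hrb
  have ht : ∀ s : ℝ, ⟪Ψ.vac, ((1 / 2 : ℂ) • (1 : Ψ.Space →L[ℂ] Ψ.Space) + (s : ℂ) • R) Ψ.vac⟫_ℂ =
      ((1 / 2 + s * r : ℝ) : ℂ) := fun s => by
    simp only [add_apply, smul_apply, one_apply_eq_self, inner_add_right, inner_smul_right, hrv,
      inner_vac_vac]
    push_cast
    ring
  have h1 : (0 : ℝ) < 1 / 2 + 1 * r := by linarith [hrb.1]
  have h2 : (0 : ℝ) < 1 / 2 + (-1) * r := by linarith [hrb.2]
  obtain ⟨h, -⟩ := hΨ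
    (Ψ.ofCommutant _ (hcomm ((1 : ℝ) : ℂ)) (main _ (by simp)) _ h1 (ht 1))
    (Ψ.ofCommutant _ (hcomm ((-1 : ℝ) : ℂ)) (main _ (by simp)) _ h2 (ht (-1)))
    (1 / 2 + 1 * r) h1 (by linarith) (by
      intro a
      rw [ofCommutant_apply, ofCommutant_apply]
      have e : (1 - ((1 / 2 + 1 * r : ℝ) : ℂ)) = ((1 / 2 + (-1) * r : ℝ) : ℂ) := by
        push_cast; ring
      rw [e, mul_inv_cancel_left₀ (by exact_mod_cast h1.ne'),
        mul_inv_cancel_left₀ (by exact_mod_cast h2.ne')]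
      simp only [add_apply, smul_apply, one_apply_eq_self, inner_add_right, inner_smul_right,
        inner_vac_π]
      push_cast
      ring)
  have hRv : R Ψ.vac = (r : ℂ) • Ψ.vac := by
    refine Ψ.total_π_vac.eq_of_inner fun a => ?_
    have ha := h (star a)
    rw [ofCommutant_apply, inv_mul_eq_iff_eq_mul₀ (by exact_mod_cast h1.ne')] at ha
    simp only [add_apply, smul_apply, one_apply_eq_self, inner_add_right, inner_smul_right,
        inner_vac_π, hR] at ha
    rw [map_star Ψ.π, ContinuousLinearMap.star_eq_adjoint,
      ContinuousLinearMap.adjoint_inner_right] at ha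
    rw [inner_smul_right]
    have hb : Ψ.functional (star a) = ⟪Ψ.π a Ψ.vac, Ψ.vac⟫_ℂ := by
      rw [← inner_vac_π, map_star Ψ.π, ContinuousLinearMap.star_eq_adjoint,
        ContinuousLinearMap.adjoint_inner_right]
    rw [hb] at ha
    push_cast at ha
    linear_combination ha
  refine ⟨r, fun x => ?_⟩
  have : R = (r : ℂ) • (1 : Ψ.Space →L[ℂ] Ψ.Space) := by
    refine Ψ.total_π_vac.ext fun a => ?_
    simp [-PositiveLinearMap.gnsStarAlgHom_apply, hR, hRv]
  rw [this]
  simp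

theorem IsPure.commutant_of_selfAdjoint (hΨ : Ψ.IsPure) (R : Ψ.Space →L[ℂ] Ψ.Space)
    (hR : ∀ a x, R (Ψ.π a x) = Ψ.π a (R x)) (hsa : IsSelfAdjoint R) :
    ∃ c : ℂ, ∀ x, R x = c • x := by
  have hpos : (0 : ℝ) < 4 * (‖R‖ + 1) := by positivity
  -- Rescaling brings the norm below `1/4`; the added `1` keeps the factor finite when `R = 0`.
  set s : ℝ := (4 * (‖R‖ + 1))⁻¹ with hs
  have hs0 : 0 < s := inv_pos.2 hpos
  obtain ⟨c, hc⟩ := hΨ.commutant_of_small ((s : ℂ) • R) (fun a x => by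
      simp [-PositiveLinearMap.gnsStarAlgHom_apply, hR])
    (IsSelfAdjoint.smul (by simp [isSelfAdjoint_iff]) hsa) (by
      rw [norm_smul, Complex.norm_real, Real.norm_of_nonneg hs0.le, hs, inv_mul_le_iff₀ hpos]
      linarith)
  refine ⟨(s : ℂ)⁻¹ * c, fun x => ?_⟩
  have h := hc x
  rw [smul_apply] at h
  rw [mul_smul, ← h, inv_smul_smul₀ (by exact_mod_cast hs0.ne')]

/-- The GNS representation of a pure state is irreducible. -/
theorem IsPure.commutant (hΨ : Ψ.IsPure) (R : Ψ.Space →L[ℂ] Ψ.Space)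
    (hR : ∀ a x, R (Ψ.π a x) = Ψ.π a (R x)) : ∃ c : ℂ, ∀ x, R x = c • x := by
  have hstar : ∀ a x, star R (Ψ.π a x) = Ψ.π a (star R x) := by
    intro a x
    have h : R * Ψ.π (star a) = Ψ.π (star a) * R := ContinuousLinearMap.ext fun y => hR (star a) y
    have h' := congrArg star h
    rw [star_mul, star_mul, ← map_star, star_star] at h'
    exact congrArg (fun T : Ψ.Space →L[ℂ] Ψ.Space => T x) h'.symm
  -- The real and imaginary parts of `R` are self-adjoint and lie in the commutant too.
  obtain ⟨c, hc⟩ := hΨ.commutant_of_selfAdjoint (R + star R) (fun a x => by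
    simp [-PositiveLinearMap.gnsStarAlgHom_apply, hR, hstar])
    (IsSelfAdjoint.add_star_self R)
  obtain ⟨d, hd⟩ := hΨ.commutant_of_selfAdjoint (Complex.I • (R - star R))
    (fun a x => by simp [-PositiveLinearMap.gnsStarAlgHom_apply, hR, hstar]) (by
      rw [isSelfAdjoint_iff, star_smul, star_sub, star_star]
      simp [← smul_neg])
  refine ⟨(c - Complex.I * d) / 2, fun x => ?_⟩
  have h1 := hc x
  have h2 := hd x
  simp only [add_apply, smul_apply, sub_apply] at h1 h2
  have h3 : R x - star R x = -(Complex.I * d) • x := by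
    rw [neg_mul_eq_neg_mul, mul_smul, ← h2, smul_smul]
    simp
  have h4 : (2 : ℂ) • R x = (c - Complex.I * d) • x := by
    rw [sub_smul, ← h1, sub_eq_add_neg, ← neg_smul, ← h3, two_smul]
    abel
  rw [div_eq_inv_mul, mul_smul, ← h4, inv_smul_smul₀ two_ne_zero]

end State

/-! ### Relations between the generators on Fock space -/

/-- The sign with which generators at different modes commute. -/
def Statistics.sgn : Statistics → ℂ
  | .fermionic => -1
  | .bosonic => 1

theorem Statistics.sgn_mul_self (κ : Statistics) : κ.sgn * κ.sgn = 1 := by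
  cases κ <;> simp [Statistics.sgn]

theorem Statistics.sgn_eq (κ : Statistics) : κ.sgn = 1 ∨ κ.sgn = -1 := by
  cases κ <;> simp [Statistics.sgn]

/-- The products of elements of a set of self-adjoint elements span the algebra generated by it. -/
theorem mem_of_mem_adjoin {B : Type*} [Semiring B] [StarRing B] [Algebra ℂ B] [StarModule ℂ B]
    {s : Set B} (hs : ∀ x ∈ s, star x = x) {N : Submodule ℂ B}
    (h : ∀ l : List B, (∀ y ∈ l, y ∈ s) → l.prod ∈ N) :
    ∀ a ∈ StarAlgebra.adjoin ℂ s, a ∈ N := by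
  intro a ha
  have hs' : star s = s := by
    ext x
    constructor
    · intro hx
      rwa [← star_star x, hs _ hx]
    · intro hx
      rwa [Set.mem_star, hs x hx]
  rw [← StarSubalgebra.mem_toSubalgebra, StarAlgebra.adjoin_toSubalgebra, hs', Set.union_self,
    ← Subalgebra.mem_toSubmodule, Algebra.adjoin_eq_span] at ha
  refine Submodule.span_le.2 ?_ ha
  intro x hx
  obtain ⟨l, hl, rfl⟩ := Submonoid.exists_list_of_mem_closure hx
  exact h l hl

section Fock

variable {M : Type} [LinearOrder M]

theorem gen_apply (κ : Statistics) (m : M) (b : Bool) (f : Fock M) (T : Finset M) :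
    gen κ m b f T = genWeight κ m b (symmDiff T {m}) * f (symmDiff T {m}) := rfl

theorem norm_weightedPerm_apply {ι : Type} (σ : Equiv.Perm ι) (w : ι → ℂ) (hw : ∀ i, ‖w i‖ = 1)
    (f : lp (fun _ : ι => ℂ) 2) : ‖weightedPerm σ w hw f‖ = ‖f‖ := by
  have h2 : 0 < (2 : ENNReal).toReal := by norm_num
  rw [lp.norm_eq_tsum_rpow h2, lp.norm_eq_tsum_rpow h2]
  congr 1
  simpa [hw] using (σ.symm.tsum_eq fun i => ‖f i‖ ^ (2 : ENNReal).toReal)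

theorem filter_lt_symmDiff_of_not_lt {m k : M} (h : ¬ k < m) (T : Finset M) :
    (symmDiff T {k}).filter (· < m) = T.filter (· < m) := by
  ext x
  by_cases hx : x = k
  · subst hx; simp [h]
  · simp [Finset.mem_symmDiff, hx]

theorem stringSign_symmDiff_of_not_lt (κ : Statistics) {m k : M} (h : ¬ k < m) (T : Finset M) :
    stringSign κ m (symmDiff T {k}) = stringSign κ m T := by
  cases κ
  · simp only [stringSign, filter_lt_symmDiff_of_not_lt h]
  · rfl

theorem stringSign_symmDiff_of_lt (κ : Statistics) {m k : M} (h : k < m) (T : Finset M) :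
    stringSign κ m (symmDiff T {k}) = κ.sgn * stringSign κ m T := by
  cases κ
  · have h1 : (symmDiff T {k}).filter (· < m) = symmDiff (T.filter (· < m)) {k} := by
      ext x
      by_cases hx : x = k
      · subst hx; simp [Finset.mem_symmDiff, h]
      · simp [Finset.mem_symmDiff, hx]
    have h2 := paritySign_mul_toggle k (T.filter (· < m))
    have h3 := paritySign_mul_self .fermionic (T.filter (· < m))
    rw [← h1] at h2
    change paritySign .fermionic ((symmDiff T {k}).filter (· < m)) =
      -1 * paritySign .fermionic (T.filter (· < m))
    linear_combination (paritySign .fermionic (T.filter (· < m))) * h2 -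
      (paritySign .fermionic ((symmDiff T {k}).filter (· < m))) * h3
  · simp [stringSign, Statistics.sgn]

theorem genWeight_symmDiff_of_ne (κ : Statistics) {m k : M} (h : m ≠ k) (b : Bool) (T : Finset M) :
    genWeight κ m b (symmDiff T {k}) = (if k < m then κ.sgn else 1) * genWeight κ m b T := by
  have hmem : (m ∈ symmDiff T {k}) ↔ m ∈ T := by simp [Finset.mem_symmDiff, h]
  unfold genWeight
  simp only [hmem]
  by_cases h1 : k < m
  · rw [stringSign_symmDiff_of_lt κ h1, if_pos h1, mul_assoc]
  · rw [stringSign_symmDiff_of_not_lt κ h1, if_neg h1, one_mul]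

/-- Of two distinct modes exactly one precedes the other, so flipping the occupations in the two
orders changes exactly one of the two string signs. -/
theorem gen_mul_gen_of_ne (κ : Statistics) {m k : M} (h : m ≠ k) (b c : Bool) :
    gen κ m b * gen κ k c = κ.sgn • (gen κ k c * gen κ m b) := by
  ext f T
  have e : symmDiff (symmDiff T {m}) {k} = symmDiff (symmDiff T {k}) {m} :=
    symmDiff_right_comm T {m} {k}
  have h1 := genWeight_symmDiff_of_ne κ h b (symmDiff T {m})
  have h2 := genWeight_symmDiff_of_ne κ h.symm c (symmDiff T {k})
  rw [e] at h1
  change genWeight κ m b (symmDiff T {m}) * (genWeight κ k c (symmDiff (symmDiff T {m}) {k}) *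
      f (symmDiff (symmDiff T {m}) {k})) =
    κ.sgn * (genWeight κ k c (symmDiff T {k}) * (genWeight κ m b (symmDiff (symmDiff T {k}) {m}) *
      f (symmDiff (symmDiff T {k}) {m})))
  rw [e, h1, h2]
  rcases lt_or_gt_of_ne h with h3 | h3
  · simp only [h3, h3.not_gt, if_true, if_false]
    ring
  · simp only [h3, h3.not_gt, if_true, if_false]
    linear_combination (-genWeight κ m b (symmDiff T {m}) * (genWeight κ k c (symmDiff T {k}) *
      f (symmDiff (symmDiff T {k}) {m}))) * κ.sgn_mul_self

theorem stringSign_mul_self (κ : Statistics) (m : M) (T : Finset M) :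
    stringSign κ m T * stringSign κ m T = 1 := by
  cases κ
  · simp [stringSign, ← mul_pow]
  · simp [stringSign]

theorem gen_mul_self (κ : Statistics) (m : M) (b : Bool) : gen κ m b * gen κ m b = 1 := by
  ext f T
  simp only [mul_apply_eq_comp, gen_apply, one_apply_eq_self, symmDiff_symmDiff_cancel_right]
  have h1 : m ∈ symmDiff T {m} ↔ m ∉ T := by simp [Finset.mem_symmDiff]
  rw [genWeight, genWeight, stringSign_symmDiff_of_not_lt κ (lt_irrefl m)]
  simp only [h1]
  have h2 := stringSign_mul_self κ m T
  have h3 := Complex.I_mul_I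
  cases b
  · simp only [Bool.false_eq_true, if_false]
    linear_combination f T * h2
  · by_cases h : m ∈ T
    · simp only [h, not_true_eq_false, if_true, if_false]
      linear_combination (-Complex.I * Complex.I * f T) * h2 - f T * h3
    · simp only [h, not_false_eq_true, if_true, if_false]
      linear_combination (-Complex.I * Complex.I * f T) * h2 - f T * h3

/-- A weighted permutation with unimodular weights is an isometry, and a generator squares to one,
so its adjoint is its inverse and hence the generator itself. -/
theorem star_gen (κ : Statistics) (m : M) (b : Bool) : star (gen κ m b) = gen κ m b := by
  have h : star (gen κ m b) * gen κ m b = 1 := by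
    rw [ContinuousLinearMap.star_eq_adjoint]
    exact (ContinuousLinearMap.norm_map_iff_adjoint_comp_self _).1
      (norm_weightedPerm_apply _ _ _)
  exact left_inv_eq_right_inv h (gen_mul_self κ m b)

theorem parityOp_mul_gen_mul_parityOp (κ : Statistics) (m : M) (b : Bool) :
    parityOp κ M * gen κ m b * parityOp κ M = κ.sgn • gen κ m b := by
  cases κ
  · ext f T
    have h : (toggle m).symm T = symmDiff T {m} := rfl
    have h2 := paritySign_mul_toggle m T
    simp only [parityOp, gen, mul_apply_eq_comp, weightedPerm_apply, Statistics.sgn, smul_apply,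
      Equiv.refl_symm, Equiv.refl_apply, lp.coeFn_smul, Pi.smul_apply, smul_eq_mul, h]
    linear_combination (genWeight .fermionic m b (symmDiff T {m}) * f (symmDiff T {m})) * h2
  · simp [parityOp_bosonic, Statistics.sgn]

end Fock

/-! ### Words, local algebras and graded commutation -/

namespace SpinSystem

variable {κ : Statistics} (S : SpinSystem κ)

theorem γ_mul_self (m : S.Mode) (b : Bool) : S.γ m b * S.γ m b = 1 :=
  Subtype.ext (gen_mul_self κ m b)

theorem star_γ (m : S.Mode) (b : Bool) : star (S.γ m b) = S.γ m b :=
  Subtype.ext (star_gen κ m b)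

theorem γ_mul_γ_of_ne {m k : S.Mode} (h : m ≠ k) (b c : Bool) :
    S.γ m b * S.γ k c = κ.sgn • (S.γ k c * S.γ m b) :=
  Subtype.ext (gen_mul_gen_of_ne κ h b c)

theorem grading_γ (m : S.Mode) (b : Bool) : S.grading (S.γ m b) = κ.sgn • S.γ m b := by
  refine Subtype.ext ?_
  change Unitary.conjStarAlgAut ℂ _ (parityUnitary κ S.Mode) (gen κ m b) = κ.sgn • gen κ m b
  rw [Unitary.conjStarAlgAut_apply, ← parityOp_mul_gen_mul_parityOp]
  change parityOp κ S.Mode * _ * star (parityOp κ S.Mode) = _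
  rw [star_parityOp]

theorem grading_grading (a : S.Observables) : S.grading (S.grading a) = a :=
  S.grading.left_inv a

theorem grading_bosonic (S : SpinSystem .bosonic) (a : S.Observables) : S.grading a = a := by
  refine Subtype.ext ?_
  change Unitary.conjStarAlgAut ℂ _ (parityUnitary .bosonic S.Mode) a.1 = a.1
  rw [Unitary.conjStarAlgAut_apply]
  change parityOp .bosonic S.Mode * _ * star (parityOp .bosonic S.Mode) = _
  rw [star_parityOp, parityOp_bosonic, one_mul, mul_one]

theorem continuous_grading : Continuous S.grading := by
  have : ∀ a, S.grading a = S.grading.toStarAlgHom a := fun _ => rfl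
  simp only [funext this]
  exact map_continuous _

/-! ### Words -/

theorem word_nil : S.word [] = 1 := rfl

theorem word_cons (p : S.Mode × Bool) (w : List (S.Mode × Bool)) :
    S.word (p :: w) = S.γ p.1 p.2 * S.word w := by
  simp [word]

theorem word_append (w w' : List (S.Mode × Bool)) : S.word (w ++ w') = S.word w * S.word w' := by
  simp [word]

theorem star_word (w : List (S.Mode × Bool)) : star (S.word w) = S.word w.reverse := by
  induction w with
  | nil => simp [word_nil]
  | cons p w ih => rw [word_cons, star_mul, ih, star_γ, List.reverse_cons, word_append, word_cons,
      word_nil, mul_one]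

theorem grading_word (w : List (S.Mode × Bool)) :
    S.grading (S.word w) = κ.sgn ^ w.length • S.word w := by
  induction w with
  | nil => simp [word_nil]
  | cons p w ih =>
    rw [word_cons, _root_.map_mul, ih, grading_γ, List.length_cons, pow_succ', smul_mul_smul_comm]

theorem grading_word_eq (w : List (S.Mode × Bool)) :
    S.grading (S.word w) = S.word w ∨ S.grading (S.word w) = -S.word w := by
  rw [grading_word]
  have : κ.sgn ^ w.length = 1 ∨ κ.sgn ^ w.length = -1 := by
    rcases κ.sgn_eq with h | h <;> rw [h]
    · simp
    · exact neg_one_pow_eq_or ℂ _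
  rcases this with h | h <;> simp [h]

/-! ### Algebras generated by sets of modes -/

/-- The C⋆-algebra generated by a set of modes. -/
def modeAlgebra (M : Set S.Mode) : StarSubalgebra ℂ S.Observables :=
  (StarAlgebra.adjoin ℂ {a | ∃ m b, m ∈ M ∧ a = S.γ m b}).topologicalClosure

variable {S}

theorem γ_mem_modeAlgebra {M : Set S.Mode} {m : S.Mode} (hm : m ∈ M) (b : Bool) :
    S.γ m b ∈ S.modeAlgebra M :=
  StarSubalgebra.le_topologicalClosure _ (StarAlgebra.subset_adjoin ℂ _ ⟨m, b, hm, rfl⟩)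

theorem word_mem_modeAlgebra {M : Set S.Mode} {w : List (S.Mode × Bool)} (hw : ∀ p ∈ w, p.1 ∈ M) :
    S.word w ∈ S.modeAlgebra M := by
  induction w with
  | nil => exact one_mem _
  | cons p w ih =>
    rw [word_cons]
    exact mul_mem (γ_mem_modeAlgebra (hw p (by simp)) _) (ih fun q hq => hw q (by simp [hq]))

theorem isClosed_modeAlgebra (M : Set S.Mode) :
    IsClosed (S.modeAlgebra M : Set S.Observables) :=
  StarSubalgebra.isClosed_topologicalClosure _

theorem modeAlgebra_le {M : Set S.Mode} {B : StarSubalgebra ℂ S.Observables}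
    (hB : IsClosed (B : Set S.Observables)) (h : ∀ m ∈ M, ∀ b, S.γ m b ∈ B) :
    S.modeAlgebra M ≤ B := by
  refine StarSubalgebra.topologicalClosure_minimal (StarAlgebra.adjoin_le ?_) hB
  rintro _ ⟨m, b, hm, rfl⟩
  exact h m hm b

theorem modeAlgebra_mono {M N : Set S.Mode} (h : M ⊆ N) : S.modeAlgebra M ≤ S.modeAlgebra N :=
  modeAlgebra_le (isClosed_modeAlgebra N) fun _ hm b => γ_mem_modeAlgebra (h hm) b

/-- The words are total in the algebra generated by a set of modes. -/
theorem mem_of_mem_modeAlgebra {M : Set S.Mode} {N : Submodule ℂ S.Observables}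
    (hN : IsClosed (N : Set S.Observables))
    (h : ∀ w : List (S.Mode × Bool), (∀ p ∈ w, p.1 ∈ M) → S.word w ∈ N) :
    ∀ a ∈ S.modeAlgebra M, a ∈ N := by
  have key : ∀ a ∈ StarAlgebra.adjoin ℂ {a | ∃ m b, m ∈ M ∧ a = S.γ m b}, a ∈ N := by
    refine mem_of_mem_adjoin ?_ fun l hl => ?_
    · rintro _ ⟨m, b, -, rfl⟩
      exact S.star_γ m b
    · have : ∃ w : List (S.Mode × Bool), (∀ p ∈ w, p.1 ∈ M) ∧ S.word w = l.prod := by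
        induction l with
        | nil => exact ⟨[], by simp, rfl⟩
        | cons y l ih =>
          obtain ⟨w, hw, hwl⟩ := ih fun z hz => hl z (by simp [hz])
          obtain ⟨m, b, hm, rfl⟩ := hl y (by simp)
          exact ⟨(m, b) :: w, by simpa [hm] using hw, by rw [word_cons, hwl, List.prod_cons]⟩
      obtain ⟨w, hw, hwl⟩ := this
      rw [← hwl]
      exact h w hw
  intro a ha
  exact closure_minimal key hN ha

variable (S) in
/-- The inclusion of the quasi-local algebra into the bounded operators on Fock space. -/
def inclusion : S.Observables →⋆ₐ[ℂ] (Fock S.Mode →L[ℂ] Fock S.Mode) := S.quasiLocal.subtype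

/-- The quasi-local algebra is a closure among the operators on Fock space, while the algebra of all
modes is a closure inside the quasi-local algebra. The two agree because distances are inherited. -/
theorem mem_modeAlgebra_univ (a : S.Observables) : a ∈ S.modeAlgebra Set.univ := by
  have hcl : StarAlgebra.adjoin ℂ S.generators ≤ (S.modeAlgebra Set.univ).map S.inclusion := by
    refine StarAlgebra.adjoin_le ?_
    rintro _ ⟨p, rfl⟩
    exact ⟨S.γ p.1 p.2, γ_mem_modeAlgebra (Set.mem_univ p.1) p.2, rfl⟩
  have ha : a.1 ∈ closure
      (StarAlgebra.adjoin ℂ S.generators : Set (Fock S.Mode →L[ℂ] Fock S.Mode)) := a.2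
  have hcl' : a ∈ closure (S.modeAlgebra Set.univ : Set S.Observables) := by
    rw [Metric.mem_closure_iff] at ha ⊢
    intro ε hε
    obtain ⟨x, hx, hax⟩ := ha ε hε
    obtain ⟨b, hb, rfl⟩ := hcl hx
    exact ⟨b, hb, hax⟩
  rwa [(isClosed_modeAlgebra _).closure_eq] at hcl'

/-- The density argument used throughout: an identity that is linear and continuous in an observable
needs to be checked only on products of generators. -/
theorem continuousLinearMap_eq_of_word {E : Type*} [NormedAddCommGroup E] [NormedSpace ℂ E]
    {M : Set S.Mode} {f g : S.Observables →L[ℂ] E}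
    (h : ∀ w : List (S.Mode × Bool), (∀ p ∈ w, p.1 ∈ M) → f (S.word w) = g (S.word w)) :
    ∀ a ∈ S.modeAlgebra M, f a = g a :=
  mem_of_mem_modeAlgebra (N := LinearMap.eqLocus (f : S.Observables →ₗ[ℂ] E) g)
    (isClosed_eq f.continuous g.continuous) h

variable (S) in
/-- The grading automorphism as a continuous linear map. -/
def gradingL : S.Observables →L[ℂ] S.Observables where
  toFun := S.grading
  map_add' := map_add S.grading
  map_smul' := map_smul S.grading
  cont := S.continuous_grading

theorem grading_mem_modeAlgebra {M : Set S.Mode} {a : S.Observables} (ha : a ∈ S.modeAlgebra M) :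
    S.grading a ∈ S.modeAlgebra M := by
  refine mem_of_mem_modeAlgebra
    (N := (S.modeAlgebra M).toSubalgebra.toSubmodule.comap (S.gradingL : _ →ₗ[ℂ] _))
    ?_ ?_ a ha
  · exact (isClosed_modeAlgebra M).preimage S.continuous_grading
  intro w hw
  change S.grading (S.word w) ∈ S.modeAlgebra M
  rw [grading_word]
  exact SMulMemClass.smul_mem _ (word_mem_modeAlgebra hw)

/-- A generator moves past an observable of the other modes up to the grading. -/
theorem γ_mul_of_mem {M : Set S.Mode} {m : S.Mode} (hm : m ∉ M) (b : Bool) {x : S.Observables}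
    (hx : x ∈ S.modeAlgebra M) : S.γ m b * x = S.grading x * S.γ m b := by
  refine continuousLinearMap_eq_of_word (f := ContinuousLinearMap.mul ℂ _ (S.γ m b))
    (g := ((ContinuousLinearMap.mul ℂ _).flip (S.γ m b)).comp S.gradingL) ?_ x hx
  intro w hw
  change S.γ m b * S.word w = S.grading (S.word w) * S.γ m b
  induction w with
  | nil => simp [word_nil]
  | cons p w ih =>
    have hp : m ≠ p.1 := fun h => hm (h ▸ hw p (by simp))
    rw [word_cons, ← mul_assoc, γ_mul_γ_of_ne S hp, smul_mul_assoc, mul_assoc,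
      ih fun q hq => hw q (by simp [hq]), _root_.map_mul, grading_γ, ← mul_assoc, smul_mul_assoc,
      smul_mul_assoc]

/-- Every generator outside `M` passes an observable of `M` at the cost of one application of `η`,
which does nothing to an even one. -/
theorem commute_of_even {M N : Set S.Mode} (hMN : Disjoint M N) {x y : S.Observables}
    (hx : x ∈ S.modeAlgebra M) (hy : y ∈ S.modeAlgebra N) (hgx : S.grading x = x) :
    x * y = y * x := by
  refine continuousLinearMap_eq_of_word (f := ContinuousLinearMap.mul ℂ _ x)
    (g := (ContinuousLinearMap.mul ℂ _).flip x) ?_ y hy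
  intro w hw
  change x * S.word w = S.word w * x
  induction w with
  | nil => simp [word_nil]
  | cons p w ih =>
    have hp : p.1 ∉ M := fun h => Set.disjoint_left.1 hMN h (hw p (by simp))
    have h := γ_mul_of_mem hp p.2 hx
    rw [hgx] at h
    rw [word_cons, ← mul_assoc, ← h, mul_assoc, ih fun q hq => hw q (by simp [hq]), mul_assoc]

theorem mul_of_odd {M N : Set S.Mode} (hMN : Disjoint M N) {x y : S.Observables}
    (hx : x ∈ S.modeAlgebra M) (hy : y ∈ S.modeAlgebra N) (hgx : S.grading x = -x) :
    x * y = S.grading y * x := by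
  cases κ with
  | bosonic =>
    -- For bosons `η` is the identity, so the only odd observable is zero.
    have : x = 0 := by
      rw [grading_bosonic] at hgx
      have h2 : (2 : ℂ) • x = 0 := by
        rw [two_smul]
        nth_rewrite 1 [hgx]
        exact neg_add_cancel x
      exact (smul_eq_zero.1 h2).resolve_left two_ne_zero
    simp [this]
  | fermionic =>
  refine continuousLinearMap_eq_of_word (f := ContinuousLinearMap.mul ℂ _ x)
    (g := ((ContinuousLinearMap.mul ℂ _).flip x).comp S.gradingL) ?_ y hy
  intro w hw
  change x * S.word w = S.grading (S.word w) * x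
  induction w with
  | nil => simp [word_nil]
  | cons p w ih =>
    have hp : p.1 ∉ M := fun h => Set.disjoint_left.1 hMN h (hw p (by simp))
    have h := γ_mul_of_mem hp p.2 hx
    rw [hgx, neg_mul, ← neg_eq_iff_eq_neg] at h
    rw [word_cons, ← mul_assoc, ← h, neg_mul, mul_assoc, ih fun q hq => hw q (by simp [hq]),
      _root_.map_mul, grading_γ, mul_assoc]
    simp [Statistics.sgn]

/-- Graded commutation of homogeneous observables of disjoint sets of modes. -/
theorem graded_commute {M N : Set S.Mode} (hMN : Disjoint M N) {x y : S.Observables}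
    (hx : x ∈ S.modeAlgebra M) (hy : y ∈ S.modeAlgebra N) (a b : Fin 2)
    (hgx : S.grading x = (-1 : ℂ) ^ (a : ℕ) • x) (hgy : S.grading y = (-1 : ℂ) ^ (b : ℕ) • y) :
    x * y = (-1 : ℂ) ^ ((a : ℕ) * (b : ℕ)) • (y * x) := by
  fin_cases a
  · simpa using commute_of_even hMN hx hy (by simpa using hgx)
  · rw [mul_of_odd hMN hx hy (by simpa using hgx), hgy]
    simp

/-- Up to a sign, the letters of a word that satisfy `P` can be moved to the front. -/
theorem exists_word_eq_filter (P : S.Mode → Prop) [DecidablePred P] (w : List (S.Mode × Bool)) :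
    ∃ s : ℂ, s * s = 1 ∧ S.word w =
      s • (S.word (w.filter fun p => P p.1) * S.word (w.filter fun p => ¬ P p.1)) := by
  induction w with
  | nil => exact ⟨1, by simp, by simp [word_nil]⟩
  | cons p w ih =>
    obtain ⟨s, hs, h⟩ := ih
    by_cases hp : P p.1
    · refine ⟨s, hs, ?_⟩
      simp only [List.filter_cons, hp, decide_true, if_true, not_true_eq_false, decide_false,
        Bool.false_eq_true, if_false]
      rw [word_cons, h, word_cons, mul_smul_comm, mul_assoc]
    · have hx := γ_mul_of_mem (S := S) (M := {m | P m}) hp p.2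
        (word_mem_modeAlgebra (w := w.filter fun p => P p.1) (by simp))
      simp only [List.filter_cons, hp, decide_true, if_true, decide_false, not_false_eq_true,
        Bool.false_eq_true, if_false]
      rcases S.grading_word_eq (w.filter fun p => P p.1) with hg | hg
      · refine ⟨s, hs, ?_⟩
        rw [word_cons, h, word_cons, mul_smul_comm, ← mul_assoc, hx, hg, mul_assoc]
      · refine ⟨-s, by simpa using hs, ?_⟩
        rw [word_cons, h, word_cons, mul_smul_comm, ← mul_assoc, hx, hg, neg_mul, neg_mul,
          mul_assoc]
        simp

end SpinSystem

/-! ### The generators of finitely many modes generate all matrices -/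

section MatrixUnits

variable {M : Type} [LinearOrder M]

/-- The algebra generated by the generators of all modes. -/
def genAlgebra (κ : Statistics) (M : Type) [LinearOrder M] :
    StarSubalgebra ℂ (Fock M →L[ℂ] Fock M) :=
  StarAlgebra.adjoin ℂ (Set.range fun p : M × Bool => gen κ p.1 p.2)

theorem gen_mem_genAlgebra (κ : Statistics) (m : M) (b : Bool) : gen κ m b ∈ genAlgebra κ M :=
  StarAlgebra.subset_adjoin ℂ _ ⟨(m, b), rfl⟩

/-- The product of the two generators of a mode is diagonal with eigenvalues `±i` according to the
occupation, so an affine combination with the identity projects onto the empty mode. -/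
theorem exists_empty_mem_genAlgebra (κ : Statistics) (m : M) :
    ∃ X ∈ genAlgebra κ M, ∀ (f : Fock M) (T : Finset M), X f T = if m ∈ T then 0 else f T := by
  refine ⟨(1 / 2 : ℂ) • (1 - Complex.I • (gen κ m false * gen κ m true)), ?_, fun f T => ?_⟩
  · exact SMulMemClass.smul_mem _ (sub_mem (one_mem _) (SMulMemClass.smul_mem _
      (mul_mem (gen_mem_genAlgebra κ m false) (gen_mem_genAlgebra κ m true))))
  · change (1 / 2 : ℂ) * (f T - Complex.I * (genWeight κ m false (symmDiff T {m}) *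
      (genWeight κ m true (symmDiff (symmDiff T {m}) {m}) * f (symmDiff (symmDiff T {m}) {m})))) = _
    rw [symmDiff_symmDiff_cancel_right, genWeight, genWeight,
      stringSign_symmDiff_of_not_lt κ (lt_irrefl m)]
    have h2 := stringSign_mul_self κ m T
    have h3 := Complex.I_mul_I
    by_cases h : m ∈ T
    · simp only [h, if_true, if_false, Bool.false_eq_true]
      linear_combination (1 / 2 * Complex.I * Complex.I * f T) * h2 + 1 / 2 * f T * h3
    · simp only [h, if_true, if_false, Bool.false_eq_true]
      linear_combination (-1 / 2 * Complex.I * Complex.I * f T) * h2 - 1 / 2 * f T * h3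

theorem exists_agree_mem_genAlgebra (κ : Statistics) (U A : Finset M) :
    ∃ X ∈ genAlgebra κ M, ∀ (f : Fock M) (T : Finset M),
      X f T = if ∀ m ∈ A, (m ∈ T ↔ m ∈ U) then f T else 0 := by
  induction A using Finset.induction_on with
  | empty => exact ⟨1, one_mem _, fun f T => by simp⟩
  | insert m A hm ih =>
    obtain ⟨X, hX, hXf⟩ := ih
    obtain ⟨Y, hY, hYf⟩ := exists_empty_mem_genAlgebra κ m
    by_cases hU : m ∈ U
    · refine ⟨(1 - Y) * X, mul_mem (sub_mem (one_mem _) hY) hX, fun f T => ?_⟩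
      change X f T - Y (X f) T = _
      rw [hYf, hXf]
      by_cases hT : m ∈ T <;> simp [hT, hU]
    · refine ⟨Y * X, mul_mem hY hX, fun f T => ?_⟩
      change Y (X f) T = _
      rw [hYf, hXf]
      by_cases hT : m ∈ T <;> simp [hT, hU]

/-- A product of one generator per mode of `A` toggles exactly the modes of `A`. The phases
collected on the way are irrelevant as long as they can be divided out. -/
theorem exists_shift_mem_genAlgebra (κ : Statistics) (A : Finset M) :
    ∃ X ∈ genAlgebra κ M, ∃ c : Finset M → ℂ, (∀ T, c T ≠ 0) ∧ ∀ (f : Fock M) (T : Finset M),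
      X f T = c T * f (symmDiff T A) := by
  induction A using Finset.induction_on with
  | empty => exact ⟨1, one_mem _, fun _ => 1, by simp, fun f T => by
      rw [show symmDiff T ∅ = T from symmDiff_bot T]; simp⟩
  | insert m A hm ih =>
    obtain ⟨X, hX, c, hc, hXf⟩ := ih
    refine ⟨gen κ m false * X, mul_mem (gen_mem_genAlgebra κ m false) hX,
      fun T => genWeight κ m false (symmDiff T {m}) * c (symmDiff T {m}), fun T => ?_,
      fun f T => ?_⟩
    · refine mul_ne_zero (fun h => ?_) (hc _)
      have := norm_genWeight κ m false (symmDiff T {m})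
      simp [h] at this
    · change genWeight κ m false (symmDiff T {m}) * X f (symmDiff T {m}) = _
      have e : symmDiff (symmDiff T {m}) A = symmDiff T (insert m A) := by
        rw [symmDiff_assoc]
        congr 1
        ext x
        by_cases hx : x = m
        · subst hx; simp [Finset.mem_symmDiff, hm]
        · simp [Finset.mem_symmDiff, hx]
      rw [hXf, e, mul_assoc]

/-- The shift by `U ∆ V` exchanges `e_V` and `e_U` up to phases, and the projection onto `e_U`
removes all other components. -/
theorem exists_matrixUnit_mem_genAlgebra [Fintype M] (κ : Statistics) (U V : Finset M) :
    ∃ X ∈ genAlgebra κ M, ∀ (f : Fock M) (T : Finset M), X f T = if T = U then f V else 0 := by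
  obtain ⟨P, hP, hPf⟩ := exists_agree_mem_genAlgebra κ U Finset.univ
  obtain ⟨X, hX, c, hc, hXf⟩ := exists_shift_mem_genAlgebra κ (symmDiff U V)
  refine ⟨(c U)⁻¹ • (P * X), SMulMemClass.smul_mem _ (mul_mem hP hX), fun f T => ?_⟩
  change (c U)⁻¹ * P (X f) T = _
  rw [hPf, hXf]
  have h : (∀ m ∈ Finset.univ, (m ∈ T ↔ m ∈ U)) ↔ T = U := by simp [Finset.ext_iff]
  by_cases hT : T = U
  · subst hT
    simp [hc, symmDiff_symmDiff_cancel_left]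
  · rw [if_neg (by rwa [h]), if_neg hT, mul_zero]

theorem rankOne_mem_genAlgebra [Fintype M] (κ : Statistics) (v : Fock M) :
    InnerProductSpace.rankOne ℂ v v ∈ genAlgebra κ M := by
  choose X hX hXf using fun p : Finset M × Finset M =>
    exists_matrixUnit_mem_genAlgebra κ p.1 p.2
  have h : InnerProductSpace.rankOne ℂ v v =
      ∑ p : Finset M × Finset M, (v p.1 * star (v p.2)) • X p := by
    ext f T
    rw [InnerProductSpace.rankOne_apply, sum_apply, lp.coeFn_sum,
      Finset.sum_apply, lp.inner_eq_tsum, tsum_fintype, Fintype.sum_prod_type]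
    change (∑ U, ⟪v U, f U⟫_ℂ) * v T = ∑ U, ∑ V, v U * star (v V) * X (U, V) f T
    simp only [hXf]
    rw [Finset.sum_comm, Finset.sum_mul]
    refine Finset.sum_congr rfl fun V _ => ?_
    rw [Finset.sum_eq_single T]
    · simp; ring
    · intro U _ hU
      simp [Ne.symm hU]
    · simp
  rw [h]
  exact sum_mem fun p _ => SMulMemClass.smul_mem _ (hX p)

end MatrixUnits

/-! ### Even projections onto the vector of a cell -/

section CellProjection

variable {κ : Statistics} {S : SpinSystem κ} {H : Type} [NormedAddCommGroup H]
  [InnerProductSpace ℂ H] [CompleteSpace H]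

theorem parity_mul_parity_mul (M : Type) (b : Fock M →L[ℂ] Fock M) :
    parityOp κ M * (parityOp κ M * b) = b := by
  rw [← mul_assoc, parityOp_mul_self, one_mul]

/-- The projection `q` onto the vector `Ω` in the cell `C` of modes: it is an even observable
that maps `y Ω` to a multiple of `Ω` for all words `y` of the cell. -/
structure IsCellProjection (ρ : S.Observables →⋆ₐ[ℂ] (H →L[ℂ] H)) (Ω : H) (C : Set S.Mode)
    (q : S.Observables) : Prop where
  mem : q ∈ S.modeAlgebra C
  star_eq : star q = q
  even : S.grading q = q
  fix : ρ q Ω = Ω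
  word : ∀ w : List (S.Mode × Bool), (∀ p ∈ w, p.1 ∈ C) →
    ∃ c : ℂ, ρ q (ρ (S.word w) Ω) = c • Ω ∧ (c = 0 ∨ S.grading (S.word w) = S.word w)

/-- Pairs of corresponding elements of a cell and of the on-site matrix algebra. -/
def cellPairs (S : SpinSystem κ) {k : ℕ} (c : Fin k → S.Mode) :
    StarSubalgebra ℂ (S.Observables × (Fock (Fin k) →L[ℂ] Fock (Fin k))) :=
  StarAlgebra.adjoin ℂ (Set.range fun p : Fin k × Bool => (S.γ (c p.1) p.2, gen κ p.1 p.2))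

variable {k : ℕ} {c : Fin k → S.Mode}

theorem γ_mem_cellPairs (p : Fin k × Bool) :
    (S.γ (c p.1) p.2, gen κ p.1 p.2) ∈ cellPairs S c :=
  StarAlgebra.subset_adjoin ℂ _ ⟨p, rfl⟩

theorem word_mem_cellPairs (w : List (Fin k × Bool)) :
    (S.word (w.map fun p => (c p.1, p.2)), genWord κ w) ∈ cellPairs S c := by
  induction w with
  | nil => exact one_mem _
  | cons p w ih =>
    have h := mul_mem (γ_mem_cellPairs (c := c) p) ih
    rw [List.map_cons, SpinSystem.word_cons]
    simpa [genWord] using h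

theorem fst_mem_of_mem_cellPairs {x : S.Observables × (Fock (Fin k) →L[ℂ] Fock (Fin k))}
    (hx : x ∈ cellPairs S c) : x.1 ∈ S.modeAlgebra (Set.range c) := by
  have h : cellPairs S c ≤ (S.modeAlgebra (Set.range c)).comap (StarAlgHom.fst ℂ _ _) := by
    refine StarAlgebra.adjoin_le ?_
    rintro _ ⟨p, rfl⟩
    exact SpinSystem.γ_mem_modeAlgebra (Set.mem_range_self p.1) p.2
  exact h hx

theorem grading_mem_cellPairs {x : S.Observables × (Fock (Fin k) →L[ℂ] Fock (Fin k))}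
    (hx : x ∈ cellPairs S c) :
    (S.grading x.1, parityOp κ (Fin k) * x.2 * parityOp κ (Fin k)) ∈ cellPairs S c := by
  induction hx using StarAlgebra.adjoin_induction with
  | mem y hy =>
    obtain ⟨p, rfl⟩ := hy
    have h := SMulMemClass.smul_mem κ.sgn (γ_mem_cellPairs (c := c) p)
    rw [SpinSystem.grading_γ, parityOp_mul_gen_mul_parityOp]
    exact h
  | algebraMap r =>
    have h : (S.grading (algebraMap ℂ S.Observables r),
        parityOp κ (Fin k) * algebraMap ℂ _ r * parityOp κ (Fin k)) =
        algebraMap ℂ (S.Observables × (Fock (Fin k) →L[ℂ] Fock (Fin k))) r := by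
      rw [Prod.algebraMap_apply, AlgHomClass.commutes, mul_assoc, Algebra.commutes, ← mul_assoc,
        parityOp_mul_self, one_mul]
    have h' := algebraMap_mem (cellPairs S c) r
    rw [← h] at h'
    exact h'
  | add y z hy hz ihy ihz =>
    have h := add_mem ihy ihz
    simpa [mul_add, add_mul] using h
  | mul y z hy hz ihy ihz =>
    have h := mul_mem ihy ihz
    simpa [mul_assoc, parity_mul_parity_mul] using h
  | star y hy ihy =>
    have h := star_mem ihy
    simpa only [Prod.star_def, star_mul, star_parityOp, mul_assoc, ← map_star] using h

/-- Transfers computations in a cell to on-site matrices. Working with the ⋆-algebra generated by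
pairs of generators, rather than with a homomorphism, avoids having to show that the correspondence
is a well-defined map. -/
theorem functional_of_mem_cellPairs {ω : State S.Observables} {v : Fock (Fin k)}
    (hω : ∀ w : List (Fin k × Bool),
      ω.functional (S.word (w.map fun p => (c p.1, p.2))) = ⟪v, genWord κ w v⟫_ℂ)
    {x : S.Observables × (Fock (Fin k) →L[ℂ] Fock (Fin k))} (hx : x ∈ cellPairs S c) :
    ω.functional x.1 = ⟪v, x.2 v⟫_ℂ := by
  let f : (S.Observables × (Fock (Fin k) →L[ℂ] Fock (Fin k))) →ₗ[ℂ] ℂ :=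
    ω.functional.toLinearMap ∘ₗ LinearMap.fst ℂ _ _
  let g : (S.Observables × (Fock (Fin k) →L[ℂ] Fock (Fin k))) →ₗ[ℂ] ℂ :=
    { toFun := fun x => ⟪v, x.2 v⟫_ℂ
      map_add' := fun x y => by simp
      map_smul' := fun r x => by simp }
  refine mem_of_mem_adjoin (N := LinearMap.eqLocus f g) ?_ (fun l hl => ?_) x hx
  · rintro _ ⟨p, rfl⟩
    exact Prod.ext (S.star_γ _ _) (star_gen _ _ _)
  · have : ∃ w : List (Fin k × Bool),
        (S.word (w.map fun p => (c p.1, p.2)), genWord κ w) = l.prod := by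
      induction l with
      | nil => exact ⟨[], rfl⟩
      | cons y l ih =>
        obtain ⟨w, hw⟩ := ih fun z hz => hl z (by simp [hz])
        obtain ⟨p, rfl⟩ := hl y (by simp)
        refine ⟨p :: w, ?_⟩
        rw [List.prod_cons, ← hw, List.map_cons, SpinSystem.word_cons]
        simp [genWord]
    obtain ⟨w, hw⟩ := this
    rw [← hw]
    exact hω w

theorem exists_map_eq_of_range {w : List (S.Mode × Bool)} (hw : ∀ p ∈ w, p.1 ∈ Set.range c) :
    ∃ w' : List (Fin k × Bool), (w'.map fun p => (c p.1, p.2)) = w := by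
  induction w with
  | nil => exact ⟨[], rfl⟩
  | cons p w ih =>
    obtain ⟨w', rfl⟩ := ih fun q hq => hw q (by simp [hq])
    obtain ⟨i, hi⟩ := hw p (by simp)
    exact ⟨(i, p.2) :: w', by simp [hi]⟩

theorem norm_sq_apply_vac {ρ : S.Observables →⋆ₐ[ℂ] (H →L[ℂ] H)} {Ω : H} {ω : State S.Observables}
    (hΩ : ∀ a, ⟪Ω, ρ a Ω⟫_ℂ = ω.functional a) (a b : S.Observables) :
    ⟪ρ a Ω, ρ b Ω⟫_ℂ = ω.functional (star a * b) := by
  rw [← hΩ, _root_.map_mul, map_star, mul_apply_eq_comp, ContinuousLinearMap.star_eq_adjoint,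
    ContinuousLinearMap.adjoint_inner_right]

/-- A state that is a pure even vector state on a cell has a cell projection. -/
theorem exists_isCellProjection {ρ : S.Observables →⋆ₐ[ℂ] (H →L[ℂ] H)} {Ω : H}
    {ω : State S.Observables} (hΩ : ∀ a, ⟪Ω, ρ a Ω⟫_ℂ = ω.functional a) {v : Fock (Fin k)}
    (hv : ‖v‖ = 1) (hev : parityOp κ (Fin k) v = v)
    (hω : ∀ w : List (Fin k × Bool),
      ω.functional (S.word (w.map fun p => (c p.1, p.2))) = ⟪v, genWord κ w v⟫_ℂ) :
    ∃ q, IsCellProjection ρ Ω (Set.range c) q := by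
  set P := InnerProductSpace.rankOne ℂ v v with hP
  have hPv : ∀ f, P f = ⟪v, f⟫_ℂ • v := fun f => InnerProductSpace.rankOne_apply ..
  have hvv : ⟪v, v⟫_ℂ = 1 := by
    rw [inner_self_eq_norm_sq_to_K, hv]; simp
  have hsP : star P = P := by
    rw [ContinuousLinearMap.star_eq_adjoint, hP, InnerProductSpace.adjoint_rankOne]
  have hPP : parityOp κ (Fin k) * P * parityOp κ (Fin k) = P := by
    ext1 f
    rw [mul_apply_eq_comp, mul_apply_eq_comp, hPv, map_smul, hev, hPv]
    congr 1
    rw [← ContinuousLinearMap.adjoint_inner_left, ← ContinuousLinearMap.star_eq_adjoint,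
      star_parityOp, hev]
  have hmap : (cellPairs S c).map (StarAlgHom.snd ℂ _ _) = genAlgebra κ (Fin k) := by
    rw [cellPairs, StarAlgHom.map_adjoin, ← Set.range_comp]
    rfl
  -- Any observable paired with `P` will do. Averaging it with its adjoint and then with its image
  -- under the grading keeps the partner `P`, which is self-adjoint and even.
  obtain ⟨⟨q₀, P'⟩, hq₀', hP'⟩ : P ∈ (cellPairs S c).map (StarAlgHom.snd ℂ _ _) := by
    rw [hmap]; exact rankOne_mem_genAlgebra κ v
  have hq₀ : (q₀, P) ∈ cellPairs S c := by
    rw [← hP']; exact hq₀'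
  have hq₁ : ((1 / 2 : ℂ) • (q₀ + star q₀), P) ∈ cellPairs S c := by
    have h := SMulMemClass.smul_mem (1 / 2 : ℂ) (add_mem hq₀ (star_mem hq₀))
    convert h using 1
    refine Prod.ext rfl ?_
    change P = (1 / 2 : ℂ) • (P + star P)
    rw [hsP, ← two_smul ℂ, smul_smul]
    norm_num
  set q₁ := (1 / 2 : ℂ) • (q₀ + star q₀) with hq₁d
  have hsq₁ : star q₁ = q₁ := by
    rw [hq₁d, star_smul, star_add, star_star, add_comm]
    simp
  have hq : ((1 / 2 : ℂ) • (q₁ + S.grading q₁), P) ∈ cellPairs S c := by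
    have h := SMulMemClass.smul_mem (1 / 2 : ℂ) (add_mem hq₁ (grading_mem_cellPairs hq₁))
    convert h using 1
    refine Prod.ext rfl ?_
    change P = (1 / 2 : ℂ) • (P + parityOp κ (Fin k) * P * parityOp κ (Fin k))
    rw [hPP, ← two_smul ℂ, smul_smul]
    norm_num
  set q := (1 / 2 : ℂ) • (q₁ + S.grading q₁) with hqd
  clear_value q₁
  -- Since `‖ρ(x) Ω‖² = ‖b v‖²` for a pair `(x, b)`, every matrix identity on `v` becomes an
  -- identity on `Ω`.
  have hvec : ∀ {x : S.Observables} {b : Fock (Fin k) →L[ℂ] Fock (Fin k)},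
      (x, b) ∈ cellPairs S c → b v = 0 → ρ x Ω = 0 := by
    intro x b hx hb
    have h := functional_of_mem_cellPairs hω (mul_mem (star_mem hx) hx)
    change ω.functional (star x * x) = ⟪v, star b (b v)⟫_ℂ at h
    rw [hb, map_zero, inner_zero_right, ← norm_sq_apply_vac hΩ] at h
    exact inner_self_eq_zero.1 h
  have hfix : ρ q Ω = Ω := by
    have h := hvec (sub_mem hq (one_mem _)) (by
      change P v - v = 0
      rw [hPv, hvv, one_smul, sub_self])
    change ρ (q - 1) Ω = 0 at h
    rw [map_sub, _root_.map_one] at h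
    exact sub_eq_zero.1 h
  refine ⟨q, fst_mem_of_mem_cellPairs hq, ?_, ?_, hfix, fun w hw => ?_⟩
  · rw [hqd, star_smul, star_add, ← map_star, hsq₁]
    simp
  · rw [hqd, map_smul, map_add, SpinSystem.grading_grading, add_comm]
  · clear_value q
    obtain ⟨w', rfl⟩ := exists_map_eq_of_range hw
    set x := S.word (w'.map fun p => (c p.1, p.2)) with hx
    set b := genWord κ w' with hb
    have hxb : (x, b) ∈ cellPairs S c := word_mem_cellPairs w'
    refine ⟨⟪v, b v⟫_ℂ, ?_, ?_⟩
    · have h := hvec (sub_mem (mul_mem hq hxb) (SMulMemClass.smul_mem ⟪v, b v⟫_ℂ (one_mem _))) (by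
        change P (b v) - ⟪v, b v⟫_ℂ • v = 0
        rw [hPv, sub_self])
      change ρ (q * x - ⟪v, b v⟫_ℂ • 1) Ω = 0 at h
      rw [map_sub, _root_.map_mul, map_smul, _root_.map_one] at h
      exact sub_eq_zero.1 h
    -- The vector `v` is even, so the expectation value of an odd word equals its own negative.
    · rcases S.grading_word_eq (w'.map fun p => (c p.1, p.2)) with h | h
      · exact Or.inr h
      · left
        have h1 := functional_of_mem_cellPairs hω (grading_mem_cellPairs hxb)
        have h2 := functional_of_mem_cellPairs hω hxb
        change ω.functional (S.grading x) =
          ⟪v, parityOp κ (Fin k) (b (parityOp κ (Fin k) v))⟫_ℂ at h1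
        change ω.functional x = ⟪v, b v⟫_ℂ at h2
        rw [h, hev, ← ContinuousLinearMap.adjoint_inner_left,
          ← ContinuousLinearMap.star_eq_adjoint, star_parityOp, hev, map_neg, h2] at h1
        exact self_eq_neg.1 h1.symm

end CellProjection

/-! ### Product vectors -/

section ProductState

variable {κ : Statistics} {S : SpinSystem κ} {H : Type} [NormedAddCommGroup H]
  [InnerProductSpace ℂ H] [CompleteSpace H]

theorem SpinSystem.exists_sign_word_mul_word {M N : Set S.Mode} (hMN : Disjoint M N)
    {w w' : List (S.Mode × Bool)} (hw : ∀ p ∈ w, p.1 ∈ M) (hw' : ∀ p ∈ w', p.1 ∈ N) :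
    ∃ s : ℂ, S.word w * S.word w' = s • (S.word w' * S.word w) := by
  have hx := word_mem_modeAlgebra hw
  have hy := word_mem_modeAlgebra hw'
  rcases S.grading_word_eq w with h | h
  · exact ⟨1, by rw [one_smul, commute_of_even hMN hx hy h]⟩
  · rw [mul_of_odd hMN hx hy h]
    rcases S.grading_word_eq w' with h' | h'
    · exact ⟨1, by rw [one_smul, h']⟩
    · exact ⟨-1, by rw [h']; simp⟩

theorem inner_star_apply (ρ : S.Observables →⋆ₐ[ℂ] (H →L[ℂ] H)) (a : S.Observables) (x y : H) :
    ⟪x, ρ (star a) y⟫_ℂ = ⟪ρ a x, y⟫_ℂ := by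
  rw [map_star, ContinuousLinearMap.star_eq_adjoint, ContinuousLinearMap.adjoint_inner_right]

theorem map_mul_apply (ρ : S.Observables →⋆ₐ[ℂ] (H →L[ℂ] H)) (a b : S.Observables) (x : H) :
    ρ (a * b) x = ρ a (ρ b x) := by
  rw [_root_.map_mul]; rfl

/-- The map `a ↦ ρ(a) Ω`. -/
def vecL (ρ : S.Observables →⋆ₐ[ℂ] (H →L[ℂ] H)) (Ω : H) : S.Observables →L[ℂ] H where
  toFun a := ρ a Ω
  map_add' a b := by simp
  map_smul' c a := by simp
  cont := (ContinuousLinearMap.apply ℂ H Ω).continuous.comp (map_continuous ρ)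

@[simp] theorem vecL_apply (ρ : S.Observables →⋆ₐ[ℂ] (H →L[ℂ] H)) (Ω : H) (a : S.Observables) :
    vecL ρ Ω a = ρ a Ω := rfl

/-- A cyclic unit vector in a representation that is a product of pure even vectors over the
cells of modes. -/
structure IsProductVector {I : Type} (cell : S.Mode → I) (ρ : S.Observables →⋆ₐ[ℂ] (H →L[ℂ] H))
    (Ω : H) : Prop where
  norm_eq : ‖Ω‖ = 1
  total : Total fun a => ρ a Ω
  projection : ∀ i, ∃ q, IsCellProjection ρ Ω {m | cell m = i} q

variable {I : Type} {cell : S.Mode → I} {ρ : S.Observables →⋆ₐ[ℂ] (H →L[ℂ] H)} {Ω : H}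

/-- A set of modes that is a union of cells. -/
def IsSaturated (cell : S.Mode → I) (M : Set S.Mode) : Prop :=
  ∀ m k, cell m = cell k → m ∈ M → k ∈ M

theorem IsSaturated.compl {M : Set S.Mode} (hM : IsSaturated cell M) : IsSaturated cell Mᶜ :=
  fun m k h hm hk => hm (hM k m h.symm hk)

namespace IsProductVector

variable (hΩ : IsProductVector cell ρ Ω)
include hΩ

theorem inner_self : ⟪Ω, Ω⟫_ℂ = 1 := by
  rw [inner_self_eq_norm_sq_to_K, hΩ.norm_eq]; simp

/-- A word meets only finitely many cells, and the product of their cell projections serves as `Q`.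
The induction removes the letters in the cell of the first letter. As `q` is even, it passes the
remaining letters without a sign. -/
theorem exists_projection {M : Set S.Mode} (hM : IsSaturated cell M) :
    ∀ w : List (S.Mode × Bool), (∀ p ∈ w, p.1 ∈ M) →
      ∃ Q ∈ S.modeAlgebra M, S.grading Q = Q ∧ ρ Q Ω = Ω ∧
        ∃ c : ℂ, ρ (star Q) (ρ (S.word w) Ω) = c • Ω ∧
          (c = 0 ∨ S.grading (S.word w) = S.word w) := by
  classical
  intro w
  induction h : w.length using Nat.strong_induction_on generalizing w with
  | _ n ih =>
  intro hw
  cases w with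
  | nil => exact ⟨1, one_mem _, map_one _, by simp, 1, by simp [SpinSystem.word_nil],
      Or.inr (by simp [SpinSystem.word_nil])⟩
  | cons p w' =>
  set i := cell p.1 with hi
  set w := p :: w' with hwd
  obtain ⟨s, -, hs⟩ := SpinSystem.exists_word_eq_filter (fun m => cell m = i) w
  set wi := w.filter fun p => cell p.1 = i with hwi
  set wr := w.filter fun p => ¬ cell p.1 = i with hwr
  have hlen : wr.length < n := by
    rw [← h, hwr, hwd]
    refine List.length_filter_lt_length_iff_exists.2 ⟨p, by simp, by simp [hi]⟩
  have hwiC : ∀ p ∈ wi, p.1 ∈ {m | cell m = i} := fun p hp => by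
    simpa using (List.mem_filter.1 hp).2
  have hwrC : ∀ p ∈ wr, p.1 ∈ {m | cell m = i}ᶜ := fun p hp => by
    simpa using (List.mem_filter.1 hp).2
  obtain ⟨Q, hQ, hQe, hQΩ, c, hc, hcw⟩ := ih _ hlen wr rfl
    fun p hp => hw p (List.mem_filter.1 hp).1
  obtain ⟨q, hq⟩ := hΩ.projection i
  obtain ⟨d, hd, hdw⟩ := hq.word wi hwiC
  have hdis : Disjoint {m | cell m = i} ({m | cell m = i}ᶜ : Set S.Mode) := disjoint_compl_right
  obtain ⟨s', hs'⟩ := SpinSystem.exists_sign_word_mul_word hdis hwiC hwrC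
  have hsub : {m | cell m = i} ⊆ M := fun m hm =>
      hM _ _ (hi.symm.trans (Eq.symm hm)) (hw p (by simp [hwd]))
  refine ⟨q * Q, mul_mem (SpinSystem.modeAlgebra_mono hsub hq.mem) hQ, ?_, ?_, s * s' * d * c, ?_, ?_⟩
  · rw [_root_.map_mul, hq.even, hQe]
  · rw [map_mul_apply, hQΩ, hq.fix]
  · rw [star_mul, hq.star_eq, hs, hs', map_mul_apply, smul_smul, map_smul, smul_apply, map_smul,
      ← map_mul_apply ρ q, ← mul_assoc, SpinSystem.commute_of_even hdis hq.mem
        (SpinSystem.word_mem_modeAlgebra hwrC) hq.even, mul_assoc, map_mul_apply, map_mul_apply, hd,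
      map_smul, map_smul, map_smul, hc, smul_smul, smul_smul, mul_assoc]
  · rcases hcw with rfl | hcw
    · exact Or.inl (by simp)
    · rcases hdw with rfl | hdw
      · exact Or.inl (by simp)
      · right
        rw [hs, map_smul, _root_.map_mul, hcw, hdw]

/-- For a word `y` outside `M`, insert the even `Q` that fixes `Ω`. Its adjoint moves past `x` and
turns `y Ω` into a multiple of `Ω`; the multiple is `⟪Ω, ρ(y) Ω⟫`. -/
theorem inner_mul {M : Set S.Mode} (hM : IsSaturated cell M) {x y : S.Observables}
    (hx : x ∈ S.modeAlgebra M) (hy : y ∈ S.modeAlgebra Mᶜ) :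
    ⟪Ω, ρ (x * y) Ω⟫_ℂ = ⟪Ω, ρ x Ω⟫_ℂ * ⟪Ω, ρ y Ω⟫_ℂ := by
  rw [map_mul_apply]
  refine SpinSystem.continuousLinearMap_eq_of_word
    (f := (innerSL ℂ Ω).comp ((ρ x).comp (vecL ρ Ω)))
    (g := ⟪Ω, ρ x Ω⟫_ℂ • (innerSL ℂ Ω).comp (vecL ρ Ω)) ?_ y hy
  · intro w hw
    change ⟪Ω, ρ x (ρ (S.word w) Ω)⟫_ℂ = ⟪Ω, ρ x Ω⟫_ℂ * ⟪Ω, ρ (S.word w) Ω⟫_ℂ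
    obtain ⟨Q, hQ, hQe, hQΩ, c, hc, -⟩ := hΩ.exists_projection hM.compl w hw
    have h1 : ∀ z : H, ⟪Ω, z⟫_ℂ = ⟪Ω, ρ (star Q) z⟫_ℂ := fun z => by
      rw [inner_star_apply, hQΩ]
    have hcomm : star Q * x = x * star Q :=
      SpinSystem.commute_of_even disjoint_compl_left (star_mem hQ) hx (by rw [map_star, hQe])
    rw [h1, h1 (ρ (S.word w) Ω), hc, ← map_mul_apply, hcomm, map_mul_apply, hc, map_smul,
      inner_smul_right, inner_smul_right, hΩ.inner_self]
    ring

/-- A word is either even or, by the alternative in `exists_projection`, has vanishing expectation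
value. -/
theorem inner_grading (a : S.Observables) : ⟪Ω, ρ (S.grading a) Ω⟫_ℂ = ⟪Ω, ρ a Ω⟫_ℂ := by
  refine SpinSystem.continuousLinearMap_eq_of_word
    (f := (innerSL ℂ Ω).comp ((vecL ρ Ω).comp S.gradingL))
    (g := (innerSL ℂ Ω).comp (vecL ρ Ω)) ?_ a (SpinSystem.mem_modeAlgebra_univ a)
  intro w hw
  change ⟪Ω, ρ (S.grading (S.word w)) Ω⟫_ℂ = ⟪Ω, ρ (S.word w) Ω⟫_ℂ
  obtain ⟨Q, hQ, hQe, hQΩ, c, hc, hcw⟩ := hΩ.exists_projection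
    (M := Set.univ) (fun _ _ _ _ => trivial) w hw
  rcases hcw with rfl | hcw
  · have h : ⟪Ω, ρ (S.word w) Ω⟫_ℂ = 0 := by
      rw [← hQΩ, ← inner_star_apply, hQΩ, hc, zero_smul, inner_zero_right]
    rcases S.grading_word_eq w with h' | h'
    · rw [h']
    · rw [h', map_neg, neg_apply, inner_neg_right, h, neg_zero]
  · rw [hcw]

/-- Invariance of the expectation values under the grading means that `ρ(a) Ω` and `ρ(η(a)) Ω` have
equal Gram matrices, which provides the operator. -/
theorem exists_parity : ∃ Θ : H →L[ℂ] H, Θ Ω = Ω ∧ (∀ a x, Θ (ρ a x) = ρ (S.grading a) (Θ x)) ∧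
    ∀ x y, ⟪Θ x, Θ y⟫_ℂ = ⟪x, y⟫_ℂ := by
  obtain ⟨Θ, h1, h2⟩ := hΩ.total.exists_isometry (fun a => ρ (S.grading a) Ω) (by
    intro a b
    rw [← inner_star_apply, ← inner_star_apply, ← map_star, ← map_mul_apply, ← map_mul_apply,
      ← _root_.map_mul, hΩ.inner_grading])
  have h3 : Θ Ω = Ω := by simpa using h1 1
  refine ⟨Θ, h3, fun a x => ?_, h2⟩
  have : Θ.comp (ρ a) = (ρ (S.grading a)).comp Θ := hΩ.total.ext fun b => by
    change Θ (ρ a (ρ b Ω)) = ρ (S.grading a) (Θ (ρ b Ω))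
    rw [h1, ← map_mul_apply, ← map_mul_apply, h1, _root_.map_mul]
  exact congrArg (fun T : H →L[ℂ] H => T x) this

omit hΩ in
/-- The closure of the space of vectors `ρ(a) Ω`, where `a` is an observable of the modes `M`. -/
def modeSpace (ρ : S.Observables →⋆ₐ[ℂ] (H →L[ℂ] H)) (Ω : H) (M : Set S.Mode) : Submodule ℂ H :=
  ((S.modeAlgebra M).toSubalgebra.toSubmodule.map (vecL ρ Ω : S.Observables →ₗ[ℂ] H)).topologicalClosure

omit hΩ in
theorem apply_mem_modeSpace {M : Set S.Mode} {a : S.Observables} (ha : a ∈ S.modeAlgebra M) :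
    ρ a Ω ∈ modeSpace ρ Ω M :=
  Submodule.le_topologicalClosure _ ⟨a, ha, rfl⟩

omit hΩ in
theorem modeSpace_induction {M : Set S.Mode} {p : H → Prop} (hp : IsClosed {x | p x})
    (h : ∀ a ∈ S.modeAlgebra M, p (ρ a Ω)) : ∀ x ∈ modeSpace ρ Ω M, p x := by
  intro x hx
  refine closure_minimal ?_ hp hx
  rintro _ ⟨a, ha, rfl⟩
  exact h a ha

/-- An operator that commutes with the observables outside `M` maps `Ω` to a vector of the
space of `M`. -/
theorem apply_mem_modeSpace_of_commute {M : Set S.Mode} (hM : IsSaturated cell M) {V : H →L[ℂ] H}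
    (hV : ∀ y ∈ S.modeAlgebra Mᶜ, ∀ x, V (ρ y x) = ρ y (V x)) : V Ω ∈ modeSpace ρ Ω M := by
  classical
  have : CompleteSpace (modeSpace ρ Ω M) :=
    (Submodule.isClosed_topologicalClosure _).completeSpace_coe
  obtain ⟨k, hk, l, hl, hkl⟩ := (modeSpace ρ Ω M).exists_add_mem_mem_orthogonal (V Ω)
  have key : ∀ w : List (S.Mode × Bool), ⟪l, ρ (S.word w) Ω⟫_ℂ = 0 := by
    intro w
    obtain ⟨s, -, hs⟩ := SpinSystem.exists_word_eq_filter (fun m => m ∈ M) w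
    have hx : S.word (w.filter fun p => p.1 ∈ M) ∈ S.modeAlgebra M :=
      SpinSystem.word_mem_modeAlgebra fun p hp => by simpa using (List.mem_filter.1 hp).2
    obtain ⟨Q, hQ, hQe, hQΩ, c, hc, -⟩ := hΩ.exists_projection hM.compl
      (w.filter fun p => ¬ p.1 ∈ M) fun p hp => by simpa using (List.mem_filter.1 hp).2
    -- An even `Q` outside `M` that fixes `Ω` also fixes the space of `M` and the vector `V Ω`,
    -- hence the orthogonal remainder `l`. Moving `Q` to the other side of the inner product
    -- replaces the letters outside `M` by a scalar, so `l` is orthogonal to all of `ρ(a) Ω`.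
    have hQk : ρ Q k = k := by
      refine modeSpace_induction (p := fun k => ρ Q k = k) (isClosed_eq (by fun_prop) (by fun_prop))
        ?_ k hk
      intro a ha
      rw [← map_mul_apply, SpinSystem.commute_of_even disjoint_compl_left hQ ha hQe,
        map_mul_apply, hQΩ]
    have hQV : ρ Q (V Ω) = V Ω := by rw [← hV Q hQ, hQΩ]
    have hQl : ρ Q l = l := by
      have h := hQV
      rw [hkl, map_add, hQk] at h
      exact add_left_cancel h
    have hcomm := SpinSystem.commute_of_even disjoint_compl_left (star_mem hQ) hx
      (by rw [map_star, hQe])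
    rw [hs, map_smul, smul_apply, inner_smul_right, ← hQl, ← inner_star_apply, ← map_mul_apply,
      ← mul_assoc, hcomm, mul_assoc, map_mul_apply, map_mul_apply, hc, map_smul, inner_smul_right,
      Submodule.inner_left_of_mem_orthogonal (apply_mem_modeSpace hx) hl, mul_zero, mul_zero]
  have hl0 : l = 0 := by
    refine hΩ.total l fun a => ?_
    rw [← inner_conj_symm, map_eq_zero]
    exact SpinSystem.continuousLinearMap_eq_of_word (f := (innerSL ℂ l).comp (vecL ρ Ω)) (g := 0)
      (fun w _ => key w) a (SpinSystem.mem_modeAlgebra_univ a)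
  rw [hkl, hl0, add_zero]
  exact hk

/-- For homogeneous `x` the element `x* x` is even, so `(x y)* (x y) = (x* x) (y* y)` and the
expectation value factorizes. On this space `ρ(x)` is thus controlled by `‖ρ(x) Ω‖`, whereas `‖x‖`
is not bounded along an approximation. -/
theorem norm_apply {M : Set S.Mode} (hM : IsSaturated cell M) {x : S.Observables}
    (hx : x ∈ S.modeAlgebra M) (a : Fin 2) (hgx : S.grading x = (-1 : ℂ) ^ (a : ℕ) • x) {z : H}
    (hz : z ∈ modeSpace ρ Ω Mᶜ) : ‖ρ x z‖ = ‖ρ x Ω‖ * ‖z‖ := by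
  refine modeSpace_induction (p := fun z => ‖ρ x z‖ = ‖ρ x Ω‖ * ‖z‖)
    (isClosed_eq (by fun_prop) (by fun_prop)) ?_ z hz
  intro y hy
  have hnorm : ∀ b : S.Observables, ((‖ρ b Ω‖ ^ 2 : ℝ) : ℂ) = ⟪Ω, ρ (star b * b) Ω⟫_ℂ := by
    intro b
    rw [map_mul_apply, inner_star_apply, inner_self_eq_norm_sq_to_K]
    norm_cast
  have he : S.grading (star x * x) = star x * x := by
    rw [_root_.map_mul, map_star, hgx]
    fin_cases a <;> simp
  have hex : star x * x ∈ S.modeAlgebra M := mul_mem (star_mem hx) hx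
  have h1 : star (x * y) * (x * y) = (star x * x) * (star y * y) := by
    have h := SpinSystem.commute_of_even disjoint_compl_right hex (star_mem hy) he
    rw [star_mul, ← mul_assoc, mul_assoc (star y), ← h, mul_assoc]
  have h2 : ‖ρ (x * y) Ω‖ ^ 2 = (‖ρ x Ω‖ * ‖ρ y Ω‖) ^ 2 := by
    have h : ((‖ρ (x * y) Ω‖ ^ 2 : ℝ) : ℂ) = ((‖ρ x Ω‖ ^ 2 * ‖ρ y Ω‖ ^ 2 : ℝ) : ℂ) := by
      rw [hnorm, h1, hΩ.inner_mul hM hex (mul_mem (star_mem hy) hy), Complex.ofReal_mul, hnorm,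
        hnorm]
    rw [mul_pow]
    exact_mod_cast h
  rw [← map_mul_apply]
  exact (sq_eq_sq₀ (norm_nonneg _) (by positivity)).1 h2

omit hΩ in
/-- Homogeneous vectors can be approximated with homogeneous observables. -/
theorem exists_homogeneous_approx {M : Set S.Mode} {Θ : H →L[ℂ] H} (hΘΩ : Θ Ω = Ω)
    (hΘ : ∀ a x, Θ (ρ a x) = ρ (S.grading a) (Θ x)) (hΘn : ∀ x, ‖Θ x‖ = ‖x‖) {z : H}
    (hz : z ∈ modeSpace ρ Ω M) (a : Fin 2) (hza : Θ z = (-1 : ℂ) ^ (a : ℕ) • z) {ε : ℝ}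
    (hε : 0 < ε) :
    ∃ x ∈ S.modeAlgebra M, S.grading x = (-1 : ℂ) ^ (a : ℕ) • x ∧ ‖z - ρ x Ω‖ < ε := by
  obtain ⟨_, ⟨x, hx, rfl⟩, hzx⟩ := Metric.mem_closure_iff.1 hz ε hε
  rw [dist_eq_norm] at hzx
  change ‖z - ρ x Ω‖ < ε at hzx
  set s : ℂ := (-1 : ℂ) ^ (a : ℕ) with hs
  have hss : s * s = 1 := by rw [hs]; fin_cases a <;> simp
  have hsn : ‖s‖ = 1 := by rw [hs]; simp
  -- The part of `x` with the desired parity approximates at least as well, because `Θ` is isometric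
  -- and fixes `z` up to the sign `s`.
  refine ⟨(1 / 2 : ℂ) • (x + s • S.grading x), ?_, ?_, ?_⟩
  · exact SMulMemClass.smul_mem _ (add_mem hx (SMulMemClass.smul_mem _
      (SpinSystem.grading_mem_modeAlgebra hx)))
  · rw [map_smul, map_add, map_smul, S.grading_grading, smul_comm s (1 / 2 : ℂ), smul_add s,
      smul_smul s s, hss, one_smul, add_comm]
  · have h1 : z - ρ ((1 / 2 : ℂ) • (x + s • S.grading x)) Ω =
        (1 / 2 : ℂ) • ((z - ρ x Ω) + s • Θ (z - ρ x Ω)) := by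
      rw [map_sub Θ, hza, hΘ, hΘΩ, smul_sub s, smul_smul s s, hss, one_smul]
      simp only [map_smul, map_add, smul_apply, add_apply]
      module
    rw [h1, norm_smul]
    have h2 : ‖(z - ρ x Ω) + s • Θ (z - ρ x Ω)‖ ≤ ‖z - ρ x Ω‖ + ‖z - ρ x Ω‖ := by
      refine (norm_add_le _ _).trans ?_
      rw [norm_smul, hsn, one_mul, hΘn]
    have h3 : ‖(1 / 2 : ℂ)‖ = 1 / 2 := by norm_num
    rw [h3]
    linarith

/-- Isometries that commute with the observables outside `M` and inside `M`, respectively, and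
have definite parities commute up to a sign on the product vector. -/
theorem graded_commute {M : Set S.Mode} (hM : IsSaturated cell M) {Θ V W : H →L[ℂ] H}
    (hΘΩ : Θ Ω = Ω) (hΘ : ∀ a x, Θ (ρ a x) = ρ (S.grading a) (Θ x)) (hΘn : ∀ x, ‖Θ x‖ = ‖x‖)
    (hVn : ∀ x, ‖V x‖ = ‖x‖) (hWn : ∀ x, ‖W x‖ = ‖x‖)
    (hV : ∀ y ∈ S.modeAlgebra Mᶜ, ∀ x, V (ρ y x) = ρ y (V x))
    (hW : ∀ y ∈ S.modeAlgebra M, ∀ x, W (ρ y x) = ρ y (W x)) (a b : Fin 2)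
    (hVa : ∀ x, Θ (V x) = (-1 : ℂ) ^ (a : ℕ) • V (Θ x))
    (hWb : ∀ x, Θ (W x) = (-1 : ℂ) ^ (b : ℕ) • W (Θ x)) :
    V (W Ω) = (-1 : ℂ) ^ ((a : ℕ) * (b : ℕ)) • W (V Ω) := by
  have hV' := hΩ.apply_mem_modeSpace_of_commute hM hV
  have hW' := hΩ.apply_mem_modeSpace_of_commute hM.compl (V := W) (by rwa [compl_compl])
  have hVΩ := hVa Ω
  have hWΩ := hWb Ω
  rw [hΘΩ] at hVΩ hWΩ
  set s : ℂ := (-1 : ℂ) ^ ((a : ℕ) * (b : ℕ)) with hs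
  have hsn : ‖s‖ = 1 := by rw [hs]; simp
  -- Both orders are compared with `x` and `y` applied to `Ω`. Each comparison costs `ε` for an
  -- isometry and `2 * ε` for `ρ x` or `ρ y`, whose vectors have norm at most `2`.
  have bound : ∀ ε : ℝ, 0 < ε → ε ≤ 1 → ‖V (W Ω) - s • W (V Ω)‖ ≤ 6 * ε := by
    intro ε hε hε1
    obtain ⟨x, hx, hgx, hxε⟩ := exists_homogeneous_approx hΘΩ hΘ hΘn hV' a hVΩ hε
    obtain ⟨y, hy, hgy, hyε⟩ := exists_homogeneous_approx hΘΩ hΘ hΘn hW' b hWΩ hε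
    have hxn : ‖ρ x Ω‖ ≤ 2 := by
      have h := norm_sub_norm_le (ρ x Ω) (V Ω)
      rw [norm_sub_rev, hVn, hΩ.norm_eq] at h
      linarith
    have hyn : ‖ρ y Ω‖ ≤ 2 := by
      have h := norm_sub_norm_le (ρ y Ω) (W Ω)
      rw [norm_sub_rev, hWn, hΩ.norm_eq] at h
      linarith
    have h1 : ‖W (V Ω) - ρ (x * y) Ω‖ ≤ 3 * ε := by
      have e : W (V Ω) - ρ (x * y) Ω = W (V Ω - ρ x Ω) + ρ x (W Ω - ρ y Ω) := by
        rw [map_sub, map_sub, hW x hx, map_mul_apply]; abel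
      rw [e]
      refine (norm_add_le _ _).trans ?_
      rw [hWn, hΩ.norm_apply hM hx a hgx (sub_mem hW' (apply_mem_modeSpace hy))]
      nlinarith [norm_nonneg (W Ω - ρ y Ω), norm_nonneg (ρ x Ω)]
    have h2 : ‖V (W Ω) - ρ (y * x) Ω‖ ≤ 3 * ε := by
      have e : V (W Ω) - ρ (y * x) Ω = V (W Ω - ρ y Ω) + ρ y (V Ω - ρ x Ω) := by
        rw [map_sub, map_sub, hV y hy, map_mul_apply]; abel
      rw [e]
      refine (norm_add_le _ _).trans ?_
      rw [hVn, hΩ.norm_apply hM.compl hy b hgy (by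
        rw [compl_compl]; exact sub_mem hV' (apply_mem_modeSpace hx))]
      nlinarith [norm_nonneg (V Ω - ρ x Ω), norm_nonneg (ρ y Ω)]
    have h3 : ρ (x * y) Ω = s • ρ (y * x) Ω := by
      rw [SpinSystem.graded_commute disjoint_compl_right hx hy a b hgx hgy, map_smul, smul_apply]
    have hss : s * s = 1 := by
      rw [hs, ← mul_pow]; simp
    have h4 : V (W Ω) - s • W (V Ω) =
        (V (W Ω) - ρ (y * x) Ω) - s • (W (V Ω) - ρ (x * y) Ω) := by
      rw [smul_sub s, h3, smul_smul s s, hss, one_smul]; abel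
    rw [h4]
    refine (norm_sub_le _ _).trans ?_
    rw [norm_smul, hsn, one_mul]
    linarith
  have h0 : ‖V (W Ω) - s • W (V Ω)‖ ≤ 0 := by
    refine le_of_forall_pos_le_add fun δ hδ => ?_
    have h := bound (min (δ / 6) 1) (by positivity) (min_le_right _ _)
    have h' := min_le_left (δ / 6) 1
    linarith
  exact sub_eq_zero.1 (norm_le_zero_iff.1 h0)

end IsProductVector

end ProductState

/-! ### Stacks of trivial states give product vectors -/

section TrivialStates

variable {κ : Statistics} {S T : SpinSystem κ}

/-- The site of the first or of the second system to which a mode of the stack belongs. -/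
def stackCell (S T : SpinSystem κ) (m : (S.stack T).Mode) : S.Λ ⊕ T.Λ :=
  Sum.map (fun k : S.Mode => (ofLex k).1) (fun k : T.Mode => (ofLex k).1) (ofLex (ofLex m).1)

/-- Every generator of a stack comes from one of the two systems. -/
theorem exists_eq_stackInl_or_stackInr (p : (S.stack T).Mode × Bool) :
    (∃ q, p = S.stackInl T q) ∨ ∃ q, p = S.stackInr T q := by
  obtain ⟨m, b⟩ := p
  obtain ⟨⟨j, i⟩, rfl⟩ := toLex.surjective m
  obtain ⟨j, rfl⟩ := toLex.surjective j
  have hi : i = (0 : Fin 1) := Subsingleton.elim (α := Fin 1) _ _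
  subst hi
  rcases j with k | k
  · exact Or.inl ⟨(k, b), rfl⟩
  · exact Or.inr ⟨(k, b), rfl⟩

theorem modePos_eq_sum_elim (m : (S.stack T).Mode) :
    (S.stack T).modePos m = Sum.elim S.pos T.pos (stackCell S T m) := by
  rcases exists_eq_stackInl_or_stackInr (m, true) with ⟨q, h⟩ | ⟨q, h⟩
  · obtain rfl : m = (S.stackInl T q).1 := congrArg Prod.fst h
    rfl
  · obtain rfl : m = (S.stackInr T q).1 := congrArg Prod.fst h
    rfl

/-- The cells are the sites before stacking, since a trivial state need not factorize over the modes
of one site. All modes of a cell have the same position, so a region of the plane never cuts a cell.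
-/
theorem isSaturated_stackCell (X : Set Plane) :
    IsSaturated (stackCell S T) ((S.stack T).modePos ⁻¹' X) := by
  intro m k h hm
  rw [Set.mem_preimage, modePos_eq_sum_elim] at hm ⊢
  rwa [← h]

theorem IsTrivialState.exists_site_vector {Ψ : State S.Observables} (h : IsTrivialState Ψ)
    (j : S.Λ) : ∃ v : Fock (Fin S.modes), ‖v‖ = 1 ∧ parityOp κ (Fin S.modes) v = v ∧
      ∀ w : List (Fin S.modes × Bool),
        Ψ.functional (S.word (w.map fun p => (S.mode j p.1, p.2))) = ⟪v, genWord κ w v⟫_ℂ := by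
  obtain ⟨v, hv, hw⟩ := h
  exact ⟨v j, (hv j).1, (hv j).2, fun w => by simpa using hw [j] (by simp) fun _ => w⟩

theorem functional_word_map_stackInl {Ψ₁ : State S.Observables} {Ψ₂ : State T.Observables}
    {Φ : State (S.stack T).Observables} (h : IsStackState Φ Ψ₁ Ψ₂) (w : List (S.Mode × Bool)) :
    Φ.functional ((S.stack T).word (w.map (S.stackInl T))) = Ψ₁.functional (S.word w) := by
  have h1 := h w []
  rwa [List.map_nil, SpinSystem.word_nil, SpinSystem.word_nil, Ψ₂.map_one, mul_one, mul_one] at h1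

theorem functional_word_map_stackInr {Ψ₁ : State S.Observables} {Ψ₂ : State T.Observables}
    {Φ : State (S.stack T).Observables} (h : IsStackState Φ Ψ₁ Ψ₂) (w : List (T.Mode × Bool)) :
    Φ.functional ((S.stack T).word (w.map (S.stackInr T))) = Ψ₂.functional (T.word w) := by
  have h1 := h [] w
  rwa [List.map_nil, SpinSystem.word_nil, SpinSystem.word_nil, Ψ₁.map_one, one_mul, one_mul] at h1

/-- In a representation, the cyclic vector of a stack of trivial states is a product vector. -/
theorem IsStackState.isProductVector {Ψ₁ : State S.Observables} {Ψ₂ : State T.Observables}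
    {Φ : State (S.stack T).Observables} (h : IsStackState Φ Ψ₁ Ψ₂) (h₁ : IsTrivialState Ψ₁)
    (h₂ : IsTrivialState Ψ₂) {H : Type} [NormedAddCommGroup H] [InnerProductSpace ℂ H]
    [CompleteSpace H] {ρ : (S.stack T).Observables →⋆ₐ[ℂ] (H →L[ℂ] H)} {Ω : H}
    (hΩ : ∀ a, ⟪Ω, ρ a Ω⟫_ℂ = Φ.functional a) (htot : Total fun a => ρ a Ω) :
    IsProductVector (stackCell S T) ρ Ω := by
  refine ⟨?_, htot, ?_⟩
  · have h1 := hΩ 1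
    rw [Φ.map_one, _root_.map_one, one_apply_eq_self] at h1
    have h2 : ‖Ω‖ ^ 2 = 1 := by
      rw [← inner_self_eq_norm_sq (𝕜 := ℂ) Ω, h1]; simp
    exact (pow_eq_one_iff_of_nonneg (norm_nonneg _) two_ne_zero).1 h2
  · rintro (j | j)
    · obtain ⟨v, hv, hev, hw⟩ := h₁.exists_site_vector j
      obtain ⟨q, hq⟩ := exists_isCellProjection
        (c := fun k : Fin S.modes => (S.stackInl T (S.mode j k, true)).1) hΩ hv hev (by
          intro w
          rw [← hw, ← functional_word_map_stackInl h, List.map_map]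
          rfl)
      refine ⟨q, ?_⟩
      convert hq using 1
      ext m
      constructor
      · intro hm
        rcases exists_eq_stackInl_or_stackInr (m, true) with ⟨p, hp⟩ | ⟨p, hp⟩
        · obtain rfl : m = (S.stackInl T p).1 := congrArg Prod.fst hp
          have hj : (ofLex p.1).1 = j := Sum.inl_injective hm
          exact ⟨(ofLex p.1).2, by rw [← hj]; rfl⟩
        · obtain rfl : m = (S.stackInr T p).1 := congrArg Prod.fst hp
          cases hm
      · rintro ⟨k, rfl⟩
        rfl
    · obtain ⟨v, hv, hev, hw⟩ := h₂.exists_site_vector j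
      obtain ⟨q, hq⟩ := exists_isCellProjection
        (c := fun k : Fin T.modes => (S.stackInr T (T.mode j k, true)).1) hΩ hv hev (by
          intro w
          rw [← hw, ← functional_word_map_stackInr h, List.map_map]
          rfl)
      refine ⟨q, ?_⟩
      convert hq using 1
      ext m
      constructor
      · intro hm
        rcases exists_eq_stackInl_or_stackInr (m, true) with ⟨p, hp⟩ | ⟨p, hp⟩
        · obtain rfl : m = (S.stackInl T p).1 := congrArg Prod.fst hp
          cases hm
        · obtain rfl : m = (S.stackInr T p).1 := congrArg Prod.fst hp
          have hj : (ofLex p.1).1 = j := Sum.inr_injective hm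
          exact ⟨(ofLex p.1).2, by rw [← hj]; rfl⟩
      · rintro ⟨k, rfl⟩
        rfl

end TrivialStates

/-! ### Lifting implementers to a larger system -/

section Lift

variable {κ : Statistics} {S R : SpinSystem κ} {Ψ : State S.Observables} {e : S.Mode → R.Mode}
  {H : Type} [NormedAddCommGroup H] [InnerProductSpace ℂ H] [CompleteSpace H]
  {ρ : R.Observables →⋆ₐ[ℂ] (H →L[ℂ] H)}

/-- The operators that intertwine the GNS representation of `Ψ` and a representation of a
larger system, in which the modes are embedded by `e`. -/
def intertwiners (Ψ : State S.Observables) (e : S.Mode → R.Mode)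
    (ρ : R.Observables →⋆ₐ[ℂ] (H →L[ℂ] H)) : Set (Ψ.Space →L[ℂ] H) :=
  {J | ∀ m b x, J (Ψ.π (S.γ m b) x) = ρ (R.γ (e m) b) (J x)}

theorem State.commutant_of_γ {T : Ψ.Space →L[ℂ] Ψ.Space}
    (hT : ∀ m b x, T (Ψ.π (S.γ m b) x) = Ψ.π (S.γ m b) (T x)) (a : S.Observables) (x : Ψ.Space) :
    T (Ψ.π a x) = Ψ.π a (T x) := by
  refine SpinSystem.continuousLinearMap_eq_of_word (f := T.comp (vecL Ψ.π x))
    (g := vecL Ψ.π (T x)) ?_ a (SpinSystem.mem_modeAlgebra_univ a)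
  intro w _
  change T (Ψ.π (S.word w) x) = Ψ.π (S.word w) (T x)
  induction w with
  | nil => simp only [SpinSystem.word_nil, Ψ.π_one_apply]
  | cons p w ih =>
    rw [SpinSystem.word_cons, map_mul_apply, map_mul_apply, hT, ih fun _ _ => trivial]

theorem inner_γ_apply (ρ : R.Observables →⋆ₐ[ℂ] (H →L[ℂ] H)) (m : R.Mode) (b : Bool) (x y : H) :
    ⟪x, ρ (R.γ m b) y⟫_ℂ = ⟪ρ (R.γ m b) x, y⟫_ℂ := by
  rw [← inner_star_apply, R.star_γ]

/-- The operator `J† J'` commutes with the irreducible representation `π_Ψ`. -/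
theorem intertwiners_schur (hΨ : Ψ.IsPure) {J J' : Ψ.Space →L[ℂ] H}
    (hJ : J ∈ intertwiners Ψ e ρ) (hJ' : J' ∈ intertwiners Ψ e ρ) :
    ∃ c : ℂ, ∀ x y, ⟪J x, J' y⟫_ℂ = c * ⟪x, y⟫_ℂ := by
  obtain ⟨c, hc⟩ := hΨ.commutant (J.adjoint.comp J') (State.commutant_of_γ fun m b x => by
    refine ext_inner_left ℂ fun y => ?_
    rw [inner_γ_apply, ContinuousLinearMap.comp_apply, ContinuousLinearMap.comp_apply,
      ContinuousLinearMap.adjoint_inner_right, ContinuousLinearMap.adjoint_inner_right, hJ',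
      hJ, inner_γ_apply])
  refine ⟨c, fun x y => ?_⟩
  rw [← ContinuousLinearMap.adjoint_inner_right, ← inner_smul_right, ← hc]
  rfl

section Parity

variable {Θ : unitary (Ψ.Space →L[ℂ] Ψ.Space)}

theorem unitary_star_apply_apply (U : unitary (Ψ.Space →L[ℂ] Ψ.Space)) (x : Ψ.Space) :
    (star (U : Ψ.Space →L[ℂ] Ψ.Space)) ((U : Ψ.Space →L[ℂ] Ψ.Space) x) = x :=
  congrArg (fun T : Ψ.Space →L[ℂ] Ψ.Space => T x) (Unitary.coe_star_mul_self U)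

theorem unitary_apply_star_apply (U : unitary (Ψ.Space →L[ℂ] Ψ.Space)) (x : Ψ.Space) :
    (U : Ψ.Space →L[ℂ] Ψ.Space) ((star (U : Ψ.Space →L[ℂ] Ψ.Space)) x) = x :=
  congrArg (fun T : Ψ.Space →L[ℂ] Ψ.Space => T x) (Unitary.coe_mul_star_self U)

theorem State.IsImplementer.apply {α : S.Observables ≃⋆ₐ[ℂ] S.Observables}
    {U : unitary (Ψ.Space →L[ℂ] Ψ.Space)} (hU : Ψ.IsImplementer α U) (a : S.Observables)
    (x : Ψ.Space) : (U : Ψ.Space →L[ℂ] Ψ.Space) (Ψ.π a x) =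
      Ψ.π (α a) ((U : Ψ.Space →L[ℂ] Ψ.Space) x) := by
  rw [hU a, mul_apply_eq_comp, mul_apply_eq_comp, unitary_star_apply_apply]

theorem State.IsImplementer.star_apply_γ (hΘ : Ψ.IsImplementer S.grading Θ) (m : S.Mode) (b : Bool)
    (x : Ψ.Space) : (star (Θ : Ψ.Space →L[ℂ] Ψ.Space)) (Ψ.π (S.γ m b) x) =
      κ.sgn • Ψ.π (S.γ m b) ((star (Θ : Ψ.Space →L[ℂ] Ψ.Space)) x) := by
  have h := hΘ.apply (S.γ m b) ((star (Θ : Ψ.Space →L[ℂ] Ψ.Space)) x)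
  rw [unitary_apply_star_apply, S.grading_γ, map_smul, smul_apply] at h
  have h' := congrArg (fun y => κ.sgn • (star (Θ : Ψ.Space →L[ℂ] Ψ.Space)) y) h
  simp only [unitary_star_apply_apply, map_smul, smul_smul, κ.sgn_mul_self, one_smul] at h'
  exact h'.symm

variable {Θ₁ : H →L[ℂ] H}

/-- The sign from moving a generator of an added mode past those of the original system is cancelled
by the sign that `Θ†` produces. -/
theorem γ_comp_mem_intertwiners (hΘ : Ψ.IsImplementer S.grading Θ) {J : Ψ.Space →L[ℂ] H}
    (hJ : J ∈ intertwiners Ψ e ρ) {k : R.Mode} (hk : k ∉ Set.range e) (c : Bool) :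
    (ρ (R.γ k c)).comp (J.comp (star (Θ : Ψ.Space →L[ℂ] Ψ.Space))) ∈ intertwiners Ψ e ρ := by
  intro m b x
  have hne : k ≠ e m := fun h => hk ⟨m, h.symm⟩
  simp only [ContinuousLinearMap.comp_apply]
  rw [hΘ.star_apply_γ, map_smul, hJ, map_smul, ← map_mul_apply, R.γ_mul_γ_of_ne hne, map_smul,
    smul_apply, smul_smul, κ.sgn_mul_self, one_smul, map_mul_apply]

/-- The signs from `Θ₁` and from `Θ†` cancel. This is the action of the parity of the multiplicity
space. -/
theorem parity_comp_mem_intertwiners (hΘ : Ψ.IsImplementer S.grading Θ)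
    (hΘ₁ : ∀ a x, Θ₁ (ρ a x) = ρ (R.grading a) (Θ₁ x)) {J : Ψ.Space →L[ℂ] H}
    (hJ : J ∈ intertwiners Ψ e ρ) :
    Θ₁.comp (J.comp (star (Θ : Ψ.Space →L[ℂ] Ψ.Space))) ∈ intertwiners Ψ e ρ := by
  intro m b x
  simp only [ContinuousLinearMap.comp_apply]
  rw [hΘ.star_apply_γ, map_smul, hJ, map_smul, hΘ₁, R.grading_γ, map_smul, smul_apply, smul_smul,
    κ.sgn_mul_self, one_smul]

variable {Ωt : H}

/-- The vectors obtained from `Ωt` and from the GNS vector by applying words of the small system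
have the same Gram matrix. -/
theorem exists_mem_intertwiners_apply_vac
    (hΩt : ∀ w, ⟪Ωt, ρ (R.word (w.map fun p => (e p.1, p.2))) Ωt⟫_ℂ = Ψ.functional (S.word w)) :
    ∃ J ∈ intertwiners Ψ e ρ, J Ψ.vac = Ωt := by
  have htot : Total fun w : List (S.Mode × Bool) => Ψ.π (S.word w) Ψ.vac := by
    intro x hx
    refine Ψ.total_π_vac x fun a => ?_
    rw [← inner_conj_symm, map_eq_zero]
    refine SpinSystem.continuousLinearMap_eq_of_word (f := (innerSL ℂ x).comp (vecL Ψ.π Ψ.vac))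
      (g := 0) (fun w _ => ?_) a (SpinSystem.mem_modeAlgebra_univ a)
    change ⟪x, Ψ.π (S.word w) Ψ.vac⟫_ℂ = 0
    rw [← inner_conj_symm, map_eq_zero]
    exact hx w
  obtain ⟨J, h1, -⟩ := htot.exists_isometry
    (fun w => ρ (R.word (w.map fun p => (e p.1, p.2))) Ωt) (by
      intro w w'
      rw [Ψ.inner_π_vac, S.star_word, ← S.word_append, ← hΩt, ← inner_star_apply, ← map_mul_apply,
        R.star_word, ← R.word_append, List.map_append, List.map_reverse])
  refine ⟨J, fun m b x => ?_, ?_⟩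
  · have : J.comp (Ψ.π (S.γ m b)) = (ρ (R.γ (e m) b)).comp J := htot.ext fun w => by
      change J (Ψ.π (S.γ m b) (Ψ.π (S.word w) Ψ.vac)) = ρ (R.γ (e m) b) (J (Ψ.π (S.word w) Ψ.vac))
      rw [← map_mul_apply, ← S.word_cons (m, b), h1, h1, List.map_cons, R.word_cons, map_mul_apply]
    exact congrArg (fun T : Ψ.Space →L[ℂ] H => T x) this
  · simpa [SpinSystem.word_nil] using h1 []

/-- Each vector `ρ(w) Ωt` is of the form `J ξ`, by induction on the word: letters of the original
system act on `ξ`, and letters of added modes are absorbed into `J`, with `ξ` replaced by `Θ ξ`. -/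
theorem total_intertwiners (hΘ : Ψ.IsImplementer S.grading Θ)
    (hΩt : ∀ w, ⟪Ωt, ρ (R.word (w.map fun p => (e p.1, p.2))) Ωt⟫_ℂ = Ψ.functional (S.word w))
    (htot : Total fun a => ρ a Ωt) :
    Total fun p : intertwiners Ψ e ρ × Ψ.Space => p.1.1 p.2 := by
  have key : ∀ w, ∃ J ∈ intertwiners Ψ e ρ, ∃ ξ, J ξ = ρ (R.word w) Ωt := by
    intro w
    induction w with
    | nil =>
      obtain ⟨J, hJ, h⟩ := exists_mem_intertwiners_apply_vac hΩt
      exact ⟨J, hJ, _, by rw [h]; simp [SpinSystem.word_nil]⟩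
    | cons p w ih =>
      obtain ⟨J, hJ, ξ, h⟩ := ih
      rw [R.word_cons, map_mul_apply, ← h]
      by_cases hp : p.1 ∈ Set.range e
      · obtain ⟨m, hm⟩ := hp
        exact ⟨J, hJ, Ψ.π (S.γ m p.2) ξ, by rw [hJ, hm]⟩
      · refine ⟨_, γ_comp_mem_intertwiners hΘ hJ hp p.2, (Θ : Ψ.Space →L[ℂ] Ψ.Space) ξ, ?_⟩
        simp only [ContinuousLinearMap.comp_apply, unitary_star_apply_apply]
  intro x hx
  refine htot x fun a => ?_
  rw [← inner_conj_symm, map_eq_zero]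
  refine SpinSystem.continuousLinearMap_eq_of_word (f := (innerSL ℂ x).comp (vecL ρ Ωt))
    (g := 0) (fun w _ => ?_) a (SpinSystem.mem_modeAlgebra_univ a)
  change ⟪x, ρ (R.word w) Ωt⟫_ℂ = 0
  obtain ⟨J, hJ, ξ, h⟩ := key w
  rw [← h, ← inner_conj_symm, map_eq_zero]
  exact hx (⟨J, hJ⟩, ξ)

theorem unitary_inner (U : unitary (Ψ.Space →L[ℂ] Ψ.Space)) (x y : Ψ.Space) :
    ⟪(U : Ψ.Space →L[ℂ] Ψ.Space) x, (U : Ψ.Space →L[ℂ] Ψ.Space) y⟫_ℂ = ⟪x, y⟫_ℂ := by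
  rw [← ContinuousLinearMap.adjoint_inner_right, ← ContinuousLinearMap.star_eq_adjoint,
    unitary_star_apply_apply]

theorem HasParity.apply {U : unitary (Ψ.Space →L[ℂ] Ψ.Space)} {ε : Fin 2} (h : HasParity Θ U ε)
    (x : Ψ.Space) : (Θ : Ψ.Space →L[ℂ] Ψ.Space) ((U : Ψ.Space →L[ℂ] Ψ.Space) x) =
      (-1 : ℂ) ^ (ε : ℕ) • (U : Ψ.Space →L[ℂ] Ψ.Space) ((Θ : Ψ.Space →L[ℂ] Ψ.Space) x) :=
  congrArg (fun T : Ψ.Space →L[ℂ] Ψ.Space => T x) h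

/-- For bosons there are no odd operators. -/
theorem HasParity.sgn_eq (hΨ : Ψ.IsPure) (hΘ : Ψ.IsImplementer S.grading Θ)
    {U : unitary (Ψ.Space →L[ℂ] Ψ.Space)} (h : HasParity Θ U 1) : κ.sgn = -1 := by
  cases κ with
  | fermionic => rfl
  | bosonic =>
    exfalso
    -- For bosons `Θ` implements the identity, so it is a scalar. It then commutes with `U`, and
    -- anticommutation would force `U Θ` to kill the cyclic vector.
    obtain ⟨c, hc⟩ := hΨ.commutant (Θ : Ψ.Space →L[ℂ] Ψ.Space) fun a x => by
      rw [hΘ.apply, SpinSystem.grading_bosonic]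
    have h1 := h.apply Ψ.vac
    rw [hc, hc, map_smul] at h1
    simp only [Fin.val_one, pow_one, neg_smul, one_smul] at h1
    rw [← map_smul, ← hc] at h1
    have h2 : (U : Ψ.Space →L[ℂ] Ψ.Space) ((Θ : Ψ.Space →L[ℂ] Ψ.Space) Ψ.vac) = 0 := by
      have h3 : (2 : ℂ) • (U : Ψ.Space →L[ℂ] Ψ.Space) ((Θ : Ψ.Space →L[ℂ] Ψ.Space) Ψ.vac) = 0 := by
        rw [two_smul]
        nth_rewrite 1 [h1]
        exact neg_add_cancel _
      exact (smul_eq_zero.1 h3).resolve_left two_ne_zero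
    have h4 := Ψ.inner_vac_vac
    rw [← unitary_inner Θ, ← unitary_inner U, h2, inner_zero_left] at h4
    exact zero_ne_one h4

/-- `J` for `ε = 0`, and `Θ₁ J Θ†` for `ε = 1`. -/
def twist (Θ₁ : H →L[ℂ] H) (Θ : unitary (Ψ.Space →L[ℂ] Ψ.Space)) (ε : Fin 2)
    (J : Ψ.Space →L[ℂ] H) : Ψ.Space →L[ℂ] H :=
  if ε = 0 then J else Θ₁.comp (J.comp (star (Θ : Ψ.Space →L[ℂ] Ψ.Space)))

theorem twist_mem (hΘ : Ψ.IsImplementer S.grading Θ)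
    (hΘ₁ : ∀ a x, Θ₁ (ρ a x) = ρ (R.grading a) (Θ₁ x)) (ε : Fin 2) {J : Ψ.Space →L[ℂ] H}
    (hJ : J ∈ intertwiners Ψ e ρ) : twist Θ₁ Θ ε J ∈ intertwiners Ψ e ρ := by
  unfold twist
  split_ifs
  · exact hJ
  · exact parity_comp_mem_intertwiners hΘ hΘ₁ hJ

omit [CompleteSpace H] in
theorem twist_comm (a b : Fin 2) (J : Ψ.Space →L[ℂ] H) :
    twist Θ₁ Θ a (twist Θ₁ Θ b J) = twist Θ₁ Θ b (twist Θ₁ Θ a J) := by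
  fin_cases a <;> fin_cases b <;> simp [twist]

/-- `V` is the lift of an operator `U` of parity `ε` to the larger system. -/
def IsLift (e : S.Mode → R.Mode) (ρ : R.Observables →⋆ₐ[ℂ] (H →L[ℂ] H)) (Θ₁ : H →L[ℂ] H)
    (Θ U : unitary (Ψ.Space →L[ℂ] Ψ.Space)) (ε : Fin 2) (V : H →L[ℂ] H) : Prop :=
  ∀ J ∈ intertwiners Ψ e ρ, ∀ ξ, V (J ξ) = twist Θ₁ Θ ε J ((U : Ψ.Space →L[ℂ] Ψ.Space) ξ)

/-- In the odd case the lift is the amplification of `U` composed with `Θ₁` and the amplification of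
`Θ†`. It has the required action because `Θ₁ J Θ†` is again an intertwiner. -/
theorem exists_isLift (hΨ : Ψ.IsPure) (hΘ : Ψ.IsImplementer S.grading Θ)
    (hΘ₁ : ∀ a x, Θ₁ (ρ a x) = ρ (R.grading a) (Θ₁ x)) (hΘ₁i : ∀ x y, ⟪Θ₁ x, Θ₁ y⟫_ℂ = ⟪x, y⟫_ℂ)
    (htot : Total fun p : intertwiners Ψ e ρ × Ψ.Space => p.1.1 p.2)
    (U : unitary (Ψ.Space →L[ℂ] Ψ.Space)) (ε : Fin 2) :
    ∃ V : H →L[ℂ] H, IsLift e ρ Θ₁ Θ U ε V ∧ ∀ x, ‖V x‖ = ‖x‖ := by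
  have hs : ∀ J ∈ intertwiners Ψ e ρ, ∀ J' ∈ intertwiners Ψ e ρ,
      ∃ c : ℂ, ∀ x y, ⟪J x, J' y⟫_ℂ = c * ⟪x, y⟫_ℂ := fun J hJ J' hJ' =>
    intertwiners_schur hΨ hJ hJ'
  obtain ⟨V, hV, hVi⟩ := exists_amplification hs htot U (unitary_inner U)
  obtain ⟨T, hT, hTi⟩ := exists_amplification hs htot
    (star (Θ : Ψ.Space →L[ℂ] Ψ.Space)) (unitary_inner (star Θ))
  by_cases hε : ε = 0
  · refine ⟨V, fun J hJ ξ => ?_, norm_eq_of_inner hVi⟩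
    rw [hV J hJ, twist, if_pos hε]
  · refine ⟨V.comp (Θ₁.comp T), fun J hJ ξ => ?_, norm_eq_of_inner fun x y => ?_⟩
    · have h := hV _ (parity_comp_mem_intertwiners hΘ hΘ₁ hJ) ξ
      rw [twist, if_neg hε, ← h]
      simp only [ContinuousLinearMap.comp_apply, hT J hJ]
    · simp only [ContinuousLinearMap.comp_apply, hVi, hΘ₁i, hTi]

theorem eq_of_intertwiners {V W : H →L[ℂ] H}
    (htot : Total fun p : intertwiners Ψ e ρ × Ψ.Space => p.1.1 p.2)
    (h : ∀ J ∈ intertwiners Ψ e ρ, ∀ ξ, V (J ξ) = W (J ξ)) : V = W :=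
  htot.ext fun p => h p.1.1 p.1.2 p.2

namespace IsLift

variable {U : unitary (Ψ.Space →L[ℂ] Ψ.Space)} {ε : Fin 2} {V : H →L[ℂ] H}

theorem commute_of_mem_range (hV : IsLift e ρ Θ₁ Θ U ε V)
    (hΘ : Ψ.IsImplementer S.grading Θ) (hΘ₁ : ∀ a x, Θ₁ (ρ a x) = ρ (R.grading a) (Θ₁ x))
    (htot : Total fun p : intertwiners Ψ e ρ × Ψ.Space => p.1.1 p.2) {m : S.Mode} {b : Bool}
    (hU : ∀ x, (U : Ψ.Space →L[ℂ] Ψ.Space) (Ψ.π (S.γ m b) x) =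
      Ψ.π (S.γ m b) ((U : Ψ.Space →L[ℂ] Ψ.Space) x)) (x : H) :
    V (ρ (R.γ (e m) b) x) = ρ (R.γ (e m) b) (V x) := by
  have : V.comp (ρ (R.γ (e m) b)) = (ρ (R.γ (e m) b)).comp V :=
    eq_of_intertwiners htot fun J hJ ξ => by
      simp only [ContinuousLinearMap.comp_apply]
      rw [← hJ, hV J hJ, hV J hJ, hU, twist_mem hΘ hΘ₁ ε hJ]
  exact congrArg (fun T : H →L[ℂ] H => T x) this

/-- Since `ρ(γ) J Θ†` is an intertwiner, the plain amplification of `U` would commute with `ρ(γ)`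
only up to the parity sign of `U`. For odd `U` the twist by `Θ₁` contributes a second sign, which
cancels it. -/
theorem commute_of_notMem_range (hV : IsLift e ρ Θ₁ Θ U ε V) (hΨ : Ψ.IsPure)
    (hΘ : Ψ.IsImplementer S.grading Θ) (hΘ₁ : ∀ a x, Θ₁ (ρ a x) = ρ (R.grading a) (Θ₁ x))
    (htot : Total fun p : intertwiners Ψ e ρ × Ψ.Space => p.1.1 p.2) (hU : HasParity Θ U ε)
    {k : R.Mode} (hk : k ∉ Set.range e) (b : Bool) (x : H) :
    V (ρ (R.γ k b) x) = ρ (R.γ k b) (V x) := by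
  have : V.comp (ρ (R.γ k b)) = (ρ (R.γ k b)).comp V :=
    eq_of_intertwiners htot fun J hJ ξ => by
      have hK := γ_comp_mem_intertwiners hΘ hJ hk b
      have h := hV _ hK ((Θ : Ψ.Space →L[ℂ] Ψ.Space) ξ)
      have hp := hU.apply ξ
      simp only [ContinuousLinearMap.comp_apply, unitary_star_apply_apply] at h ⊢
      rw [h, hV J hJ]
      obtain rfl | rfl : ε = 0 ∨ ε = 1 := by omega
      · simp only [Fin.val_zero, pow_zero, one_smul] at hp
        simp only [twist, if_true, ContinuousLinearMap.comp_apply]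
        rw [← hp, unitary_star_apply_apply]
      · have hsgn := hU.sgn_eq hΨ hΘ
        simp only [Fin.val_one, pow_one, neg_smul, one_smul] at hp
        rw [← neg_eq_iff_eq_neg] at hp
        simp only [twist, one_ne_zero, if_false, ContinuousLinearMap.comp_apply]
        rw [← hp, map_neg, unitary_star_apply_apply, hΘ₁, R.grading_γ, hsgn]
        simp
  exact congrArg (fun T : H →L[ℂ] H => T x) this

theorem parity (hV : IsLift e ρ Θ₁ Θ U ε V)
    (hΘ : Ψ.IsImplementer S.grading Θ) (hΘ₁ : ∀ a x, Θ₁ (ρ a x) = ρ (R.grading a) (Θ₁ x))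
    (htot : Total fun p : intertwiners Ψ e ρ × Ψ.Space => p.1.1 p.2) (hU : HasParity Θ U ε)
    (x : H) : Θ₁ (V x) = (-1 : ℂ) ^ (ε : ℕ) • V (Θ₁ x) := by
  have : Θ₁.comp V = (-1 : ℂ) ^ (ε : ℕ) • V.comp Θ₁ :=
    eq_of_intertwiners htot fun J hJ ξ => by
      have hK := parity_comp_mem_intertwiners hΘ hΘ₁ hJ
      have h := hV _ hK ((Θ : Ψ.Space →L[ℂ] Ψ.Space) ξ)
      have hp := hU.apply ξ
      simp only [ContinuousLinearMap.comp_apply, unitary_star_apply_apply, smul_apply] at h ⊢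
      rw [h, hV J hJ]
      obtain rfl | rfl : ε = 0 ∨ ε = 1 := by omega
      · simp only [Fin.val_zero, pow_zero, one_smul] at hp ⊢
        simp only [twist, if_true, ContinuousLinearMap.comp_apply]
        rw [← hp, unitary_star_apply_apply]
      · simp only [Fin.val_one, pow_one, neg_smul, one_smul] at hp ⊢
        rw [← neg_eq_iff_eq_neg] at hp
        simp only [twist, one_ne_zero, if_false, ContinuousLinearMap.comp_apply]
        rw [← hp, map_neg, unitary_star_apply_apply]
        simp
  exact congrArg (fun T : H →L[ℂ] H => T x) this

/-- Twists commute with each other, so both products of lifts act by the same doubly twisted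
intertwiner and only the order of `U` and `U'` differs. -/
theorem commute {U' : unitary (Ψ.Space →L[ℂ] Ψ.Space)} {ε' : Fin 2} {V' : H →L[ℂ] H}
    (hV : IsLift e ρ Θ₁ Θ U ε V) (hV' : IsLift e ρ Θ₁ Θ U' ε' V')
    (hΘ : Ψ.IsImplementer S.grading Θ) (hΘ₁ : ∀ a x, Θ₁ (ρ a x) = ρ (R.grading a) (Θ₁ x))
    (htot : Total fun p : intertwiners Ψ e ρ × Ψ.Space => p.1.1 p.2) {c : ℂ}
    (h : ∀ x, (U : Ψ.Space →L[ℂ] Ψ.Space) ((U' : Ψ.Space →L[ℂ] Ψ.Space) x) =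
      c • (U' : Ψ.Space →L[ℂ] Ψ.Space) ((U : Ψ.Space →L[ℂ] Ψ.Space) x)) (x : H) :
    V (V' x) = c • V' (V x) := by
  have : V.comp V' = c • V'.comp V := eq_of_intertwiners htot fun J hJ ξ => by
    simp only [ContinuousLinearMap.comp_apply, smul_apply]
    rw [hV' J hJ, hV J hJ, hV _ (twist_mem hΘ hΘ₁ _ hJ), hV' _ (twist_mem hΘ hΘ₁ _ hJ), h,
      map_smul, twist_comm]
  exact congrArg (fun T : H →L[ℂ] H => T x) this

end IsLift

end Parity

end Lift

/-! ### Localized automorphisms and cone partitions -/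

section Localization

variable {κ : Statistics} {S : SpinSystem κ}

theorem SpinSystem.continuous_starAlgEquiv {T : SpinSystem κ}
    (β : S.Observables ≃⋆ₐ[ℂ] T.Observables) : Continuous β := by
  have : ∀ a, β a = β.toStarAlgHom a := fun _ => rfl
  simp only [funext this]
  exact map_continuous _

theorem SpinSystem.γ_mem_localAlgebra {X : Set Plane} {m : S.Mode} (hm : S.modePos m ∈ X)
    (b : Bool) : S.γ m b ∈ S.localAlgebra X :=
  SpinSystem.γ_mem_modeAlgebra (M := S.modePos ⁻¹' X) hm b

/-- Automorphisms that agree on the generators are equal. -/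
theorem SpinSystem.starAlgEquiv_apply_eq {β β' : S.Observables ≃⋆ₐ[ℂ] S.Observables}
    (h : ∀ m b, β (S.γ m b) = β' (S.γ m b)) (a : S.Observables) : β a = β' a := by
  have hle : S.modeAlgebra Set.univ ≤ StarAlgHom.equalizer β.toStarAlgHom β'.toStarAlgHom :=
    SpinSystem.modeAlgebra_le (isClosed_eq (S.continuous_starAlgEquiv β)
      (S.continuous_starAlgEquiv β')) fun m _ b => h m b
  exact hle (SpinSystem.mem_modeAlgebra_univ a)

/-- A generator located in `X` stays in the algebra of `X`, and all others are fixed. So a region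
that contains `X` or avoids it is preserved. -/
theorem SpinSystem.IsLocalizedIn.apply_mem {X W : Set Plane}
    {β : S.Observables ≃⋆ₐ[ℂ] S.Observables} (hβ : S.IsLocalizedIn X β)
    (h : X ⊆ W ∨ Disjoint X W) {a : S.Observables} (ha : a ∈ S.localAlgebra W) :
    β a ∈ S.localAlgebra W := by
  have hle : S.modeAlgebra (S.modePos ⁻¹' W) ≤ (S.localAlgebra W).comap β.toStarAlgHom := by
    refine SpinSystem.modeAlgebra_le
      ((SpinSystem.isClosed_modeAlgebra _).preimage (S.continuous_starAlgEquiv β)) fun m hm b => ?_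
    change β (S.γ m b) ∈ S.localAlgebra W
    by_cases hmX : S.modePos m ∈ X
    · rcases h with h | h
      · exact SpinSystem.modeAlgebra_mono (Set.preimage_mono h)
          ((hβ.1 _).2 (S.γ_mem_localAlgebra hmX b))
      · exact absurd hm (Set.disjoint_left.1 h hmX)
    · rw [hβ.2 _ (S.γ_mem_localAlgebra (X := Xᶜ) hmX b)]
      exact S.γ_mem_localAlgebra hm b
  exact hle ha

theorem SpinSystem.prod_apply_mem {W : Set Plane}
    {l : List (S.Observables ≃⋆ₐ[ℂ] S.Observables)}
    (hl : ∀ β ∈ l, ∀ a ∈ S.localAlgebra W, β a ∈ S.localAlgebra W) :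
    ∀ a ∈ S.localAlgebra W, l.prod a ∈ S.localAlgebra W := by
  induction l with
  | nil => exact fun a ha => ha
  | cons β l ih =>
    intro a ha
    rw [List.prod_cons, StarAlgEquiv.mul_apply]
    exact hl β (by simp) _ (ih (fun β' h => hl β' (by simp [h])) a ha)

/-- The factors on the cones `B` act first and preserve `W`; those on the cones `A` act second and
preserve the larger region `W'`. -/
theorem IsAssociated.apply_mem {n : ℕ} {P : GoodConicalPartition n}
    {α : S.Observables ≃⋆ₐ[ℂ] S.Observables} (hα : IsAssociated P S α) {W W' : Set Plane}
    (hWW' : W ⊆ W') (hB : ∀ a, (P.B a).region ⊆ W ∨ Disjoint (P.B a).region W)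
    (hA : ∀ a, (P.A a).region ⊆ W' ∨ Disjoint (P.A a).region W') {x : S.Observables}
    (hx : x ∈ S.localAlgebra W) : α x ∈ S.localAlgebra W' := by
  obtain ⟨β, β', h, rfl⟩ := hα
  rw [StarAlgEquiv.mul_apply]
  refine SpinSystem.prod_apply_mem ?_ _ (SpinSystem.modeAlgebra_mono (Set.preimage_mono hWW')
    (SpinSystem.prod_apply_mem ?_ x hx))
  · intro γ hγ a ha
    obtain ⟨i, rfl⟩ := (List.mem_ofFn' _ _).1 hγ
    exact (h i).1.apply_mem (hA i) ha
  · intro γ hγ a ha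
    obtain ⟨i, rfl⟩ := (List.mem_ofFn' _ _).1 hγ
    exact (h i).2.apply_mem (hB i) ha

theorem SpinSystem.IsLocalizedIn.commute {X Y : Set Plane} (hXY : Disjoint X Y)
    {β β' : S.Observables ≃⋆ₐ[ℂ] S.Observables} (hβ : S.IsLocalizedIn X β)
    (hβ' : S.IsLocalizedIn Y β') (a : S.Observables) : β (β' a) = β' (β a) := by
  have hfix : ∀ {Z Z' : Set Plane} {δ : S.Observables ≃⋆ₐ[ℂ] S.Observables}, Disjoint Z Z' →
      S.IsLocalizedIn Z' δ → ∀ x ∈ S.localAlgebra Z, δ x = x := fun hZ hδ x hx =>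
    hδ.2 x (SpinSystem.modeAlgebra_mono (Set.preimage_mono
      (Set.subset_compl_iff_disjoint_right.2 hZ)) hx)
  refine SpinSystem.starAlgEquiv_apply_eq (β := β * β') (β' := β' * β) (fun m b => ?_) a
  rw [StarAlgEquiv.mul_apply, StarAlgEquiv.mul_apply]
  by_cases hX : S.modePos m ∈ X
  · have h := S.γ_mem_localAlgebra hX b
    rw [hfix hXY hβ' _ h, hfix hXY hβ' _ ((hβ.1 _).2 h)]
  · have h := hβ.2 _ (S.γ_mem_localAlgebra (X := Xᶜ) hX b)
    rw [h]
    by_cases hY : S.modePos m ∈ Y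
    · exact hfix hXY.symm hβ _ ((hβ'.1 _).2 (S.γ_mem_localAlgebra hY b))
    · rw [hβ'.2 _ (S.γ_mem_localAlgebra (X := Yᶜ) hY b), h]

/-- An automorphism of the observables of a region that misses a site is graded. -/
theorem SpinSystem.IsLocalizedIn.isGraded {X : Set Plane}
    {β : S.Observables ≃⋆ₐ[ℂ] S.Observables} (hβ : S.IsLocalizedIn X β)
    (hX : ∃ j, S.pos j ∉ X) : S.IsGraded β := by
  obtain ⟨j, hj⟩ := hX
  intro a
  refine SpinSystem.starAlgEquiv_apply_eq (β := β * S.grading) (β' := S.grading * β)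
    (fun m b => ?_) a
  rw [StarAlgEquiv.mul_apply, StarAlgEquiv.mul_apply]
  by_cases hm : S.modePos m ∈ X
  -- The on-site number of `m` is reused at `j`, which guarantees that `j` carries a mode. The
  -- automorphism `β` fixes this generator, and conjugation by it is `η` on the algebra of `X`, so
  -- `β` commutes with `η` there.
  · set k := S.mode j (ofLex m).2 with hk
    have hkX : k ∉ S.modePos ⁻¹' X := hj
    have hfix : β (S.γ k b) = S.γ k b :=
      hβ.2 _ (S.γ_mem_localAlgebra (show S.modePos k ∈ Xᶜ from hj) b)
    have hmem := S.γ_mem_localAlgebra hm b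
    have h1 := congrArg β (SpinSystem.γ_mul_of_mem hkX b hmem)
    have h2 := SpinSystem.γ_mul_of_mem hkX b ((hβ.1 _).2 hmem)
    rw [_root_.map_mul, _root_.map_mul, hfix, h2] at h1
    have h3 := congrArg (fun x => x * S.γ k b) h1
    simp only [mul_assoc, S.γ_mul_self, mul_one] at h3
    exact h3.symm
  · have h := hβ.2 _ (S.γ_mem_localAlgebra (X := Xᶜ) hm b)
    rw [h, S.grading_γ, map_smul, h]

end Localization

/-! ### Commutation of implementers up to scalars -/

section Implementers

variable {κ : Statistics} {S : SpinSystem κ} {Ψ : State S.Observables}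
  {Θ U U' : unitary (Ψ.Space →L[ℂ] Ψ.Space)} {β β' : S.Observables ≃⋆ₐ[ℂ] S.Observables}

theorem unitary_apply_injective (U : unitary (Ψ.Space →L[ℂ] Ψ.Space)) {x : Ψ.Space}
    (h : (U : Ψ.Space →L[ℂ] Ψ.Space) x = 0) : x = 0 := by
  rw [← unitary_star_apply_apply U x, h, map_zero]

/-- Implementers of commuting automorphisms commute up to a scalar. -/
theorem exists_implementers_commute_smul (hΨ : Ψ.IsPure) (hU : Ψ.IsImplementer β U)
    (hU' : Ψ.IsImplementer β' U') (h : ∀ a, β (β' a) = β' (β a)) :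
    ∃ c : ℂ, ∀ x, (U : Ψ.Space →L[ℂ] Ψ.Space) ((U' : Ψ.Space →L[ℂ] Ψ.Space) x) =
      c • (U' : Ψ.Space →L[ℂ] Ψ.Space) ((U : Ψ.Space →L[ℂ] Ψ.Space) x) := by
  have hstar : ∀ {V : unitary (Ψ.Space →L[ℂ] Ψ.Space)} {δ : S.Observables ≃⋆ₐ[ℂ] S.Observables},
      Ψ.IsImplementer δ V → ∀ a x, star (V : Ψ.Space →L[ℂ] Ψ.Space) (Ψ.π (δ a) x) =
        Ψ.π a (star (V : Ψ.Space →L[ℂ] Ψ.Space) x) := by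
    intro V δ hV a x
    rw [hV a, mul_apply_eq_comp, mul_apply_eq_comp, unitary_star_apply_apply]
  -- The commutator `U† U'† U U'` implements the identity and is therefore a scalar.
  obtain ⟨c, hc⟩ := hΨ.commutant (star (U : Ψ.Space →L[ℂ] Ψ.Space) *
    (star (U' : Ψ.Space →L[ℂ] Ψ.Space) * ((U : Ψ.Space →L[ℂ] Ψ.Space) *
      (U' : Ψ.Space →L[ℂ] Ψ.Space)))) fun a x => by
    simp only [mul_apply_eq_comp]
    rw [hU'.apply, hU.apply, h, hstar hU', hstar hU]
  refine ⟨c, fun x => ?_⟩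
  have h1 := congrArg (fun y => (U' : Ψ.Space →L[ℂ] Ψ.Space) ((U : Ψ.Space →L[ℂ] Ψ.Space) y)) (hc x)
  simpa only [mul_apply_eq_comp, unitary_apply_star_apply, map_smul] using h1

/-- An operator that implements a graded automorphism has a unique parity. -/
theorem existsUnique_hasParity (hΨ : Ψ.IsPure) (hΘ : Ψ.IsImplementer S.grading Θ)
    (hU : Ψ.IsImplementer β U) (hβ : S.IsGraded β) : ∃! ε : Fin 2, HasParity Θ U ε := by
  obtain ⟨c, hc⟩ := exists_implementers_commute_smul hΨ hΘ hU fun a => (hβ a).symm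
  obtain ⟨d, hd⟩ := hΨ.commutant ((Θ : Ψ.Space →L[ℂ] Ψ.Space) * (Θ : Ψ.Space →L[ℂ] Ψ.Space))
    fun a x => by
      rw [mul_apply_eq_comp, mul_apply_eq_comp, hΘ.apply, hΘ.apply, S.grading_grading]
  simp only [mul_apply_eq_comp] at hd
  have hne : ∀ V : unitary (Ψ.Space →L[ℂ] Ψ.Space), (V : Ψ.Space →L[ℂ] Ψ.Space) Ψ.vac ≠ 0 :=
    fun V h => Ψ.vac_ne_zero (unitary_apply_injective V h)
  have hd0 : d ≠ 0 := by
    rintro rfl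
    have h := hd Ψ.vac
    rw [zero_smul] at h
    exact hne Θ (unitary_apply_injective Θ h)
  have hne' : ∀ V W : unitary (Ψ.Space →L[ℂ] Ψ.Space),
      (V : Ψ.Space →L[ℂ] Ψ.Space) ((W : Ψ.Space →L[ℂ] Ψ.Space) Ψ.vac) ≠ 0 :=
    fun V W h => hne W (unitary_apply_injective V h)
  -- Moving both factors of `Θ²`, which is the nonzero scalar `d`, past `U` produces `c²`.
  have hcc : c * c = 1 := by
    have h := hc Ψ.vac
    have h1 := congrArg (Θ : Ψ.Space →L[ℂ] Ψ.Space) h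
    rw [hd, map_smul, hc, hd, map_smul, smul_smul, smul_smul] at h1
    have h2 : d • (U : Ψ.Space →L[ℂ] Ψ.Space) Ψ.vac =
        d • ((c * c) • (U : Ψ.Space →L[ℂ] Ψ.Space) Ψ.vac) := by
      rw [smul_smul, h1, mul_comm]
    have h3 := smul_right_injective _ hd0 h2
    have h4 : (c * c - 1) • (U : Ψ.Space →L[ℂ] Ψ.Space) Ψ.vac = 0 := by
      rw [sub_smul, one_smul, ← h3, sub_self]
    exact sub_eq_zero.1 ((smul_eq_zero.1 h4).resolve_right (hne U))
  have hiff : ∀ ε : Fin 2, HasParity Θ U ε ↔ (-1 : ℂ) ^ (ε : ℕ) = c := by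
    intro ε
    constructor
    · intro h
      have h1 := h.apply Ψ.vac
      rw [hc, ← sub_eq_zero, ← sub_smul] at h1
      exact (sub_eq_zero.1 ((smul_eq_zero.1 h1).resolve_right (hne' U Θ))).symm
    · intro h
      refine ContinuousLinearMap.ext fun x => ?_
      rw [h]
      exact hc x
  simp only [hiff]
  rcases mul_self_eq_one_iff.1 hcc with rfl | rfl
  · refine ⟨0, by simp, fun ε hε => ?_⟩
    obtain rfl | rfl : ε = 0 ∨ ε = 1 := by omega
    · rfl
    · norm_num at hε
  · refine ⟨1, by simp, fun ε hε => ?_⟩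
    obtain rfl | rfl : ε = 0 ∨ ε = 1 := by omega
    · norm_num at hε
    · rfl

end Implementers

/-! ### The commutation relation in a disentangled representation -/

section Main

variable {κ : Statistics}

theorem commute_of_commute_γ {R : SpinSystem κ} {H : Type} [NormedAddCommGroup H]
    [InnerProductSpace ℂ H] [CompleteSpace H] {ρ : R.Observables →⋆ₐ[ℂ] (H →L[ℂ] H)}
    {M : Set R.Mode} {V : H →L[ℂ] H}
    (hV : ∀ m ∈ M, ∀ b x, V (ρ (R.γ m b) x) = ρ (R.γ m b) (V x)) {a : R.Observables}
    (ha : a ∈ R.modeAlgebra M) (x : H) : V (ρ a x) = ρ a (V x) := by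
  refine SpinSystem.continuousLinearMap_eq_of_word (f := V.comp (vecL ρ x))
    (g := vecL ρ (V x)) ?_ a ha
  intro w hw
  change V (ρ (R.word w) x) = ρ (R.word w) (V x)
  induction w with
  | nil => simp [SpinSystem.word_nil]
  | cons p w ih =>
    rw [SpinSystem.word_cons, map_mul_apply, map_mul_apply, hV _ (hw p (by simp)),
      ih fun q hq => hw q (by simp [hq])]

variable {S : SpinSystem κ} {Ψ : State S.Observables}

/-- The lift of an implementer commutes with the local algebras that the disentangling automorphism
maps away from the support of the implemented automorphism. -/
theorem IsLift.commute_of_localized (hΨ : Ψ.IsPure) {R T : SpinSystem κ}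
    {e : S.Mode → R.Mode} (he : ∀ m, R.modePos (e m) = S.modePos m)
    {H : Type} [NormedAddCommGroup H] [InnerProductSpace ℂ H] [CompleteSpace H]
    {ρ : R.Observables →⋆ₐ[ℂ] (H →L[ℂ] H)} {ρ₁ : T.Observables →⋆ₐ[ℂ] (H →L[ℂ] H)}
    {φ : R.Observables ≃⋆ₐ[ℂ] T.Observables} (hφ : R.IsSystemIso T φ)
    {α : R.Observables ≃⋆ₐ[ℂ] R.Observables} (hρ : ∀ a, ρ₁ (φ a) = ρ (α a))
    {Θ U : unitary (Ψ.Space →L[ℂ] Ψ.Space)} (hΘ : Ψ.IsImplementer S.grading Θ)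
    {Θ₁ : H →L[ℂ] H} (hΘ₁ : ∀ a x, Θ₁ (ρ a x) = ρ (R.grading a) (Θ₁ x))
    (htot : Total fun p : intertwiners Ψ e ρ × Ψ.Space => p.1.1 p.2)
    {Y Z : Set Plane} {β : S.Observables ≃⋆ₐ[ℂ] S.Observables} {ε : Fin 2} {V : H →L[ℂ] H}
    (hV : IsLift e ρ Θ₁ Θ U ε V)
    (hβ : ∀ m b, S.modePos m ∉ Y → β (S.γ m b) = S.γ m b)
    (hα : ∀ a ∈ R.localAlgebra Z, α a ∈ R.localAlgebra Yᶜ) (hU : Ψ.IsImplementer β U)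
    (hε : HasParity Θ U ε) {y : T.Observables} (hy : y ∈ T.localAlgebra Z) (x : H) :
    V (ρ₁ y x) = ρ₁ y (V x) := by
  obtain ⟨y, rfl⟩ : ∃ b, φ b = y := ⟨_, φ.apply_symm_apply y⟩
  rw [hρ]
  refine commute_of_commute_γ (M := R.modePos ⁻¹' Yᶜ) (fun m hm b x => ?_)
    (hα _ ((hφ.2 _ _).1 hy)) x
  by_cases hme : m ∈ Set.range e
  · obtain ⟨k, rfl⟩ := hme
    have hk : S.modePos k ∉ Y := by
      rw [← he k]
      exact hm
    exact hV.commute_of_mem_range hΘ hΘ₁ htot (fun x => by rw [hU.apply, hβ k b hk]) x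
  · exact hV.commute_of_notMem_range hΨ hΘ hΘ₁ htot hε hme b x

/-- The commutation relation of implementers, given a representation of a larger system in which
there is a product vector for the local structure that is transported by `α`. -/
theorem graded_commute_of_productVector (hΨ : Ψ.IsPure) {R T : SpinSystem κ}
    {e : S.Mode → R.Mode} (he : ∀ m, R.modePos (e m) = S.modePos m)
    {H : Type} [NormedAddCommGroup H] [InnerProductSpace ℂ H] [CompleteSpace H]
    {ρ : R.Observables →⋆ₐ[ℂ] (H →L[ℂ] H)} {ρ₁ : T.Observables →⋆ₐ[ℂ] (H →L[ℂ] H)}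
    {φ : R.Observables ≃⋆ₐ[ℂ] T.Observables} (hφ : R.IsSystemIso T φ)
    {α : R.Observables ≃⋆ₐ[ℂ] R.Observables} (hαg : R.IsGraded α)
    (hρ : ∀ a, ρ₁ (φ a) = ρ (α a)) {Ωt : H}
    (hΩt : ∀ w, ⟪Ωt, ρ (R.word (w.map fun p => (e p.1, p.2))) Ωt⟫_ℂ = Ψ.functional (S.word w))
    (htotΩt : Total fun a => ρ a Ωt) {I : Type} {cell : T.Mode → I} {Ω : H}
    (hprod : IsProductVector cell ρ₁ Ω) {X YL YR : Set Plane}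
    (hX : IsSaturated cell (T.modePos ⁻¹' X))
    (hαL : ∀ a ∈ R.localAlgebra Xᶜ, α a ∈ R.localAlgebra YLᶜ)
    (hαR : ∀ a ∈ R.localAlgebra X, α a ∈ R.localAlgebra YRᶜ)
    {βL βR : S.Observables ≃⋆ₐ[ℂ] S.Observables}
    (hβL : ∀ m b, S.modePos m ∉ YL → βL (S.γ m b) = S.γ m b)
    (hβR : ∀ m b, S.modePos m ∉ YR → βR (S.γ m b) = S.γ m b)
    {Θ UL UR : unitary (Ψ.Space →L[ℂ] Ψ.Space)} (hΘ : Ψ.IsImplementer S.grading Θ)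
    (hUL : Ψ.IsImplementer βL UL) (hUR : Ψ.IsImplementer βR UR) {c : ℂ}
    (hc : ∀ x, (UL : Ψ.Space →L[ℂ] Ψ.Space) ((UR : Ψ.Space →L[ℂ] Ψ.Space) x) =
      c • (UR : Ψ.Space →L[ℂ] Ψ.Space) ((UL : Ψ.Space →L[ℂ] Ψ.Space) x))
    {εL εR : Fin 2} (hεL : HasParity Θ UL εL) (hεR : HasParity Θ UR εR) :
    c = (-1 : ℂ) ^ ((εL : ℕ) * (εR : ℕ)) := by
  obtain ⟨Θ₁, hΘ₁Ω, hΘ₁, hΘ₁i⟩ := hprod.exists_parity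
  -- The parity of the product vector also implements the grading in `ρ`, because both `α` and `φ`
  -- respect gradings.
  have hΘ₁' : ∀ a x, Θ₁ (ρ a x) = ρ (R.grading a) (Θ₁ x) := by
    intro a x
    obtain ⟨a, rfl⟩ : ∃ b, α b = a := ⟨_, α.apply_symm_apply a⟩
    rw [← hρ, ← hαg, ← hρ, hφ.1, hΘ₁]
  have htot := total_intertwiners (e := e) hΘ hΩt htotΩt
  obtain ⟨VL, hVL, hVLn⟩ := exists_isLift hΨ hΘ hΘ₁' hΘ₁i htot UL εL
  obtain ⟨VR, hVR, hVRn⟩ := exists_isLift hΨ hΘ hΘ₁' hΘ₁i htot UR εR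
  have hcommL : ∀ y ∈ T.localAlgebra Xᶜ, ∀ x, VL (ρ₁ y x) = ρ₁ y (VL x) :=
    fun y hy x => hVL.commute_of_localized hΨ he hφ hρ hΘ hΘ₁' htot hβL hαL hUL hεL hy x
  have hcommR : ∀ y ∈ T.localAlgebra X, ∀ x, VR (ρ₁ y x) = ρ₁ y (VR x) :=
    fun y hy x => hVR.commute_of_localized hΨ he hφ hρ hΘ hΘ₁' htot hβR hαR hUR hεR hy x
  have key := hprod.graded_commute hX hΘ₁Ω hΘ₁ (norm_eq_of_inner hΘ₁i)
    hVLn hVRn hcommL hcommR εL εR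
    (hVL.parity hΘ hΘ₁' htot hεL) (hVR.parity hΘ hΘ₁' htot hεR)
  -- The relation with the scalar `c` passes to the lifts. Comparison with the sign on the nonzero
  -- vector `VR (VL Ω)` determines `c`.
  have key' := hVL.commute hVR hΘ hΘ₁' htot hc Ω
  rw [key, ← sub_eq_zero, ← sub_smul] at key'
  have hne : VR (VL Ω) ≠ 0 := by
    rw [← norm_ne_zero_iff, hVRn, hVLn, hprod.norm_eq]
    exact one_ne_zero
  exact (sub_eq_zero.1 ((smul_eq_zero.1 key').resolve_right hne)).symm

/-- The commutation relation of implementers, given an automorphism that separates the two regions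
and disentangles an extension of the given state to a larger system. -/
theorem graded_commute_of_disentangled (hΨ : Ψ.IsPure) {R S₀ T₁ : SpinSystem κ}
    {e : S.Mode → R.Mode} (he : ∀ m, R.modePos (e m) = S.modePos m) {E₀ : State R.Observables}
    (hE₀ : ∀ w, E₀.functional (R.word (w.map fun p => (e p.1, p.2))) = Ψ.functional (S.word w))
    {Ψ₀ : State S₀.Observables} (hΨ₀ : IsTrivialState Ψ₀) {τ₁ : State T₁.Observables}
    (hτ₁ : IsTrivialState τ₁) {E₁ : State (S₀.stack T₁).Observables}
    (hE₁ : IsStackState E₁ Ψ₀ τ₁) {φ : R.Observables ≃⋆ₐ[ℂ] (S₀.stack T₁).Observables}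
    (hφ : R.IsSystemIso (S₀.stack T₁) φ) {α : R.Observables ≃⋆ₐ[ℂ] R.Observables}
    (hαg : R.IsGraded α) (hequiv : (E₀.comp α).UnitarilyEquivalent (E₁.comp φ))
    {X YL YR : Set Plane} (hαL : ∀ a ∈ R.localAlgebra Xᶜ, α a ∈ R.localAlgebra YLᶜ)
    (hαR : ∀ a ∈ R.localAlgebra X, α a ∈ R.localAlgebra YRᶜ)
    {βL βR : S.Observables ≃⋆ₐ[ℂ] S.Observables}
    (hβL : ∀ m b, S.modePos m ∉ YL → βL (S.γ m b) = S.γ m b)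
    (hβR : ∀ m b, S.modePos m ∉ YR → βR (S.γ m b) = S.γ m b)
    {Θ UL UR : unitary (Ψ.Space →L[ℂ] Ψ.Space)} (hΘ : Ψ.IsImplementer S.grading Θ)
    (hUL : Ψ.IsImplementer βL UL) (hUR : Ψ.IsImplementer βR UR) {c : ℂ}
    (hc : ∀ x, (UL : Ψ.Space →L[ℂ] Ψ.Space) ((UR : Ψ.Space →L[ℂ] Ψ.Space) x) =
      c • (UR : Ψ.Space →L[ℂ] Ψ.Space) ((UL : Ψ.Space →L[ℂ] Ψ.Space) x))
    {εL εR : Fin 2} (hεL : HasParity Θ UL εL) (hεR : HasParity Θ UR εR) :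
    c = (-1 : ℂ) ^ ((εL : ℕ) * (εR : ℕ)) := by
  obtain ⟨W, hW⟩ := hequiv
  -- Both representations live on the GNS space of `E₁.comp φ`. Undoing `φ` makes its cyclic vector
  -- represent the product state `E₁`; undoing `α` makes the image under `W` of the other cyclic
  -- vector represent `E₀`, which extends `Ψ`.
  set ρ := (E₁.comp φ).π.comp α.symm.toStarAlgHom
  set ρ₁ := (E₁.comp φ).π.comp φ.symm.toStarAlgHom
  have hρ : ∀ a, ρ (α a) = (E₁.comp φ).π a := fun a =>
    congrArg (E₁.comp φ).π (α.symm_apply_apply a)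
  have hρ₁ : ∀ a, ρ₁ (φ a) = (E₁.comp φ).π a := fun a =>
    congrArg (E₁.comp φ).π (φ.symm_apply_apply a)
  have hρW : ∀ a, ρ (α a) (W (E₀.comp α).vac) = W ((E₀.comp α).π a (E₀.comp α).vac) := fun a => by
    rw [hW, hρ]
  refine graded_commute_of_productVector hΨ he hφ hαg (ρ := ρ) (ρ₁ := ρ₁)
    (fun a => (hρ₁ a).trans (hρ a).symm) (Ωt := W (E₀.comp α).vac) (fun w => ?_) (fun x hx => ?_)
    (hE₁.isProductVector hΨ₀ hτ₁ (Ω := (E₁.comp φ).vac) (fun a => ?_) fun x hx => ?_)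
    (isSaturated_stackCell X) hαL hαR hβL hβR hΘ hUL hUR hc hεL hεR
  · obtain ⟨a, ha⟩ : ∃ b, α b = R.word (w.map fun p => (e p.1, p.2)) :=
      ⟨_, α.apply_symm_apply _⟩
    rw [← hE₀, ← ha, hρW, W.inner_map_map, State.inner_vac_π]
    rfl
  · have h : W.symm x = 0 := (E₀.comp α).total_π_vac _ fun a => by
      have h := hx (α a)
      beta_reduce at h
      rw [hρW, ← W.apply_symm_apply x, W.inner_map_map] at h
      exact h
    rw [← W.apply_symm_apply x, h, map_zero]
  · obtain ⟨a, rfl⟩ : ∃ b, φ b = a := ⟨_, φ.apply_symm_apply a⟩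
    rw [hρ₁, State.inner_vac_π]
    rfl
  · refine (E₁.comp φ).total_π_vac x fun a => ?_
    have h := hx (φ a)
    beta_reduce at h
    rwa [hρ₁] at h

end Main

/-! ### Cones in the plane -/

section Geometry

theorem direction_add_two_pi (θ : ℝ) : direction (θ + 2 * Real.pi) = direction θ := by
  simp [direction]

theorem direction_add_int (θ : ℝ) (k : ℤ) : direction (θ + k * (2 * Real.pi)) = direction θ := by
  simp [direction]

theorem norm_direction (θ : ℝ) : ‖direction θ‖ = 1 := by
  simp [direction, EuclideanSpace.norm_eq]

theorem continuous_direction : Continuous direction := by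
  refine (PiLp.continuous_toLp 2 _).comp (continuous_pi fun i => ?_)
  fin_cases i
  · exact Real.continuous_cos
  · exact Real.continuous_sin

theorem exists_eq_smul_direction (c : ℝ) (y : Plane) :
    ∃ r θ : ℝ, 0 ≤ r ∧ c ≤ θ ∧ θ < c + 2 * Real.pi ∧ y = r • direction θ := by
  set z : ℂ := ⟨y 0, y 1⟩ with hz
  obtain ⟨k, hk, -⟩ := existsUnique_add_zsmul_mem_Ico Real.two_pi_pos z.arg c
  refine ⟨‖z‖, z.arg + k • (2 * Real.pi), norm_nonneg _, hk.1, hk.2, ?_⟩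
  rw [zsmul_eq_mul, direction_add_int]
  ext i
  fin_cases i
  · exact (Complex.norm_mul_cos_arg z).symm
  · exact (Complex.norm_mul_sin_arg z).symm

/-- Taking norms equates the radii; then the angles differ by a multiple of the full angle that is
smaller than the full angle in modulus. -/
theorem eq_of_smul_direction_eq {r s θ θ' : ℝ} (hr : 0 < r) (hs : 0 ≤ s)
    (h : r • direction θ = s • direction θ') (h1 : θ' - θ < 2 * Real.pi)
    (h2 : θ - θ' < 2 * Real.pi) : θ = θ' := by
  have hn := congrArg norm h
  rw [norm_smul, norm_smul, norm_direction, norm_direction, mul_one, mul_one,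
    Real.norm_of_nonneg hr.le, Real.norm_of_nonneg hs] at hn
  subst hn
  have hd := smul_right_injective _ hr.ne' h
  have h0 : Real.cos θ = Real.cos θ' := congrArg (fun v : Plane => v 0) hd
  have h0' : Real.sin θ = Real.sin θ' := congrArg (fun v : Plane => v 1) hd
  obtain ⟨k, hk⟩ := Real.Angle.angle_eq_iff_two_pi_dvd_sub.1 (Real.Angle.cos_sin_inj h0 h0')
  have hpi := Real.two_pi_pos
  have hk1 : (k : ℝ) < 1 := by
    by_contra hcon
    nlinarith [not_lt.1 hcon]
  have hk2 : (-1 : ℝ) < k := by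
    by_contra hcon
    nlinarith [not_lt.1 hcon]
  have hk0 : k = 0 := by
    have h3 : k < 1 := by exact_mod_cast hk1
    have h4 : -1 < k := by exact_mod_cast hk2
    omega
  rw [hk0, Int.cast_zero, mul_zero] at hk
  exact sub_eq_zero.1 hk

/-- The closed sector spanned by the half-lines from `p` with directions in `[a, b]`. -/
def closedSector (p : Plane) (a b : ℝ) : Set Plane :=
  {x | ∃ r θ : ℝ, 0 ≤ r ∧ a ≤ θ ∧ θ ≤ b ∧ x = p + r • direction θ}

/-- The sector is the projection of a closed set along a compact interval of angles. -/
theorem isClosed_closedSector (p : Plane) (a b : ℝ) : IsClosed (closedSector p a b) := by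
  have h : closedSector p a b =
      Prod.fst '' {z : Plane × Set.Icc a b | z.1 - p = ‖z.1 - p‖ • direction z.2} := by
    ext x
    constructor
    · rintro ⟨r, θ, hr, ha, hb, rfl⟩
      refine ⟨(_, ⟨θ, ha, hb⟩), ?_, rfl⟩
      simp [norm_smul, norm_direction, abs_of_nonneg hr]
    · rintro ⟨⟨y, θ, ha, hb⟩, h, rfl⟩
      exact ⟨_, θ, norm_nonneg _, ha, hb, eq_add_of_sub_eq' h⟩
  rw [h]
  refine isClosedMap_fst_of_compactSpace _ (isClosed_eq (by fun_prop) ?_)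
  exact ((continuous_fst.sub continuous_const).norm).smul
    (continuous_direction.comp (continuous_subtype_val.comp continuous_snd))

theorem closedSector_add_two_pi (p : Plane) (a b : ℝ) :
    closedSector p (a + 2 * Real.pi) (b + 2 * Real.pi) = closedSector p a b := by
  ext x
  constructor
  · rintro ⟨r, θ, hr, ha, hb, rfl⟩
    refine ⟨r, θ - 2 * Real.pi, hr, by linarith, by linarith, ?_⟩
    rw [← direction_add_two_pi (θ - _), sub_add_cancel]
  · rintro ⟨r, θ, hr, ha, hb, rfl⟩
    exact ⟨r, θ + 2 * Real.pi, hr, by linarith, by linarith, by rw [direction_add_two_pi]⟩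

theorem closedSector_inter_subset {p : Plane} {a b c d : ℝ} (h1 : b < c)
    (h2 : d < a + 2 * Real.pi) : closedSector p a b ∩ closedSector p c d ⊆ {p} := by
  rintro x ⟨⟨r, θ, hr, ha, hb, rfl⟩, s, θ', hs, hc, hd, h⟩
  rcases hr.eq_or_lt with rfl | hr
  · simp
  · have := eq_of_smul_direction_eq hr hs (add_left_cancel h) (by linarith) (by linarith)
    linarith

theorem self_mem_closedSector (p : Plane) {a b : ℝ} (h : a ≤ b) : p ∈ closedSector p a b :=
  ⟨0, a, le_rfl, le_rfl, h, by simp⟩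

namespace Cone

theorem disjoint_region {C D : Cone} (hp : C.apex = D.apex) (h1 : C.hi ≤ D.lo)
    (h2 : D.hi ≤ C.lo + 2 * Real.pi) : Disjoint C.region D.region := by
  rw [Set.disjoint_left]
  rintro x ⟨r, θ, hr, ha, hb, rfl⟩ ⟨s, θ', hs, hc, hd, h⟩
  rw [hp] at h
  have := eq_of_smul_direction_eq hr hs.le (add_left_cancel h) (by linarith) (by linarith)
  linarith

theorem compl_region (C : Cone) :
    C.regionᶜ = closedSector C.apex C.hi (C.lo + 2 * Real.pi) := by
  ext x
  constructor
  · intro hx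
    obtain ⟨r, θ, hr, h1, h2, h⟩ := exists_eq_smul_direction C.lo (x - C.apex)
    have h' : x = C.apex + r • direction θ := eq_add_of_sub_eq' h
    rcases hr.eq_or_lt with rfl | hr
    · rw [zero_smul, add_zero] at h'
      rw [h']
      exact self_mem_closedSector _ C.hi_lt.le
    · rcases h1.eq_or_lt with rfl | h1
      · exact ⟨r, C.lo + 2 * Real.pi, hr.le, C.hi_lt.le, le_rfl, by rwa [direction_add_two_pi]⟩
      · exact ⟨r, θ, hr.le, not_lt.1 fun h3 => hx ⟨r, θ, hr, h1, h3, h'⟩, h2.le, h'⟩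
  · rintro ⟨s, θ', hs, hc, hd, rfl⟩ ⟨r, θ, hr, ha, hb, h⟩
    have := eq_of_smul_direction_eq hr hs (add_left_cancel h.symm) (by linarith) (by linarith)
    linarith

theorem isOpen_region (C : Cone) : IsOpen C.region := by
  rw [← isClosed_compl_iff, C.compl_region]
  exact isClosed_closedSector _ _ _

theorem closure_region (C : Cone) : closure C.region = closedSector C.apex C.lo C.hi := by
  refine subset_antisymm (closure_minimal ?_ (isClosed_closedSector _ _ _)) ?_
  · rintro x ⟨r, θ, hr, ha, hb, rfl⟩
    exact ⟨r, θ, hr.le, ha.le, hb.le, rfl⟩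
  · rintro x ⟨r, θ, hr, ha, hb, rfl⟩
    have hf : Continuous fun z : ℝ × ℝ => C.apex + z.1 • direction z.2 :=
      continuous_const.add (continuous_fst.smul (continuous_direction.comp continuous_snd))
    have hmem : ((r, θ) : ℝ × ℝ) ∈ closure (Set.Ioi (0 : ℝ) ×ˢ Set.Ioo C.lo C.hi) := by
      rw [closure_prod_eq, closure_Ioi, closure_Ioo C.lo_lt_hi.ne]
      exact ⟨hr, ha, hb⟩
    refine closure_mono ?_ (image_closure_subset_closure_image hf ⟨_, hmem, rfl⟩)
    rintro _ ⟨⟨r, θ⟩, ⟨hr, ha, hb⟩, rfl⟩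
    exact ⟨r, θ, hr, ha, hb, rfl⟩

theorem boundary_eq (C : Cone) : C.boundary =
    closedSector C.apex C.lo C.hi ∩ closedSector C.apex C.hi (C.lo + 2 * Real.pi) := by
  have h := compl_region ⟨C.apex, C.hi, C.lo + 2 * Real.pi, C.hi_lt, by linarith [C.lo_lt_hi]⟩
  rw [closedSector_add_two_pi] at h
  rw [boundary, frontier_eq_closure_inter_closure, closure_closure, C.closure_region]
  simp only at h
  rw [← h, compl_compl, closure_region]

theorem add_direction_lo_mem_boundary (C : Cone) : C.apex + direction C.lo ∈ C.boundary := by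
  rw [boundary_eq]
  exact ⟨⟨1, C.lo, zero_le_one, le_rfl, C.lo_lt_hi.le, by rw [one_smul]⟩,
    ⟨1, C.lo + 2 * Real.pi, zero_le_one, C.hi_lt.le, le_rfl,
      by rw [one_smul, direction_add_two_pi]⟩⟩

theorem add_direction_hi_mem_boundary (C : Cone) : C.apex + direction C.hi ∈ C.boundary := by
  rw [boundary_eq]
  exact ⟨⟨1, C.hi, zero_le_one, C.lo_lt_hi.le, le_rfl, by rw [one_smul]⟩,
    ⟨1, C.hi, zero_le_one, le_rfl, C.hi_lt.le, by rw [one_smul]⟩⟩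

theorem exists_of_mem_boundary {C : Cone} {x : Plane} (hx : x ∈ C.boundary) :
    ∃ r : ℝ, x = C.apex + r • direction C.lo ∨ x = C.apex + r • direction C.hi := by
  rw [boundary_eq] at hx
  obtain ⟨⟨r, θ, hr, ha, hb, rfl⟩, s, θ', hs, hc, hd, h⟩ := hx
  rcases hr.eq_or_lt with rfl | hr
  · exact ⟨0, Or.inl (by simp)⟩
  refine ⟨r, ?_⟩
  by_cases h1 : θ = C.lo
  · exact Or.inl (by rw [h1])
  · have := eq_of_smul_direction_eq hr hs (add_left_cancel h) (by
      have := lt_of_le_of_ne ha (Ne.symm h1)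
      linarith) (by linarith [Real.two_pi_pos])
    have h2 : θ = C.hi := by linarith
    exact Or.inr (by rw [h2])

/-- The cone rotated by a multiple of the full angle. -/
def rotate (C : Cone) (k : ℤ) : Cone where
  apex := C.apex
  lo := C.lo + k * (2 * Real.pi)
  hi := C.hi + k * (2 * Real.pi)
  lo_lt_hi := by linarith [C.lo_lt_hi]
  hi_lt := by linarith [C.hi_lt]

theorem region_rotate (C : Cone) (k : ℤ) : (C.rotate k).region = C.region := by
  ext x
  constructor
  · rintro ⟨r, θ, hr, ha, hb, h⟩
    simp only [rotate] at ha hb h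
    refine ⟨r, θ - k * (2 * Real.pi), hr, by linarith, by linarith, ?_⟩
    rw [← direction_add_int (θ - _) k, sub_add_cancel]
    exact h
  · rintro ⟨r, θ, hr, ha, hb, h⟩
    refine ⟨r, θ + k * (2 * Real.pi), hr, by simpa [rotate], by simpa [rotate], ?_⟩
    rw [direction_add_int]
    exact h

/-- Disjoint cones whose boundaries meet only at the common apex are separated by gaps. -/
theorem exists_rotate_gap {C D : Cone} (hp : C.apex = D.apex) (hdisj : Disjoint C.region D.region)
    (hbdry : C.boundary ∩ D.boundary = {C.apex}) :
    ∃ k : ℤ, C.hi < (D.rotate k).lo ∧ (D.rotate k).hi < C.lo + 2 * Real.pi := by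
  -- The angles of `D` are shifted so that `D.lo` falls into the full turn starting at `C.lo`.
  -- Overlapping intervals then contradict disjointness, and touching ones give a common boundary
  -- point at distance one from the apex.
  obtain ⟨k, ⟨hk1, hk2⟩, -⟩ := existsUnique_add_zsmul_mem_Ico Real.two_pi_pos D.lo C.lo
  rw [zsmul_eq_mul] at hk1 hk2
  refine ⟨k, ?_⟩
  have hD : (D.rotate k).boundary = D.boundary := by rw [boundary, region_rotate, boundary]
  rw [← D.region_rotate k] at hdisj
  rw [← hD] at hbdry
  replace hp : C.apex = (D.rotate k).apex := hp
  replace hk1 : C.lo ≤ (D.rotate k).lo := hk1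
  replace hk2 : (D.rotate k).lo < C.lo + 2 * Real.pi := hk2
  generalize D.rotate k = E at *
  have hE := E.lo_lt_hi
  have hC := C.lo_lt_hi
  have hdir : ∀ θ, C.apex + direction θ ≠ C.apex := fun θ h => by
    have h1 := norm_direction θ
    rw [add_eq_left.1 h, norm_zero] at h1
    exact zero_ne_one h1
  constructor
  · refine lt_of_le_of_ne (not_lt.1 fun h => ?_) fun h => ?_
    · obtain ⟨θ, h1, h2⟩ := exists_between (lt_min h hE)
      refine Set.disjoint_left.1 hdisj
        ⟨1, θ, one_pos, by linarith, h2.trans_le (min_le_left _ _), rfl⟩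
        ⟨1, θ, one_pos, h1, h2.trans_le (min_le_right _ _), by rw [hp]⟩
    · refine hdir C.hi (hbdry.le ⟨C.add_direction_hi_mem_boundary, ?_⟩)
      rw [h, hp]
      exact E.add_direction_lo_mem_boundary
  · refine lt_of_le_of_ne (not_lt.1 fun h => ?_) fun h => ?_
    · obtain ⟨θ, h1, h2⟩ := exists_between (lt_min h (add_lt_add_left hC (2 * Real.pi)))
      have h3 := h2.trans_le (min_le_right _ _)
      refine Set.disjoint_left.1 hdisj
        ⟨1, θ - 2 * Real.pi, one_pos, by linarith, by linarith, rfl⟩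
        ⟨1, θ, one_pos, by linarith, h2.trans_le (min_le_left _ _), ?_⟩
      rw [hp, ← direction_add_two_pi (θ - _), sub_add_cancel]
    · refine hdir C.lo (hbdry.le ⟨C.add_direction_lo_mem_boundary, ?_⟩)
      rw [← direction_add_two_pi, ← h, hp]
      exact E.add_direction_hi_mem_boundary

/-- A slightly displaced and slightly wider cone contains all the points of a cone that are not too
close to the apex. -/
theorem exists_region_subset (C : Cone) {a b : ℝ} (ha : a < C.lo) (hb : C.hi < b)
    (hab : b < a + 2 * Real.pi) {d : ℝ} (hd : 0 < d) :
    ∃ ε > 0, ∀ D : Cone, dist D.apex C.apex < ε → D.lo = a → D.hi = b →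
      ∀ x ∈ C.region, d ≤ dist x C.apex → x ∈ D.region := by
  set E : Cone := ⟨0, a, b, by linarith [C.lo_lt_hi], hab⟩ with hE
  have hK : IsCompact (direction '' Set.Icc C.lo C.hi) :=
    isCompact_Icc.image continuous_direction
  have hKE : direction '' Set.Icc C.lo C.hi ⊆ E.region := by
    rintro _ ⟨θ, ⟨h1, h2⟩, rfl⟩
    exact ⟨1, θ, one_pos, ha.trans_le h1, h2.trans_lt hb, by simp [hE]⟩
  -- The compact arc of directions has a uniform margin `δ` inside the wider cone. Rescaling a point
  -- at distance `r ≥ d` to the unit circle turns the displacement of the apex into one of size less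
  -- than `δ`.
  obtain ⟨δ, hδ, hsub⟩ := hK.exists_thickening_subset_open E.isOpen_region hKE
  refine ⟨δ * d, by positivity, ?_⟩
  rintro D hD hlo hhi x ⟨r, θ, hr, h1, h2, rfl⟩ hx
  have hxr : dist (C.apex + r • direction θ) C.apex = r := by
    rw [dist_eq_norm, add_sub_cancel_left, norm_smul, norm_direction, mul_one,
      Real.norm_of_nonneg hr.le]
  rw [hxr] at hx
  have hmem : direction θ + r⁻¹ • (C.apex - D.apex) ∈ E.region := by
    refine hsub (Metric.mem_thickening_iff.2 ⟨direction θ, ⟨θ, ⟨h1.le, h2.le⟩, rfl⟩, ?_⟩)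
    rw [dist_eq_norm, add_sub_cancel_left, norm_smul, norm_inv, Real.norm_of_nonneg hr.le,
      ← dist_eq_norm, dist_comm, inv_mul_lt_iff₀ hr]
    calc dist D.apex C.apex < δ * d := hD
      _ ≤ r * δ := by rw [mul_comm]; gcongr
  obtain ⟨s, θ', hs, h3, h4, h⟩ := hmem
  refine ⟨r * s, θ', mul_pos hr hs, by rwa [hlo], by rwa [hhi], ?_⟩
  rw [hE, zero_add] at h
  rw [mul_smul, ← h, smul_add, smul_inv_smul₀ hr.ne']
  abel

end Cone

/-- Sites do not accumulate at a point. -/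
theorem SpinSystem.exists_le_dist {κ : Statistics} (S : SpinSystem κ) (p : Plane) :
    ∃ d > 0, ∀ j, S.pos j ≠ p → d ≤ dist (S.pos j) p := by
  obtain ⟨l, hl⟩ := S.uniformlyLocallyFinite
  have hfin : {j | dist (S.pos j) p < 1}.Finite :=
    Set.finite_of_encard_le_coe (hl p)
  have hF : (S.pos '' {j | dist (S.pos j) p < 1} \ {p}).Finite := (hfin.image _).sdiff
  obtain ⟨ε, hε, hball⟩ := Metric.isOpen_iff.1 hF.isClosed.isOpen_compl p (by simp)
  refine ⟨min ε 1, lt_min hε one_pos, fun j hj => not_lt.1 fun h => ?_⟩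
  exact hball (h.trans_le (min_le_left _ _)) ⟨⟨j, h.trans_le (min_le_right _ _), rfl⟩, hj⟩

/-- Points that do not lie on any of countably many lines are dense. -/
theorem dense_off_lines {Q : Set Plane} (hQ : Q.Countable) {F : Set ℝ} (hF : F.Countable) :
    Dense {p : Plane | ∀ q ∈ Q, ∀ θ ∈ F, ∀ r : ℝ, q ≠ p + r • direction θ} := by
  refine MeasureTheory.Measure.dense_of_ae (μ := MeasureTheory.volume) ?_
  rw [MeasureTheory.ae_ball_iff hQ]
  intro q _
  rw [MeasureTheory.ae_ball_iff hF]
  intro θ _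
  -- The apexes excluded by a site `q` and a direction form a line through `q`, which has measure
  -- zero.
  have hne : AffineSubspace.mk' q (Submodule.span ℝ {direction θ}) ≠ ⊤ := by
    intro h
    have h1 := congrArg AffineSubspace.direction h
    rw [AffineSubspace.direction_mk', AffineSubspace.direction_top] at h1
    have h2 := finrank_span_singleton (K := ℝ) (v := direction θ) fun h0 => by
      have h3 := norm_direction θ
      rw [h0, norm_zero] at h3
      exact zero_ne_one h3
    rw [h1, finrank_top, finrank_euclideanSpace_fin] at h2
    norm_num at h2
  have h0 := MeasureTheory.Measure.addHaar_affineSubspace MeasureTheory.volume _ hne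
  refine MeasureTheory.ae_iff.2 (MeasureTheory.measure_mono_null ?_ h0)
  intro p hp
  simp only [Set.mem_ofPred_eq, not_forall, not_not] at hp
  obtain ⟨r, rfl⟩ := hp
  rw [SetLike.mem_coe, AffineSubspace.mem_mk']
  refine Submodule.mem_span_singleton.2 ⟨-r, ?_⟩
  simp

end Geometry

/-! ### A partition that separates the two cones -/

section Partition

theorem pairwise_of_lt {n : ℕ} {r : Fin n → Fin n → Prop} (hsymm : ∀ {a b}, r a b → r b a)
    (h : ∀ a b, a < b → r a b) : Pairwise r := fun a b hab =>
  hab.lt_or_gt.elim (h a b) fun hba => hsymm (h b a hba)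

/-- The good conical partition with apex `p`, separating half-lines in the directions
`t 0 < t 1 < t 2 < t 3`, and cones of opening angle `2 * δ` around them. -/
def fourPartition (p : Plane) (t : Fin 4 → ℝ) (δ : ℝ) (hδ : 0 < δ) (h0 : t 0 + 2 * δ < t 1)
    (h1 : t 1 + 2 * δ < t 2) (h2 : t 2 + 2 * δ < t 3)
    (h3 : t 3 + 2 * δ < t 0 + 2 * Real.pi) : GoodConicalPartition 2 where
  apex := p
  A := ![⟨p, t 0, t 1, by linarith, by linarith⟩, ⟨p, t 1, t 2, by linarith, by linarith⟩,
    ⟨p, t 2, t 3, by linarith, by linarith⟩, ⟨p, t 3, t 0 + 2 * Real.pi, by linarith, by linarith⟩]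
  B := ![⟨p, t 1 - δ, t 1 + δ, by linarith, by linarith⟩,
    ⟨p, t 2 - δ, t 2 + δ, by linarith, by linarith⟩,
    ⟨p, t 3 - δ, t 3 + δ, by linarith, by linarith⟩,
    ⟨p, t 0 + 2 * Real.pi - δ, t 0 + 2 * Real.pi + δ, by linarith, by linarith⟩]
  apex_A := by intro a; fin_cases a <;> rfl
  apex_B := by intro a; fin_cases a <;> rfl
  disjoint_A := by
    refine pairwise_of_lt (fun h => Disjoint.symm h) ?_
    intro a b hab
    fin_cases a <;> fin_cases b <;> first
      | exact absurd hab (by decide)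
      | exact Cone.disjoint_region rfl (by simp; try linarith) (by simp; try linarith)
  cover := by
    refine Set.eq_univ_of_forall fun x => ?_
    obtain ⟨r, θ, hr, ha, hb, h⟩ := exists_eq_smul_direction (t 0) (x - p)
    replace h : x = p + r • direction θ := eq_add_of_sub_eq' h
    have key : ∀ A : Fin 4 → Cone, ∀ a, x ∈ closedSector (A a).apex (A a).lo (A a).hi →
        x ∈ closure (⋃ a, (A a).region) := fun A a hx =>
      closure_mono (Set.subset_iUnion (fun a => (A a).region) a) ((A a).closure_region ▸ hx)
    rcases le_total θ (t 1) with c1 | c1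
    · exact key _ 0 ⟨r, θ, hr, ha, c1, h⟩
    rcases le_total θ (t 2) with c2 | c2
    · exact key _ 1 ⟨r, θ, hr, c1, c2, h⟩
    rcases le_total θ (t 3) with c3 | c3
    · exact key _ 2 ⟨r, θ, hr, c2, c3, h⟩
    · exact key _ 3 ⟨r, θ, hr, c3, hb.le, h⟩
  oriented := by
    intro a
    fin_cases a
    · rfl
    · rfl
    · rfl
    · exact direction_add_two_pi (t 0)
  closure_B := by
    refine pairwise_of_lt (fun h => by rwa [Set.inter_comm]) ?_
    intro a b hab
    simp only [Cone.closure_region]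
    refine subset_antisymm ?_ (Set.singleton_subset_iff.2 ?_)
    · fin_cases a <;> fin_cases b <;> first
        | exact absurd hab (by decide)
        | exact closedSector_inter_subset (by simp; try linarith) (by simp; try linarith)
    · fin_cases a <;> fin_cases b <;>
        exact ⟨self_mem_closedSector _ (by simp; try linarith),
          self_mem_closedSector _ (by simp; try linarith)⟩
  separating := by
    intro a r hr
    fin_cases a <;> exact ⟨r, _, hr, by simp [hδ], by simp [hδ], rfl⟩

theorem fourPartition_disjoint_B (p : Plane) (t : Fin 4 → ℝ) (δ : ℝ) (hδ : 0 < δ)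
    (h0 : t 0 + 2 * δ < t 1) (h1 : t 1 + 2 * δ < t 2) (h2 : t 2 + 2 * δ < t 3)
    (h3 : t 3 + 2 * δ < t 0 + 2 * Real.pi) :
    Pairwise fun a b => Disjoint ((fourPartition p t δ hδ h0 h1 h2 h3).B a).region
      ((fourPartition p t δ hδ h0 h1 h2 h3).B b).region := by
  refine pairwise_of_lt (fun h => Disjoint.symm h) ?_
  intro a b hab
  fin_cases a <;> fin_cases b <;> first
    | exact absurd hab (by decide)
    | exact Cone.disjoint_region rfl (by simp [fourPartition]; linarith)
        (by simp [fourPartition]; linarith)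

theorem fourPartition_disjoint_A_B (p : Plane) (t : Fin 4 → ℝ) (δ : ℝ) (hδ : 0 < δ)
    (h0 : t 0 + 2 * δ < t 1) (h1 : t 1 + 2 * δ < t 2) (h2 : t 2 + 2 * δ < t 3)
    (h3 : t 3 + 2 * δ < t 0 + 2 * Real.pi) :
    Disjoint ((fourPartition p t δ hδ h0 h1 h2 h3).A 0).region
        ((fourPartition p t δ hδ h0 h1 h2 h3).B 1).region ∧
      Disjoint ((fourPartition p t δ hδ h0 h1 h2 h3).A 0).region
        ((fourPartition p t δ hδ h0 h1 h2 h3).B 2).region ∧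
      Disjoint ((fourPartition p t δ hδ h0 h1 h2 h3).A 2).region
        ((fourPartition p t δ hδ h0 h1 h2 h3).B 0).region ∧
      Disjoint ((fourPartition p t δ hδ h0 h1 h2 h3).A 2).region
        ((fourPartition p t δ hδ h0 h1 h2 h3).B 3).region := by
  refine ⟨Cone.disjoint_region rfl ?_ ?_, Cone.disjoint_region rfl ?_ ?_,
    Disjoint.symm (Cone.disjoint_region rfl ?_ ?_), Cone.disjoint_region rfl ?_ ?_⟩ <;>
    simp [fourPartition] <;> linarith

/-- The set `F` of boundary angles does not depend on the apex, so the apex can be chosen afterwards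
to avoid the lines in these directions. -/
theorem exists_fourPartition {t : Fin 4 → ℝ} {δ : ℝ} (hδ : 0 < δ)
    (h0 : t 0 + 2 * δ < t 1) (h1 : t 1 + 2 * δ < t 2) (h2 : t 2 + 2 * δ < t 3)
    (h3 : t 3 + 2 * δ < t 0 + 2 * Real.pi) :
    ∃ F : Set ℝ, F.Countable ∧ ∀ p : Plane, ∃ P : GoodConicalPartition 2, P.apex = p ∧
      (∀ a, ((P.A a).lo ∈ F ∧ (P.A a).hi ∈ F) ∧ (P.B a).lo ∈ F ∧ (P.B a).hi ∈ F) ∧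
      ((P.A 0).lo = t 0 ∧ (P.A 0).hi = t 1) ∧ ((P.A 2).lo = t 2 ∧ (P.A 2).hi = t 3) ∧
      (Pairwise fun a b => Disjoint (P.B a).region (P.B b).region) ∧
      Disjoint (P.A 0).region (P.B 1).region ∧ Disjoint (P.A 0).region (P.B 2).region ∧
      Disjoint (P.A 2).region (P.B 0).region ∧ Disjoint (P.A 2).region (P.B 3).region := by
  refine ⟨{t 0, t 1, t 2, t 3, t 0 + 2 * Real.pi, t 1 - δ, t 1 + δ, t 2 - δ, t 2 + δ, t 3 - δ,
    t 3 + δ, t 0 + 2 * Real.pi - δ, t 0 + 2 * Real.pi + δ}, (Set.toFinite _).countable, fun p =>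
    ⟨fourPartition p t δ hδ h0 h1 h2 h3, rfl, fun a => ?_, ⟨rfl, rfl⟩, ⟨rfl, rfl⟩,
      fourPartition_disjoint_B .., fourPartition_disjoint_A_B ..⟩⟩
  fin_cases a <;> simp [fourPartition]

/-- Disjoint cones with a common apex whose boundaries meet only there are contained, as far as the
sites are concerned, in opposite cones of a good conical partition that avoids a given countable
set. -/
theorem exists_partition {κ : Statistics} (S : SpinSystem κ) {C D : Cone} (hp : C.apex = D.apex)
    (hdisj : Disjoint C.region D.region) (hbdry : C.boundary ∩ D.boundary = {C.apex})
    {Q : Set Plane} (hQ : Q.Countable) : ∃ P : GoodConicalPartition 2,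
      (∀ a, ∀ q ∈ Q, q ∉ (P.A a).boundary ∧ q ∉ (P.B a).boundary) ∧
      (∀ j, S.pos j ∈ C.region → S.pos j ∈ (P.A 0).region) ∧
      (∀ j, S.pos j ∈ D.region → S.pos j ∈ (P.A 2).region) ∧
      (Pairwise fun a b => Disjoint (P.B a).region (P.B b).region) ∧
      Disjoint (P.A 0).region (P.B 1).region ∧ Disjoint (P.A 0).region (P.B 2).region ∧
      Disjoint (P.A 2).region (P.B 0).region ∧ Disjoint (P.A 2).region (P.B 3).region := by
  obtain ⟨k, hk1, hk2⟩ := Cone.exists_rotate_gap hp hdisj hbdry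
  have hE : (D.rotate k).apex = C.apex := hp.symm
  obtain ⟨t, δ, hδ, h0, h1, h2, h3, hC0, hC1, hE2, hE3⟩ : ∃ (t : Fin 4 → ℝ) (δ : ℝ), 0 < δ ∧
      t 0 + 2 * δ < t 1 ∧ t 1 + 2 * δ < t 2 ∧ t 2 + 2 * δ < t 3 ∧
      t 3 + 2 * δ < t 0 + 2 * Real.pi ∧ t 0 < C.lo ∧ C.hi < t 1 ∧ t 2 < (D.rotate k).lo ∧
      (D.rotate k).hi < t 3 := by
    obtain ⟨g, hg, hg1, hg2⟩ : ∃ g : ℝ, 0 < g ∧ C.hi + g ≤ (D.rotate k).lo ∧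
        (D.rotate k).hi + g ≤ C.lo + 2 * Real.pi :=
      ⟨min ((D.rotate k).lo - C.hi) (C.lo + 2 * Real.pi - (D.rotate k).hi),
        lt_min (by linarith) (by linarith),
        by linarith [min_le_left ((D.rotate k).lo - C.hi) (C.lo + 2 * Real.pi - (D.rotate k).hi)],
        by linarith [min_le_right ((D.rotate k).lo - C.hi) (C.lo + 2 * Real.pi - (D.rotate k).hi)]⟩
    have hC := C.lo_lt_hi
    have hD := (D.rotate k).lo_lt_hi
    -- Each cone is widened by `g / 3` on both sides, which leaves at least `g / 3` of every gap
    -- free. This exceeds the angle `2 * (g / 12)` required between neighbouring separating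
    -- directions.
    refine ⟨![C.lo - g / 3, C.hi + g / 3, (D.rotate k).lo - g / 3, (D.rotate k).hi + g / 3], g / 12,
      by positivity, ?_, ?_, ?_, ?_, ?_, ?_, ?_, ?_⟩ <;> simp <;> linarith
  obtain ⟨F, hF, hFP⟩ := exists_fourPartition hδ h0 h1 h2 h3
  obtain ⟨d, hd, hdist⟩ := S.exists_le_dist C.apex
  obtain ⟨ε, hε, hCP⟩ := C.exists_region_subset hC0 hC1 (by linarith) hd
  obtain ⟨ε', hε', hDP⟩ := (D.rotate k).exists_region_subset hE2 hE3 (by linarith) hd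
  -- The apex moves by less than both tolerances. These are positive because the sites inside the
  -- cones stay at distance at least `d` from the original apex.
  obtain ⟨p, hpQ, hpd⟩ := (dense_off_lines hQ hF).exists_dist_lt C.apex (lt_min hε hε')
  rw [dist_comm] at hpd
  have hne : ∀ {B : Cone}, B.apex = C.apex → ∀ j, S.pos j ∈ B.region →
      d ≤ dist (S.pos j) C.apex := by
    rintro B hB j ⟨r, θ, hr, -, -, h⟩
    refine hdist j fun h' => ?_
    rw [h', hB, left_eq_add, smul_eq_zero, or_iff_right hr.ne', ← norm_eq_zero,
      norm_direction] at h
    exact one_ne_zero h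
  have hgen : ∀ B : Cone, B.apex = p → B.lo ∈ F ∧ B.hi ∈ F → ∀ q ∈ Q, q ∉ B.boundary := by
    rintro B rfl ⟨hlo, hhi⟩ q hq hqB
    obtain ⟨r, h | h⟩ := Cone.exists_of_mem_boundary hqB
    · exact hpQ q hq _ hlo r h
    · exact hpQ q hq _ hhi r h
  obtain ⟨P, rfl, hPF, hA0, hA2, hPB⟩ := hFP p
  refine ⟨P, fun a q hq => ⟨hgen _ (P.apex_A a) (hPF a).1 q hq, hgen _ (P.apex_B a) (hPF a).2 q hq⟩,
    fun j hj => ?_, fun j hj => ?_, hPB⟩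
  · refine hCP _ ?_ hA0.1 hA0.2 _ hj (hne rfl j hj)
    rw [P.apex_A]
    exact hpd.trans_le (min_le_left _ _)
  · rw [← D.region_rotate k] at hj
    refine hDP _ ?_ hA2.1 hA2.2 _ hj (by rw [hE]; exact hne hE j hj)
    rw [hE, P.apex_A]
    exact hpd.trans_le (min_le_right _ _)

end Partition

/-! ### From invertibility to the commutation relation -/

section Conclusion

variable {κ : Statistics} {S : SpinSystem κ} {Ψ : State S.Observables}

/-- The commutation relation of implementers of automorphisms of two separated cones. -/
theorem graded_commute_of_isInvertible (hpure : Ψ.IsPure) (hinv : IsInvertible Ψ) {BL BR : Cone}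
    (hapex : BL.apex = BR.apex) (hdisj : Disjoint BL.region BR.region)
    (hbdry : BL.boundary ∩ BR.boundary = {BL.apex})
    {βL βR : S.Observables ≃⋆ₐ[ℂ] S.Observables}
    (hβL : S.IsLocalizedIn BL.region βL) (hβR : S.IsLocalizedIn BR.region βR)
    {Θ UL UR : unitary (Ψ.Space →L[ℂ] Ψ.Space)} (hΘ : Ψ.IsImplementer S.grading Θ)
    (hUL : Ψ.IsImplementer βL UL) (hUR : Ψ.IsImplementer βR UR) {c : ℂ}
    (hc : ∀ x, (UL : Ψ.Space →L[ℂ] Ψ.Space) ((UR : Ψ.Space →L[ℂ] Ψ.Space) x) =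
      c • (UR : Ψ.Space →L[ℂ] Ψ.Space) ((UL : Ψ.Space →L[ℂ] Ψ.Space) x))
    {εL εR : Fin 2} (hεL : HasParity Θ UL εL) (hεR : HasParity Θ UR εR) :
    c = (-1 : ℂ) ^ ((εL : ℕ) * (εR : ℕ)) := by
  obtain ⟨S', Ψ', Φ, hΦ, S₀, Ψ₀, hΨ₀, hphase⟩ := hinv
  obtain ⟨P, hgen, hL, hR, hBB, hA0B1, hA0B2, hA2B0, hA2B3⟩ :=
    exists_partition S hapex hdisj hbdry
      ((Set.countable_range (S.stack S').pos).union (Set.countable_range S₀.pos))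
  obtain ⟨T₀, T₁, τ₀, τ₁, E₀, E₁, φ, α, -, hτ₁, hE₀, hE₁, hφ, hαg, hα, hequiv⟩ := hphase 2 P
    (fun a => ⟨fun j => (hgen a _ (Or.inl ⟨j, rfl⟩)).1, fun j => (hgen a _ (Or.inl ⟨j, rfl⟩)).2⟩)
    (fun a => ⟨fun j => (hgen a _ (Or.inr ⟨j, rfl⟩)).1, fun j => (hgen a _ (Or.inr ⟨j, rfl⟩)).2⟩)
  have hA : ∀ a b, (P.A a).region ⊆ (P.A b).regionᶜ ∨ Disjoint (P.A a).region (P.A b).regionᶜ := by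
    intro a b
    by_cases h : a = b
    · exact Or.inr (h ▸ disjoint_compl_right)
    · exact Or.inl (Set.subset_compl_iff_disjoint_right.2 (P.disjoint_A h))
  -- The cone `A_0` is enlarged by the two cones `B` at its edges, so that no cone `B` crosses the
  -- boundary of the region. It still avoids `A_2`.
  set X : Set Plane := (P.A 0).region ∪ ((P.B 0).region ∪ (P.B 3).region) with hX
  have hBX : ∀ a, (P.B a).region ⊆ X ∨ Disjoint (P.B a).region X := by
    intro a
    fin_cases a
    · exact Or.inl (Set.subset_union_left.trans Set.subset_union_right)
    · exact Or.inr (Set.disjoint_union_right.2 ⟨hA0B1.symm,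
        Set.disjoint_union_right.2 ⟨hBB (by decide), hBB (by decide)⟩⟩)
    · exact Or.inr (Set.disjoint_union_right.2 ⟨hA0B2.symm,
        Set.disjoint_union_right.2 ⟨hBB (by decide), hBB (by decide)⟩⟩)
    · exact Or.inl (Set.subset_union_right.trans Set.subset_union_right)
  have hX2 : X ⊆ (P.A 2).regionᶜ := by
    rw [Set.subset_compl_iff_disjoint_left]
    exact Set.disjoint_union_right.2 ⟨P.disjoint_A (by decide),
      Set.disjoint_union_right.2 ⟨hA2B0, hA2B3⟩⟩
  refine graded_commute_of_disentangled hpure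
    (e := fun m => ((S.stack S').stackInl T₀ (S.stackInl S' (m, true))).1) (fun m => rfl)
    (fun w => ?_) hΨ₀ hτ₁ hE₁ hφ hαg hequiv (X := X) (YL := (P.A 0).region) (YR := (P.A 2).region)
    (fun a ha => hα.apply_mem (Set.compl_subset_compl.2 Set.subset_union_left) (fun a => ?_)
      (fun a => hA a 0) ha)
    (fun a ha => hα.apply_mem hX2 hBX (fun a => hA a 2) ha)
    (fun m b hm => hβL.2 _ (S.γ_mem_localAlgebra (X := BL.regionᶜ) (fun h => hm (hL _ h)) b))
    (fun m b hm => hβR.2 _ (S.γ_mem_localAlgebra (X := BR.regionᶜ) (fun h => hm (hR _ h)) b))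
    hΘ hUL hUR hc hεL hεR
  · rw [← functional_word_map_stackInl hΦ, ← functional_word_map_stackInl hE₀, List.map_map]
    rfl
  · rcases hBX a with h | h
    · exact Or.inr (Set.disjoint_compl_right_iff_subset.2 h)
    · exact Or.inl (Set.subset_compl_iff_disjoint_right.2 h)

end Conclusion
end
end Spin

theorem mainTheorem8 {κ : Spin.Statistics} (S : Spin.SpinSystem κ)
    (Ψ : Spin.State S.Observables) (hpure : Ψ.IsPure) (hinv : Spin.IsInvertible Ψ)
    (BL BR : Spin.Cone) (hapex : BL.apex = BR.apex) (hdisj : Disjoint BL.region BR.region)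
    (hbdry : BL.boundary ∩ BR.boundary = {BL.apex})
    (βL βR : S.Observables ≃⋆ₐ[ℂ] S.Observables)
    (hβL : S.IsLocalizedIn BL.region βL) (hβR : S.IsLocalizedIn BR.region βR)
    (hL : (Ψ.comp βL).UnitarilyEquivalent Ψ) (hR : (Ψ.comp βR).UnitarilyEquivalent Ψ)
    (Θ UL UR : unitary (Ψ.Space →L[ℂ] Ψ.Space)) (hΘ : Ψ.IsImplementer S.grading Θ)
    (hUL : Ψ.IsImplementer βL UL) (hUR : Ψ.IsImplementer βR UR) :
    ((S.IsGraded βL ∨ ∃ j, S.pos j ∉ BL.region) → ∃! εL : Fin 2, Spin.HasParity Θ UL εL) ∧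
    ((S.IsGraded βR ∨ ∃ j, S.pos j ∉ BR.region) → ∃! εR : Fin 2, Spin.HasParity Θ UR εR) ∧
    ∀ εL εR : Fin 2, Spin.HasParity Θ UL εL → Spin.HasParity Θ UR εR →
      (UL : Ψ.Space →L[ℂ] Ψ.Space) * (UR : Ψ.Space →L[ℂ] Ψ.Space) =
        (-1 : ℂ) ^ ((εL : ℕ) * (εR : ℕ)) •
          ((UR : Ψ.Space →L[ℂ] Ψ.Space) * (UL : Ψ.Space →L[ℂ] Ψ.Space)) := by
  refine ⟨fun h => ?_, fun h => ?_, fun εL εR hεL hεR => ?_⟩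
  · exact Spin.existsUnique_hasParity hpure hΘ hUL (h.elim id hβL.isGraded)
  · exact Spin.existsUnique_hasParity hpure hΘ hUR (h.elim id hβR.isGraded)
  -- Automorphisms of disjoint regions commute even when they are not graded: on each generator at
  -- least one of them acts trivially.
  · obtain ⟨c, hc⟩ :=
      Spin.exists_implementers_commute_smul hpure hUL hUR (hβL.commute hdisj hβR)
    have hsign := Spin.graded_commute_of_isInvertible hpure hinv hapex hdisj hbdry hβL hβR hΘ hUL
      hUR hc hεL hεR
    rw [hsign] at hc
    exact ContinuousLinearMap.ext hc
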